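/- Let $d_A\in\{2,3\}$ and $d_B\ge d_A$ be integers, and let $U$ be a unitary operator on $\mathbb{C}^{d_A}\otimes\mathbb{C}^{d_B}$ of Schmidt rank $3$, that is, $U=\sum_{j=1}^{3}S_j\otimes T_j$ with linearly independent $d_A\times d_A$ matrices $S_1,S_2,S_3$ and linearly independent $d_B\times d_B$ matrices $T_1,T_2,T_3$. Put $k=\min\{d_A^2,d_B\}$ and let $|\Psi_k\rangle=\frac{1}{\sqrt k}\sum_{i=1}^{k}|i\rangle\otimes|i\rangle\in\mathbb{C}^k\otimes\mathbb{C}^k$ be the maximally entangled state of Schmidt rank $k$. Then $U$ can be implemented, deterministically and exactly, by local operations and classical communication (LOCC) and one copy of $|\Psi_k\rangle$ shared by Alice and Bob. That is, there is a finite-round LOCC protocol, in which Alice acts on $\mathbb{C}^{d_A}\otimes\mathbb{C}^k$ (her input and her half of $|\Psi_k\rangle$) and Bob acts on $\mathbb{C}^{d_B}\otimes\mathbb{C}^k$ (his input and his half of $|\Psi_k\rangle$), whose total map $\Lambda$ (averaged over all measurement outcomes) satisfies $$\Lambda\bigl(\rho\otimes|\Psi_k\rangle\langle\Psi_k|\bigr)=U\rho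 U^\dagger$$ for every operator $\rho$ on $\mathbb{C}^{d_A}\otimes\mathbb{C}^{d_B}$. Here a finite-round LOCC protocol is a finite sequence of rounds in each of which one party performs a measurement on his or her own system, given by finitely many Kraus operators $K_i$ with $\sum_i K_i^\dagger K_i=I$ (the output dimension may differ from the input dimension), and communicates the outcome $i$ to the other party; all later operations may depend on the earlier outcomes. -/

import Mathlib

open scoped Kronecker

/-- A bipartite operator `U` on `ℂ^A ⊗ ℂ^B` has Schmidt rank `n`: it is a sum of `n` product
operators with linearly independent factors on each side. -/
def HasSchmidtRank {A B : Type} (U : Matrix (A × B) (A × B) ℂ) (n : ℕ) : Prop :=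
  ∃ (S : Fin n → Matrix A A ℂ) (T : Fin n → Matrix B B ℂ),
    LinearIndependent ℂ S ∧ LinearIndependent ℂ T ∧ U = ∑ j, S j ⊗ₖ T j

/-- `IsLOCC Λ`: the map `Λ` from operators on `ℂ^A ⊗ ℂ^B` to operators on `ℂ^A' ⊗ ℂ^B'` is
realized by a finite-round protocol of local operations and classical communication, Alice holding
the first tensor factor and Bob the second.

Either the protocol is over (`done`), or one party performs a quantum measurement on his or her
system, given by finitely many Kraus operators `K i` with `∑ i, (K i)† (K i) = 1`, and communicates
the outcome `i`; the two then go on with an LOCC protocol that may depend on `i`. The dimension of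
the measured system may change, also depending on `i`, so this includes adding and discarding local
ancillas, local unitaries and local randomness. The final state is averaged over all outcomes. -/
inductive IsLOCC {A' B' : Type} : {A B : Type} →
    (Matrix (A × B) (A × B) ℂ → Matrix (A' × B') (A' × B') ℂ) → Prop
  | done : IsLOCC (fun ρ : Matrix (A' × B') (A' × B') ℂ => ρ)
  | alice {A B : Type} [Fintype A] [DecidableEq A] [Fintype B] [DecidableEq B]
      {ι : Type} [Fintype ι] {C : ι → Type} [∀ i, Fintype (C i)]
      (K : ∀ i, Matrix (C i) A ℂ) (hK : ∑ i, (K i).conjTranspose * K i = 1)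
      (Λ : ∀ i, Matrix (C i × B) (C i × B) ℂ → Matrix (A' × B') (A' × B') ℂ)
      (hΛ : ∀ i, IsLOCC (Λ i)) :
      IsLOCC (fun ρ : Matrix (A × B) (A × B) ℂ =>
        ∑ i, Λ i ((K i ⊗ₖ (1 : Matrix B B ℂ)) * ρ * (K i ⊗ₖ (1 : Matrix B B ℂ)).conjTranspose))
  | bob {A B : Type} [Fintype A] [DecidableEq A] [Fintype B] [DecidableEq B]
      {ι : Type} [Fintype ι] {C : ι → Type} [∀ i, Fintype (C i)]
      (K : ∀ i, Matrix (C i) B ℂ) (hK : ∑ i, (K i).conjTranspose * K i = 1)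
      (Λ : ∀ i, Matrix (A × C i) (A × C i) ℂ → Matrix (A' × B') (A' × B') ℂ)
      (hΛ : ∀ i, IsLOCC (Λ i)) :
      IsLOCC (fun ρ : Matrix (A × B) (A × B) ℂ =>
        ∑ i, Λ i (((1 : Matrix A A ℂ) ⊗ₖ K i) * ρ * ((1 : Matrix A A ℂ) ⊗ₖ K i).conjTranspose))

/-- The vector `|Ψ_k⟩ = (1/√k) ∑ i, |i i⟩`. -/
noncomputable def maxEntangledKet (k : ℕ) : Fin k × Fin k → ℂ :=
  fun p => if p.1 = p.2 then ((1 / Real.sqrt k : ℝ) : ℂ) else 0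

/-- The density operator `|Ψ_k⟩⟨Ψ_k|`. -/
noncomputable def maxEntangledState (k : ℕ) : Matrix (Fin k × Fin k) (Fin k × Fin k) ℂ :=
  Matrix.vecMulVec (maxEntangledKet k) (star (maxEntangledKet k))

/-- The joint operator `ρ ⊗ σ` of two bipartite systems `A B` and `X Y`, regrouped so that Alice
holds `A X` and Bob holds `B Y`. -/
def bipartiteTensor {A B X Y : Type} (ρ : Matrix (A × B) (A × B) ℂ)
    (σ : Matrix (X × Y) (X × Y) ℂ) : Matrix ((A × X) × (B × Y)) ((A × X) × (B × Y)) ℂ :=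
  (ρ ⊗ₖ σ).submatrix (Equiv.prodProdProdComm A X B Y) (Equiv.prodProdProdComm A X B Y)

/-- The unitary `U` can be implemented (deterministically and exactly) by LOCC with the help of one
copy of `|Ψ_k⟩`: some LOCC map sends `ρ ⊗ |Ψ_k⟩⟨Ψ_k|` to `U ρ U†`. This is asked of every operator
`ρ`, that is, as an equality of linear maps, so it also holds for inputs entangled with a
reference system. -/
def ImplementableByLOCC {A B : Type} [Fintype A] [Fintype B]
    (U : Matrix (A × B) (A × B) ℂ) (k : ℕ) : Prop :=
  ∃ Λ : Matrix ((A × Fin k) × (B × Fin k)) ((A × Fin k) × (B × Fin k)) ℂ →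
      Matrix (A × B) (A × B) ℂ,
    IsLOCC Λ ∧ ∀ ρ : Matrix (A × B) (A × B) ℂ,
      Λ (bipartiteTensor ρ (maxEntangledState k)) = U * ρ * U.conjTranspose

/-! If `dA ^ 2 ≤ dB`, then `k = dA ^ 2` and two-way teleportation suffices: `|Ψ_k⟩` is a pair of
maximally entangled states of dimension `dA`, one carrying Alice's system to Bob, who applies `U`,
the other carrying it back (`implementableByLOCC_of_unitary`).

Otherwise `k = dB ≥ dA`, and the point is that `U` is a controlled unitary, with control on one of
the two sides: in suitable orthonormal bases of source and target, all `S l` or all `T l` are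
diagonal (`SimDiag`). A controlled unitary costs a maximally entangled state whose dimension is at
least that of the control (`implementableByLOCC_of_controlled`), and `dB` is enough for either side.

The classification works with coordinate-free maps between inner product spaces of equal dimension,
so that pieces of `U` are again of the same kind. If all `T l` map a subspace into another one of
the same dimension, they also map the orthogonal complements into each other
(`IsometricSum.map_orthogonal`), which permits induction on the dimension. In particular it is
enough to find, again and again, a vector that all `T l` send into one line.

For a two-dimensional Alice, orthonormal bases can be chosen in which `U` is, up to a phase, a block
matrix with equal diagonal blocks. Unitarity then makes the products `x† y` of its blocks that
matter commute, and a common eigenvector gives the line. A sum of two terms is settled by an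
eigenvalue argument.

For a three-dimensional Alice, a splitting on either side reduces to smaller cases. If neither side
splits, compare the spans of the Gram matrices `⟪S l a, S m a'⟫` and `⟪T l v, T m v'⟫`. Isometry
makes them orthogonal up to one dimension in the nine-dimensional matrix space, so their dimensions
add up to at most 10 (`IsometricSum.finrank_gramSpan_add_le`). But the second has dimension at least
5 (`IsometricSum.five_le_finrank_gramSpan`) and the first at least 6
(`IsometricSum.six_le_finrank_gramSpan`), a contradiction. -/

open scoped TensorProduct
open Module

/-! ### Isometries given as sums of tensor products -/

section IsometricSum

variable {E E' F F' : Type*}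
  [NormedAddCommGroup E] [InnerProductSpace ℂ E] [NormedAddCommGroup E'] [InnerProductSpace ℂ E']
  [NormedAddCommGroup F] [InnerProductSpace ℂ F] [NormedAddCommGroup F'] [InnerProductSpace ℂ F']
  {ι κ : Type*} [Fintype ι] [Fintype κ]

/-- The operator `∑ l, S l ⊗ T l`. -/
noncomputable def tensorSum (S : ι → E →ₗ[ℂ] E') (T : ι → F →ₗ[ℂ] F') :
    E ⊗[ℂ] F →ₗ[ℂ] E' ⊗[ℂ] F' :=
  ∑ l, TensorProduct.map (S l) (T l)

/-- The operator `∑ l, S l ⊗ T l` preserves inner products of product vectors. -/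
def IsometricSum (S : ι → E →ₗ[ℂ] E') (T : ι → F →ₗ[ℂ] F') : Prop :=
  ∀ a a' v v', ∑ l, ∑ m, inner ℂ (S l a) (S m a') * inner ℂ (T l v) (T m v') =
    inner ℂ a a' * inner ℂ v v'

theorem tensorSum_tmul (S : ι → E →ₗ[ℂ] E') (T : ι → F →ₗ[ℂ] F') (a : E) (v : F) :
    tensorSum S T (a ⊗ₜ v) = ∑ l, S l a ⊗ₜ[ℂ] T l v := by
  simp [tensorSum]

theorem isometricSum_iff {S : ι → E →ₗ[ℂ] E'} {T : ι → F →ₗ[ℂ] F'} :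
    IsometricSum S T ↔ ∀ a a' v v', inner ℂ (tensorSum S T (a ⊗ₜ v)) (tensorSum S T (a' ⊗ₜ v')) =
      inner ℂ a a' * inner ℂ v v' := by
  simp only [IsometricSum, tensorSum_tmul, sum_inner, inner_sum, TensorProduct.inner_tmul]
  refine forall₄_congr fun a a' v v' => ?_
  rw [Finset.sum_comm]

theorem IsometricSum.inner_tensorSum {S : ι → E →ₗ[ℂ] E'} {T : ι → F →ₗ[ℂ] F'}
    (h : IsometricSum S T) (x y : E ⊗[ℂ] F) :
    inner ℂ (tensorSum S T x) (tensorSum S T y) = inner ℂ x y := by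
  rw [isometricSum_iff] at h
  induction x with
  | zero => simp
  | add x x' hx hx' => rw [map_add, inner_add_left, hx, hx', inner_add_left]
  | tmul a v =>
    induction y with
    | zero => simp
    | add x x' hx hx' => rw [map_add, inner_add_right, hx, hx', inner_add_right]
    | tmul a' v' => rw [h, TensorProduct.inner_tmul]

theorem IsometricSum.injective {S : ι → E →ₗ[ℂ] E'} {T : ι → F →ₗ[ℂ] F'}
    (h : IsometricSum S T) : Function.Injective (tensorSum S T) := by
  rw [injective_iff_map_eq_zero]
  intro x hx
  rw [← inner_self_eq_zero (𝕜 := ℂ), ← h.inner_tensorSum, hx, inner_zero_left]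

theorem IsometricSum.symm {S : ι → E →ₗ[ℂ] E'} {T : ι → F →ₗ[ℂ] F'}
    (h : IsometricSum S T) : IsometricSum T S := by
  intro a a' v v'
  rw [mul_comm, ← h v v' a a']
  simp only [mul_comm]

theorem tensorSum_change (S : ι → E →ₗ[ℂ] E') {T : ι → F →ₗ[ℂ] F'} {T' : κ → F →ₗ[ℂ] F'}
    (c : Matrix ι κ ℂ) (hc : ∀ l, T l = ∑ m, c l m • T' m) :
    tensorSum S T = tensorSum (fun m => ∑ l, c l m • S l) T' := by
  ext a v
  simp only [TensorProduct.AlgebraTensorModule.curry_apply, LinearMap.restrictScalars_self,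
    TensorProduct.curry_apply, tensorSum_tmul, hc, LinearMap.sum_apply, LinearMap.smul_apply,
    TensorProduct.tmul_sum, TensorProduct.sum_tmul, TensorProduct.tmul_smul,
    TensorProduct.smul_tmul']
  rw [Finset.sum_comm]

/-- Isometry concerns only the total operator, so either family may be re-expanded if the other
absorbs the coefficients. -/
theorem IsometricSum.change {S : ι → E →ₗ[ℂ] E'} {T : ι → F →ₗ[ℂ] F'} {T' : κ → F →ₗ[ℂ] F'}
    (h : IsometricSum S T) (c : Matrix ι κ ℂ) (hc : ∀ l, T l = ∑ m, c l m • T' m) :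
    IsometricSum (fun m => ∑ l, c l m • S l) T' := by
  rw [isometricSum_iff, ← tensorSum_change S c hc]
  exact isometricSum_iff.1 h

theorem IsometricSum.restrict {S : ι → E →ₗ[ℂ] E'} {T : ι → F →ₗ[ℂ] F'}
    (h : IsometricSum S T) {V : Submodule ℂ F} {W : Submodule ℂ F'}
    (hVW : ∀ l, ∀ v ∈ V, T l v ∈ W) : IsometricSum S (fun l => (T l).restrict (hVW l)) := by
  intro a a' v v'
  simpa [Submodule.coe_inner] using h a a' v v'

/-- The isometry embeds `E ⊗ V` into `E' ⊗ W`; cancel the common dimension of `E` and `E'`. -/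
theorem IsometricSum.finrank_le [FiniteDimensional ℂ E] [FiniteDimensional ℂ E']
    [FiniteDimensional ℂ F] [FiniteDimensional ℂ F']
    {S : ι → E →ₗ[ℂ] E'} {T : ι → F →ₗ[ℂ] F'}
    (h : IsometricSum S T) (hE : finrank ℂ E = finrank ℂ E') (hE0 : 0 < finrank ℂ E)
    {V : Submodule ℂ F} {W : Submodule ℂ F'}
    (hVW : ∀ l, ∀ v ∈ V, T l v ∈ W) : finrank ℂ V ≤ finrank ℂ W := by
  have h1 := LinearMap.finrank_le_finrank_of_injective (h.restrict hVW).injective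
  rw [finrank_tensorProduct, finrank_tensorProduct, ← hE] at h1
  exact Nat.le_of_mul_le_mul_left h1 hE0

/-- Coefficients `⟪b, S l a⟫` of a linearly independent family separate. -/
theorem mem_of_forall_sum_inner_smul_mem {S : ι → E →ₗ[ℂ] E'} (hS : LinearIndependent ℂ S)
    {X : Type*} [AddCommGroup X] [Module ℂ X] {x : ι → X} {W : Submodule ℂ X}
    (h : ∀ a b, ∑ l, inner ℂ b (S l a) • x l ∈ W) (l : ι) : x l ∈ W := by
  rw [← Submodule.Quotient.mk_eq_zero, ← Module.forall_dual_apply_eq_zero_iff ℂ]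
  intro φ
  refine Fintype.linearIndependent_iff.1 hS (fun l => φ (W.mkQ (x l))) ?_ l
  ext a
  refine ext_inner_left ℂ fun b => ?_
  have := (Submodule.Quotient.mk_eq_zero W).2 (h a b)
  rw [← Submodule.mkQ_apply, map_sum] at this
  have := congrArg φ this
  simp only [map_smul, map_sum, map_zero, smul_eq_mul] at this
  simp only [LinearMap.sum_apply, LinearMap.smul_apply, inner_sum, inner_smul_right,
    LinearMap.zero_apply, inner_zero_right]
  rw [← this]
  exact Finset.sum_congr rfl fun _ _ => mul_comm _ _

/-- If an isometric sum maps `V` into a space `W` of the same dimension, it maps `Vᗮ` into `Wᗮ`. -/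
theorem IsometricSum.map_orthogonal [FiniteDimensional ℂ E] [FiniteDimensional ℂ E']
    [FiniteDimensional ℂ F] [FiniteDimensional ℂ F']
    {S : ι → E →ₗ[ℂ] E'} {T : ι → F →ₗ[ℂ] F'}
    (h : IsometricSum S T) (hE : finrank ℂ E = finrank ℂ E') (hS : LinearIndependent ℂ S)
    {V : Submodule ℂ F} {W : Submodule ℂ F'} (hd : finrank ℂ V = finrank ℂ W)
    (hVW : ∀ l, ∀ v ∈ V, T l v ∈ W) : ∀ l, ∀ v ∈ Vᗮ, T l v ∈ Wᗮ := by
  have hsurj : Function.Surjective (tensorSum S fun l => (T l).restrict (hVW l)) := by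
    rw [← LinearMap.injective_iff_surjective_of_finrank_eq_finrank]
    · exact (h.restrict hVW).injective
    · rw [finrank_tensorProduct, finrank_tensorProduct, hE, hd]
  have hincl : ∀ y, tensorSum S T (LinearMap.lTensor E V.subtype y) =
      LinearMap.lTensor E' W.subtype (tensorSum S (fun l => (T l).restrict (hVW l)) y) := by
    intro y
    induction y with
    | zero => simp
    | add x y hx hy => simp only [map_add, hx, hy]
    | tmul a v => simp [tensorSum_tmul]
  intro l v hv
  refine mem_of_forall_sum_inner_smul_mem hS (x := fun l => T l v) (fun a b => ?_) l
  rw [Submodule.mem_orthogonal]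
  intro w hw
  -- By surjectivity every `b ⊗ w` is the image of a vector of `E ⊗ V`, which is orthogonal to `a ⊗
  -- v`. The coefficients of `S` then separate the individual `T l v`.
  obtain ⟨y, hy⟩ := hsurj (b ⊗ₜ (⟨w, hw⟩ : W))
  have h1 : inner ℂ (b ⊗ₜ[ℂ] w) (tensorSum S T (a ⊗ₜ v)) = 0 := by
    have h2 : b ⊗ₜ[ℂ] w = tensorSum S T (LinearMap.lTensor E V.subtype y) := by
      rw [hincl, hy]; simp
    rw [h2, h.inner_tensorSum]
    clear h2 hy
    induction y with
    | zero => simp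
    | add x y hx hy => rw [map_add, inner_add_left, hx, hy, add_zero]
    | tmul a' v' =>
      simp only [LinearMap.lTensor_tmul, Submodule.subtype_apply, TensorProduct.inner_tmul]
      rw [Submodule.mem_orthogonal] at hv
      rw [hv _ v'.2, mul_zero]
  rw [tensorSum_tmul] at h1
  simpa [inner_sum, inner_smul_right] using h1

/-- The adjoint of an isometric sum between spaces of equal dimensions is isometric. -/
theorem IsometricSum.adjoint [FiniteDimensional ℂ E] [FiniteDimensional ℂ E']
    [FiniteDimensional ℂ F] [FiniteDimensional ℂ F']
    {S : ι → E →ₗ[ℂ] E'} {T : ι → F →ₗ[ℂ] F'}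
    (h : IsometricSum S T) (hE : finrank ℂ E = finrank ℂ E') (hF : finrank ℂ F = finrank ℂ F') :
    IsometricSum (fun l => (S l).adjoint) (fun l => (T l).adjoint) := by
  have hadj : tensorSum (fun l => (S l).adjoint) (fun l => (T l).adjoint) =
      (tensorSum S T).adjoint := by
    simp only [tensorSum, map_sum]
    refine Finset.sum_congr rfl fun l _ => ?_
    simp
  have hsurj : Function.Surjective (tensorSum S T) := by
    rw [← LinearMap.injective_iff_surjective_of_finrank_eq_finrank]
    · exact h.injective
    · rw [finrank_tensorProduct, finrank_tensorProduct, hE, hF]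
  have hleft : ∀ x, (tensorSum S T).adjoint (tensorSum S T x) = x := fun x =>
    ext_inner_left ℂ fun y => by rw [LinearMap.adjoint_inner_right, h.inner_tensorSum]
  rw [isometricSum_iff, hadj]
  intro a a' v v'
  obtain ⟨x, hx⟩ := hsurj (a ⊗ₜ v)
  obtain ⟨y, hy⟩ := hsurj (a' ⊗ₜ v')
  rw [← hx, ← hy, hleft, hleft, ← h.inner_tensorSum, hx, hy, TensorProduct.inner_tmul]

end IsometricSum

/-! ### Simultaneous diagonalization, common lines and splittings -/

section SimDiag

variable {F F' : Type*}
  [NormedAddCommGroup F] [InnerProductSpace ℂ F] [NormedAddCommGroup F'] [InnerProductSpace ℂ F']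
  {ι κ : Type*}

/-- The maps `T l` are simultaneously diagonal with respect to a suitable pair of orthonormal
bases. -/
def SimDiag (T : ι → F →ₗ[ℂ] F') : Prop :=
  ∃ (n : ℕ) (f : OrthonormalBasis (Fin n) ℂ F) (g : OrthonormalBasis (Fin n) ℂ F'),
    ∀ l i, ∃ c : ℂ, T l (f i) = c • g i

/-- The maps `T l` send some nonzero vector into a common line. -/
def HasLine (T : ι → F →ₗ[ℂ] F') : Prop :=
  ∃ v : F, v ≠ 0 ∧ ∃ w : F', ∀ l, ∃ c : ℂ, T l v = c • w

/-- The maps `T l` send some proper nonzero subspace into a common subspace of the same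
dimension. -/
def Splits (T : ι → F →ₗ[ℂ] F') : Prop :=
  ∃ (V : Submodule ℂ F) (W : Submodule ℂ F'), finrank ℂ V = finrank ℂ W ∧ 0 < finrank ℂ V ∧
    finrank ℂ V < finrank ℂ F ∧ ∀ l, ∀ v ∈ V, T l v ∈ W

/-- This property and the two below depend only on the span of the family, so they survive the
changes of family made later. -/
theorem SimDiag.of_combination [Fintype κ] {T : ι → F →ₗ[ℂ] F'} {T' : κ → F →ₗ[ℂ] F'}
    (h : SimDiag T') (c : Matrix ι κ ℂ) (hc : ∀ l, T l = ∑ m, c l m • T' m) : SimDiag T := by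
  obtain ⟨n, f, g, h⟩ := h
  choose d hd using h
  refine ⟨n, f, g, fun l i => ⟨∑ m, c l m * d m i, ?_⟩⟩
  simp [hc, hd, Finset.sum_smul, mul_smul]

theorem HasLine.of_combination [Fintype κ] {T : ι → F →ₗ[ℂ] F'} {T' : κ → F →ₗ[ℂ] F'}
    (h : HasLine T') (c : Matrix ι κ ℂ) (hc : ∀ l, T l = ∑ m, c l m • T' m) : HasLine T := by
  obtain ⟨v, hv, w, h⟩ := h
  choose d hd using h
  refine ⟨v, hv, w, fun l => ⟨∑ m, c l m * d m, ?_⟩⟩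
  simp [hc, hd, Finset.sum_smul, mul_smul]

theorem Splits.of_combination [Fintype κ] {T : ι → F →ₗ[ℂ] F'} {T' : κ → F →ₗ[ℂ] F'}
    (h : Splits T') (c : Matrix ι κ ℂ) (hc : ∀ l, T l = ∑ m, c l m • T' m) : Splits T := by
  obtain ⟨V, W, h1, h2, h3, h⟩ := h
  refine ⟨V, W, h1, h2, h3, fun l v hv => ?_⟩
  simp only [hc, LinearMap.sum_apply, LinearMap.smul_apply]
  exact Submodule.sum_mem _ fun m _ => Submodule.smul_mem _ _ (h m v hv)

theorem simDiag_of_finrank_eq_zero [FiniteDimensional ℂ F] [FiniteDimensional ℂ F']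
    (T : ι → F →ₗ[ℂ] F') (hF : finrank ℂ F = 0) (hF' : finrank ℂ F' = 0) : SimDiag T :=
  ⟨0, (stdOrthonormalBasis ℂ F).reindex (finCongr hF),
    (stdOrthonormalBasis ℂ F').reindex (finCongr hF'), fun _ i => i.elim0⟩

theorem simDiag_of_finrank_eq_one [FiniteDimensional ℂ F] [FiniteDimensional ℂ F']
    (T : ι → F →ₗ[ℂ] F') (hF : finrank ℂ F = 1) (hF' : finrank ℂ F' = 1) : SimDiag T := by
  set f := (stdOrthonormalBasis ℂ F).reindex (finCongr hF)
  set g := (stdOrthonormalBasis ℂ F').reindex (finCongr hF')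
  refine ⟨1, f, g, fun l i => ⟨g.repr (T l (f i)) i, ?_⟩⟩
  have h := g.sum_repr (T l (f i))
  rw [Fin.sum_univ_one] at h
  rw [Subsingleton.elim i 0] at h ⊢
  exact h.symm

theorem simDiag_of_restrict [FiniteDimensional ℂ F] [FiniteDimensional ℂ F']
    {T : ι → F →ₗ[ℂ] F'} {V : Submodule ℂ F} {W : Submodule ℂ F'}
    (hVW : ∀ l, ∀ v ∈ V, T l v ∈ W) (hVW' : ∀ l, ∀ v ∈ Vᗮ, T l v ∈ Wᗮ)
    (h : SimDiag fun l => (T l).restrict (hVW l))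
    (h' : SimDiag fun l => (T l).restrict (hVW' l)) : SimDiag T := by
  obtain ⟨n, f, g, h⟩ := h
  obtain ⟨n', f', g', h'⟩ := h'
  refine ⟨n + n', ((f.prod f').map V.orthogonalDecomposition.symm).reindex finSumFinEquiv,
    ((g.prod g').map W.orthogonalDecomposition.symm).reindex finSumFinEquiv, fun l i => ?_⟩
  obtain ⟨i, rfl⟩ := finSumFinEquiv.surjective i
  rcases i with i | i
  · obtain ⟨c, hc⟩ := h l i
    refine ⟨c, ?_⟩
    have := congrArg Subtype.val hc
    simpa using this
  · obtain ⟨c, hc⟩ := h' l i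
    refine ⟨c, ?_⟩
    have := congrArg Subtype.val hc
    simpa using this

end SimDiag

/-! ### Induction by splitting off lines -/

section Induction

universe u v

variable {E E' : Type*}
  [NormedAddCommGroup E] [InnerProductSpace ℂ E] [NormedAddCommGroup E'] [InnerProductSpace ℂ E']
  [FiniteDimensional ℂ E] {ι : Type*} [Fintype ι]

theorem IsometricSum.eq_zero {F F' : Type*}
    [NormedAddCommGroup F] [InnerProductSpace ℂ F] [NormedAddCommGroup F'] [InnerProductSpace ℂ F']
    {S : ι → E →ₗ[ℂ] E'} {T : ι → F →ₗ[ℂ] F'} (h : IsometricSum S T) (hE0 : 0 < finrank ℂ E)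
    {v : F} (hv : ∀ l, T l v = 0) : v = 0 := by
  have : Nontrivial E := finrank_pos_iff.1 hE0
  obtain ⟨a, ha⟩ := exists_ne (0 : E)
  simpa [hv, ha] using (h a a v v).symm

/-- An isometric sum leaves no nonzero common kernel for the `T l`, so the target of the common line
is itself a line. -/
theorem IsometricSum.splits_of_hasLine {F F' : Type*}
    [NormedAddCommGroup F] [InnerProductSpace ℂ F] [NormedAddCommGroup F'] [InnerProductSpace ℂ F']
    {S : ι → E →ₗ[ℂ] E'} {T : ι → F →ₗ[ℂ] F'} (h : IsometricSum S T) (hE0 : 0 < finrank ℂ E)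
    (hT : HasLine T) (hF : 2 ≤ finrank ℂ F) : Splits T := by
  obtain ⟨v, hv, w, hw⟩ := hT
  have hw0 : w ≠ 0 := by
    rintro rfl
    exact hv (h.eq_zero hE0 fun l => by simpa using hw l)
  refine ⟨Submodule.span ℂ {v}, Submodule.span ℂ {w}, ?_, ?_, ?_, fun l x hx => ?_⟩
  · rw [finrank_span_singleton hv, finrank_span_singleton hw0]
  · rw [finrank_span_singleton hv]; exact one_pos
  · rw [finrank_span_singleton hv]; exact hF
  · obtain ⟨c, rfl⟩ := Submodule.mem_span_singleton.1 hx
    obtain ⟨d, hd⟩ := hw l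
    rw [map_smul, hd]
    exact Submodule.smul_mem _ _ (Submodule.smul_mem _ _ (Submodule.mem_span_singleton_self w))

theorem finrank_orthogonal_eq {F F' : Type*} [NormedAddCommGroup F] [InnerProductSpace ℂ F]
    [NormedAddCommGroup F'] [InnerProductSpace ℂ F'] [FiniteDimensional ℂ F]
    [FiniteDimensional ℂ F'] (hF : finrank ℂ F = finrank ℂ F') {V : Submodule ℂ F}
    {W : Submodule ℂ F'} (h : finrank ℂ V = finrank ℂ W) : finrank ℂ Vᗮ = finrank ℂ Wᗮ := by
  have h1 := V.finrank_add_finrank_orthogonal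
  have h2 := W.finrank_add_finrank_orthogonal
  lia

/-- Splitting off lines one by one. -/
theorem IsometricSum.simDiag_of_forall_hasLine [FiniteDimensional ℂ E'] {S : ι → E →ₗ[ℂ] E'}
    (hE : finrank ℂ E = finrank ℂ E') (hE0 : 0 < finrank ℂ E) (hS : LinearIndependent ℂ S)
    (H : ∀ (F : Type u) (F' : Type v) [NormedAddCommGroup F] [InnerProductSpace ℂ F]
      [NormedAddCommGroup F'] [InnerProductSpace ℂ F'] [FiniteDimensional ℂ F]
      [FiniteDimensional ℂ F'] (T : ι → F →ₗ[ℂ] F'), IsometricSum S T →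
      finrank ℂ F = finrank ℂ F' → 0 < finrank ℂ F → HasLine T)
    (n : ℕ) : ∀ (F : Type u) (F' : Type v) [NormedAddCommGroup F] [InnerProductSpace ℂ F]
      [NormedAddCommGroup F'] [InnerProductSpace ℂ F'] [FiniteDimensional ℂ F]
      [FiniteDimensional ℂ F'] (T : ι → F →ₗ[ℂ] F'), IsometricSum S T →
      finrank ℂ F = n → finrank ℂ F' = n → SimDiag T := by
  induction n using Nat.strong_induction_on with
  | _ n ih =>
    intro F F' _ _ _ _ _ _ T h hF hF'
    rcases Nat.lt_or_ge n 2 with hn | hn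
    · interval_cases n
      · exact simDiag_of_finrank_eq_zero T hF hF'
      · exact simDiag_of_finrank_eq_one T hF hF'
    · obtain ⟨V, W, h1, h2, h3, hVW⟩ :=
        h.splits_of_hasLine hE0 (H F F' T h (hF.trans hF'.symm) (by lia)) (by lia)
      have hVW' := h.map_orthogonal hE hS h1 hVW
      have h4 := V.finrank_add_finrank_orthogonal
      have h5 := finrank_orthogonal_eq (hF.trans hF'.symm) h1
      exact simDiag_of_restrict hVW hVW'
        (ih _ (by lia) _ _ _ (h.restrict hVW) rfl h1.symm)
        (ih _ (by lia) _ _ _ (h.restrict hVW') rfl h5.symm)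

end Induction

/-! ### Sums of two terms -/

section Pencil

variable {E E' F F' : Type*}
  [NormedAddCommGroup E] [InnerProductSpace ℂ E] [NormedAddCommGroup E'] [InnerProductSpace ℂ E']
  [NormedAddCommGroup F] [InnerProductSpace ℂ F] [NormedAddCommGroup F'] [InnerProductSpace ℂ F']
  [FiniteDimensional ℂ E] [FiniteDimensional ℂ E'] [FiniteDimensional ℂ F'] [FiniteDimensional ℂ F]

/-- Two linear maps between spaces of the same positive dimension have a singular combination. -/
theorem exists_singular_combination {V W : Type*} [AddCommGroup V] [Module ℂ V] [AddCommGroup W]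
    [Module ℂ W] [FiniteDimensional ℂ V] [FiniteDimensional ℂ W]
    (hVW : finrank ℂ V = finrank ℂ W) (h0 : 0 < finrank ℂ V) (A B : V →ₗ[ℂ] W) :
    ∃ v ≠ 0, ∃ x y : ℂ, (x ≠ 0 ∨ y ≠ 0) ∧ x • A v + y • B v = 0 := by
  have : Nontrivial V := finrank_pos_iff.1 h0
  by_cases hA : Function.Injective A
  · let e := LinearEquiv.ofInjectiveOfFinrankEq A hA hVW
    obtain ⟨μ, hμ⟩ := Module.End.exists_eigenvalue (e.symm.toLinearMap ∘ₗ B)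
    obtain ⟨v, hv⟩ := hμ.exists_hasEigenvector
    refine ⟨v, hv.2, -μ, 1, Or.inr one_ne_zero, ?_⟩
    have h1 : e.symm (B v) = μ • v := hv.apply_eq_smul
    have h2 : B v = μ • A v := by
      rw [LinearEquiv.symm_apply_eq] at h1
      rw [h1, map_smul]
      rfl
    rw [h2]; module
  · rw [injective_iff_map_eq_zero] at hA
    push Not at hA
    obtain ⟨v, hv, hv0⟩ := hA
    exact ⟨v, hv0, 1, 0, Or.inl one_ne_zero, by simp [hv]⟩

/-- Apply the existence of a singular combination twice. On the first side it yields `a` with `S 0 a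
= p • b` and `S 1 a = q • b`; isometry then makes `A = p • T 0 + q • T 1` injective. On the second
side, a singular combination of `A` with one of the `T l` makes `T 0 v` and `T 1 v` parallel. -/
theorem IsometricSum.hasLine_of_two {S : Fin 2 → E →ₗ[ℂ] E'} {T : Fin 2 → F →ₗ[ℂ] F'}
    (h : IsometricSum S T) (hE : finrank ℂ E = finrank ℂ E') (hE0 : 0 < finrank ℂ E)
    (hF : finrank ℂ F = finrank ℂ F') (hF0 : 0 < finrank ℂ F) : HasLine T := by
  obtain ⟨a, ha, x, y, hxy, hxya⟩ := exists_singular_combination hE hE0 (S 0) (S 1)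
  obtain ⟨b, p, q, hp, hq⟩ : ∃ (b : E') (p q : ℂ), S 0 a = p • b ∧ S 1 a = q • b := by
    by_cases hx : x = 0
    · have hy : y ≠ 0 := by simpa [hx] using hxy
      exact ⟨S 0 a, 1, 0, by simp, by simpa [hx, hy] using hxya⟩
    · refine ⟨S 1 a, -(x⁻¹ * y), 1, ?_, by simp⟩
      have : x⁻¹ • (x • S 0 a + y • S 1 a) = 0 := by rw [hxya, smul_zero]
      rw [smul_add, smul_smul, inv_mul_cancel₀ hx, one_smul, smul_smul] at this
      rw [neg_smul]
      exact eq_neg_of_add_eq_zero_left this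
  have hinj : ∀ v, p • T 0 v + q • T 1 v = 0 → v = 0 := by
    intro v hv
    have h1 : inner ℂ b b * inner ℂ (p • T 0 v + q • T 1 v) (p • T 0 v + q • T 1 v) =
        inner ℂ a a * inner ℂ v v := by
      rw [← h a a v v]
      simp only [Fin.sum_univ_two, hp, hq, inner_smul_left, inner_smul_right, inner_add_left,
        inner_add_right]
      ring
    simpa [hv, ha] using h1.symm
  let A : F →ₗ[ℂ] F' := p • T 0 + q • T 1
  have hA : Function.Injective A := (injective_iff_map_eq_zero A).2 hinj
  by_cases hpz : p = 0
  · obtain ⟨v, hv, x, y, hxy, hv'⟩ := exists_singular_combination hF hF0 (T 0) A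
    have hx : x ≠ 0 := by
      rintro rfl
      simp only [zero_smul, zero_add, ne_eq, not_true_eq_false, false_or, smul_eq_zero] at hxy hv'
      exact hv (hA (by simpa using hv'.resolve_left hxy))
    have hq0 : q ≠ 0 := by
      rintro rfl
      exact hv (hinj v (by simp [hpz]))
    refine ⟨v, hv, T 1 v, fun l => ?_⟩
    fin_cases l
    · refine ⟨-(x⁻¹ * (y * q)), ?_⟩
      have : x⁻¹ • (x • T 0 v + y • A v) = 0 := by rw [hv', smul_zero]
      rw [smul_add, smul_smul, inv_mul_cancel₀ hx, one_smul] at this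
      rw [neg_smul]
      refine eq_neg_of_add_eq_zero_left (Eq.trans ?_ this)
      simp [A, hpz, smul_smul]
    · exact ⟨1, by simp⟩
  · obtain ⟨v, hv, x, y, hxy, hv'⟩ := exists_singular_combination hF hF0 (T 1) A
    have hx : x ≠ 0 := by
      rintro rfl
      simp only [zero_smul, zero_add, ne_eq, not_true_eq_false, false_or, smul_eq_zero] at hxy hv'
      exact hv (hA (by simpa using hv'.resolve_left hxy))
    have h1 : T 1 v = -(x⁻¹ * y) • A v := by
      have : x⁻¹ • (x • T 1 v + y • A v) = 0 := by rw [hv', smul_zero]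
      rw [smul_add, smul_smul, inv_mul_cancel₀ hx, one_smul, smul_smul] at this
      rw [neg_smul]
      exact eq_neg_of_add_eq_zero_left this
    have h2 : T 0 v = p⁻¹ • A v + -(p⁻¹ * q) • T 1 v := by
      simp only [A, LinearMap.add_apply, LinearMap.smul_apply, smul_add, smul_smul,
        inv_mul_cancel₀ hpz]
      module
    refine ⟨v, hv, A v, fun l => ?_⟩
    fin_cases l
    · exact ⟨p⁻¹ + -(p⁻¹ * q) * -(x⁻¹ * y), by simp only [Fin.zero_eta]; rw [h2, h1]; module⟩
    · exact ⟨_, h1⟩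

end Pencil

/-! ### Common eigenvectors and unitary two-by-two block matrices -/

/-- A commuting set of operators on a nonzero space has a common eigenvector. -/
theorem exists_common_eigenvector {V : Type*} [AddCommGroup V] [Module ℂ V]
    [FiniteDimensional ℂ V] [Nontrivial V] (X : Set (End ℂ V))
    (hX : ∀ f ∈ X, ∀ g ∈ X, Commute f g) : ∃ v ≠ 0, ∀ f ∈ X, ∃ c : ℂ, f v = c • v := by
  suffices H : ∀ (n : ℕ) (W : Submodule ℂ V), finrank ℂ W = n → W ≠ ⊥ →
      (∀ f ∈ X, ∀ w ∈ W, f w ∈ W) → ∃ v ≠ 0, ∀ f ∈ X, ∃ c : ℂ, f v = c • v from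
    H _ ⊤ rfl top_ne_bot fun _ _ _ _ => Submodule.mem_top
  intro n
  induction n using Nat.strong_induction_on with
  | _ n ih =>
    intro W hn hW hinv
    -- If some `f` is not scalar on the invariant subspace `W`, one of its eigenspaces cuts `W` down
    -- properly, and commutation keeps the piece invariant.
    by_cases hsc : ∀ f ∈ X, ∃ c : ℂ, ∀ w ∈ W, f w = c • w
    · obtain ⟨w, hw, hw0⟩ := W.ne_bot_iff.1 hW
      exact ⟨w, hw0, fun f hf => (hsc f hf).imp fun c hc => hc w hw⟩
    · push Not at hsc
      obtain ⟨f, hf, hfc⟩ := hsc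
      have : Nontrivial W := (Submodule.nontrivial_iff_ne_bot).2 hW
      obtain ⟨μ, hμ⟩ := Module.End.exists_eigenvalue (f.restrict (hinv f hf))
      obtain ⟨w, hw⟩ := hμ.exists_hasEigenvector
      have hfw : f w = μ • (w : V) := congrArg Subtype.val hw.apply_eq_smul
      refine ih (finrank ℂ (W ⊓ f.eigenspace μ : Submodule ℂ V)) ?_ _ rfl ?_ ?_
      · rw [← hn]
        refine Submodule.finrank_lt_finrank_of_lt (lt_of_le_of_ne inf_le_left fun h => ?_)
        obtain ⟨x, hx, hx'⟩ := hfc μ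
        rw [← h] at hx
        exact hx' (Module.End.mem_eigenspace_iff.1 hx.2)
      · rw [Submodule.ne_bot_iff]
        exact ⟨w, ⟨w.2, Module.End.mem_eigenspace_iff.2 hfw⟩, by simpa using hw.2⟩
      · rintro g hg x ⟨hx, hx'⟩
        refine ⟨hinv g hg x hx, Module.End.mem_eigenspace_iff.2 ?_⟩
        have h1 : f (g x) = g (f x) := LinearMap.congr_fun (hX f hf g hg) x
        rw [h1, Module.End.mem_eigenspace_iff.1 hx', map_smul]

/-- Products `x† y` of the entries of a unitary block matrix `!![p, q; r, p]` commute. -/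
theorem commute_of_unitary_blocks {R : Type*} [Ring R] [StarRing R] {p q r : R}
    (h1 : star p * p + star r * r = 1) (h2 : star p * p + star q * q = 1)
    (h3 : star p * q + star r * p = 0) (h4 : p * star p + q * star q = 1)
    (h5 : p * star p + r * star r = 1) (h6 : p * star r + q * star p = 0) :
    ∀ f ∈ ({star p * p, star p * q, star q * p, star q * r, star r * q} : Set R),
    ∀ g ∈ ({star p * p, star p * q, star q * p, star q * r, star r * q} : Set R), Commute f g := by
  have h1' := sub_eq_zero.2 h1
  have h2' := sub_eq_zero.2 h2
  have h4' := sub_eq_zero.2 h4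
  have h5' := sub_eq_zero.2 h5
  have h3s : star q * p + star p * r = 0 := by
    simpa [star_add, star_mul] using congrArg star h3
  have h6s : r * star p + p * star q = 0 := by
    simpa [star_add, star_mul] using congrArg star h6
  -- Each commutator below is an explicit combination of the unitarity relations, in some cases
  -- together with a commutator already shown to vanish. The remaining commutations follow by taking
  -- adjoints.
  have GC : Commute (star p * p) (star p * q) := by
    refine sub_eq_zero.1 ?_
    calc _ = star p * (p * star p + q * star q - 1) * q
          - star p * q * (star p * p + star q * q - 1) := by noncomm_ring
      _ = 0 := by rw [h4', h2']; simp
  have GC' : Commute (star p * p) (star q * p) := by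
    simpa [star_mul] using GC.star_star
  have GE : Commute (star p * p) (star q * r) := by
    refine sub_eq_zero.1 ?_
    calc _ = (star p * p + star q * q - 1) * (star q * r)
          - star q * (p * star p + q * star q - 1) * r
          - star q * r * (star p * p + star r * r - 1)
          + star q * (p * star p + r * star r - 1) * r := by noncomm_ring
      _ = 0 := by rw [h1', h2', h4', h5']; simp
  have GE' : Commute (star p * p) (star r * q) := by
    simpa [star_mul] using GE.star_star
  have CC' : Commute (star p * q) (star q * p) := by
    refine sub_eq_zero.1 ?_
    calc _ = star p * (p * star p + q * star q - 1) * p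
          - star q * (p * star p + q * star q - 1) * q
          + (star p * p + star q * q - 1) * (star q * q)
          - star p * p * (star p * p + star q * q - 1) := by noncomm_ring
      _ = 0 := by rw [h2', h4']; simp
  have CE : Commute (star p * q) (star q * r) := by
    refine sub_eq_zero.1 ?_
    calc _ = star p * (p * star p + q * star q - 1) * r
          - star q * (r * star p + p * star q) * q
          + (star q * p + star p * r) - star p * p * (star q * p + star p * r)
          + star q * p * (star p * p + star q * q - 1)
          + (star p * p * (star q * p) - star q * p * (star p * p)) := by noncomm_ring
      _ = 0 := by rw [h4', h6s, h3s, h2', sub_eq_zero.2 GC'.eq]; simp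
  have CE' : Commute (star p * q) (star r * q) := by
    refine sub_eq_zero.1 ?_
    calc _ = (star p * q + star r * p) * (star r * q) - star r * (p * star r + q * star p) * q := by
          noncomm_ring
      _ = 0 := by rw [h3, h6]; simp
  have C'E : Commute (star q * p) (star q * r) := by
    simpa [star_mul] using CE'.star_star
  have C'E' : Commute (star q * p) (star r * q) := by
    simpa [star_mul] using CE.star_star
  have EE' : Commute (star q * r) (star r * q) := by
    refine sub_eq_zero.1 ?_
    calc _ = star q * (p * star p + r * star r - 1) * q
          - star r * (p * star p + q * star q - 1) * r
          + (star p * p + star q * q - 1) - (star p * p + star r * r - 1)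
          + (star p * q + star r * p) * (star p * r) - star p * q * (star q * p + star p * r)
          + (star p * q * (star q * p) - star q * p * (star p * q)) := by noncomm_ring
      _ = 0 := by rw [h5', h4', h2', h1', h3, h3s, sub_eq_zero.2 CC'.eq]; simp
  rintro f (rfl | rfl | rfl | rfl | rfl) g (rfl | rfl | rfl | rfl | rfl)
  · exact Commute.refl _
  · exact GC
  · exact GC'
  · exact GE
  · exact GE'
  · exact GC.symm
  · exact Commute.refl _
  · exact CC'
  · exact CE
  · exact CE'
  · exact GC'.symm
  · exact CC'.symm
  · exact Commute.refl _
  · exact C'E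
  · exact C'E'
  · exact GE.symm
  · exact CE.symm
  · exact C'E.symm
  · exact Commute.refl _
  · exact EE'
  · exact GE'.symm
  · exact CE'.symm
  · exact C'E'.symm
  · exact EE'.symm
  · exact Commute.refl _

/-! ### Blocks of the operator in bases of the first factor -/

section BlockEntry

variable {E E' F F' : Type*}
  [NormedAddCommGroup E] [InnerProductSpace ℂ E] [NormedAddCommGroup E'] [InnerProductSpace ℂ E']
  [NormedAddCommGroup F] [InnerProductSpace ℂ F] [NormedAddCommGroup F'] [InnerProductSpace ℂ F']
  {ι κ κ' : Type*} [Fintype ι] [Fintype κ'] [Fintype κ]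

/-- The block `(⟨b| ⊗ 1) (∑ l, S l ⊗ T l) (|a⟩ ⊗ 1)`. -/
noncomputable def blockEntry (S : ι → E →ₗ[ℂ] E') (T : ι → F →ₗ[ℂ] F') (b : E') (a : E) :
    F →ₗ[ℂ] F' :=
  ∑ l, inner ℂ b (S l a) • T l

/-- Parseval in the basis `e`: these are the orthogonality relations between the columns of the
block matrix. -/
theorem IsometricSum.sum_inner_blockEntry {S : ι → E →ₗ[ℂ] E'} {T : ι → F →ₗ[ℂ] F'}
    (h : IsometricSum S T) (e : OrthonormalBasis κ ℂ E') (a a' : E) (v v' : F) :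
    ∑ j, inner ℂ (blockEntry S T (e j) a v) (blockEntry S T (e j) a' v') =
      inner ℂ a a' * inner ℂ v v' := by
  rw [← h a a' v v']
  simp only [blockEntry, LinearMap.sum_apply, LinearMap.smul_apply, sum_inner, inner_sum,
    inner_smul_left, inner_smul_right, inner_conj_symm, Finset.mul_sum]
  rw [Finset.sum_comm, Finset.sum_congr rfl fun l _ => Finset.sum_comm, Finset.sum_comm]
  refine Finset.sum_congr rfl fun l _ => Finset.sum_congr rfl fun m _ => ?_
  rw [← e.sum_inner_mul_inner, Finset.sum_mul]
  exact Finset.sum_congr rfl fun j _ => by ring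

/-- Applied to the adjoint sum, this turns the column relations into the row relations of a unitary
block matrix. -/
theorem adjoint_blockEntry [FiniteDimensional ℂ E] [FiniteDimensional ℂ E']
    [FiniteDimensional ℂ F] [FiniteDimensional ℂ F'] (S : ι → E →ₗ[ℂ] E') (T : ι → F →ₗ[ℂ] F')
    (b : E') (a : E) :
    blockEntry (fun l => (S l).adjoint) (fun l => (T l).adjoint) a b =
      (blockEntry S T b a).adjoint := by
  simp only [blockEntry, map_sum, LinearMap.adjoint_inner_right]
  refine Finset.sum_congr rfl fun l _ => ?_
  rw [map_smulₛₗ, inner_conj_symm]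

/-- Independence of `S` makes each `T l` a combination of blocks, so a linear property of the `T l`
need only be checked on the blocks in chosen bases. -/
theorem mem_of_forall_blockEntry_mem {S : ι → E →ₗ[ℂ] E'} {T : ι → F →ₗ[ℂ] F'}
    (hS : LinearIndependent ℂ S) (f : Basis κ ℂ E) (e : OrthonormalBasis κ' ℂ E')
    {W : Submodule ℂ (F →ₗ[ℂ] F')} (h : ∀ i j, blockEntry S T (e j) (f i) ∈ W) (l : ι) :
    T l ∈ W := by
  refine mem_of_forall_sum_inner_smul_mem hS (fun a b => ?_) l
  have : ∑ l, inner ℂ b (S l a) • T l =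
      ∑ i, ∑ j, (f.repr a i * inner ℂ b (e j)) • blockEntry S T (e j) (f i) := by
    simp only [blockEntry, Finset.smul_sum, smul_smul]
    rw [Finset.sum_congr rfl fun i _ => Finset.sum_comm, Finset.sum_comm]
    refine Finset.sum_congr rfl fun l _ => ?_
    simp only [← Finset.sum_smul]
    congr 1
    conv_lhs => rw [← f.sum_repr a]
    simp only [map_sum, map_smul, inner_sum, inner_smul_right]
    refine Finset.sum_congr rfl fun i _ => ?_
    rw [← e.sum_inner_mul_inner, Finset.mul_sum]
    exact Finset.sum_congr rfl fun j _ => by ring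
  rw [this]
  exact Submodule.sum_mem _ fun i _ => Submodule.sum_mem _ fun j _ => W.smul_mem _ (h i j)

/-- With `W` the span of the `T l v`, the hypothesis says that all `T l` map the hyperplane `vᗮ`
into `Wᗮ`. Dimensions cannot drop under such maps, so `W` is at most a line. -/
theorem IsometricSum.hasLine_of_inner_eq_zero [FiniteDimensional ℂ E] [FiniteDimensional ℂ E']
    [FiniteDimensional ℂ F] [FiniteDimensional ℂ F']
    {S : ι → E →ₗ[ℂ] E'} {T : ι → F →ₗ[ℂ] F'} (h : IsometricSum S T)
    (hE : finrank ℂ E = finrank ℂ E') (hE0 : 0 < finrank ℂ E) (hF : finrank ℂ F = finrank ℂ F')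
    {v : F} (hv : v ≠ 0)
    (hT : ∀ v', inner ℂ v' v = 0 → ∀ l m, inner ℂ (T l v') (T m v) = 0) : HasLine T := by
  let W : Submodule ℂ F' := Submodule.span ℂ (Set.range fun l => T l v)
  have h1 : finrank ℂ (ℂ ∙ v)ᗮ ≤ finrank ℂ Wᗮ := by
    refine h.finrank_le hE hE0 fun l v' hv' => ?_
    rw [Submodule.mem_orthogonal']
    intro w hw
    induction hw using Submodule.span_induction with
    | mem x hx =>
      obtain ⟨m, rfl⟩ := hx
      exact hT v' ((Submodule.mem_orthogonal_singleton_iff_inner_left).1 hv') l m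
    | zero => simp
    | add x y _ _ hx hy => rw [inner_add_right, hx, hy, add_zero]
    | smul c x _ hx => rw [inner_smul_right, hx, mul_zero]
  have h2 := W.finrank_add_finrank_orthogonal
  have h3 := (ℂ ∙ v).finrank_add_finrank_orthogonal
  rw [finrank_span_singleton hv] at h3
  obtain ⟨w, hw⟩ := finrank_le_one_iff.1 (show finrank ℂ W ≤ 1 by lia)
  refine ⟨v, hv, w, fun l => ?_⟩
  obtain ⟨c, hc⟩ := hw ⟨T l v, Submodule.subset_span ⟨l, rfl⟩⟩
  exact ⟨c, (congrArg Subtype.val hc).symm⟩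

end BlockEntry

/-! ### Two-dimensional first factor -/

section Qubit

/-- Singular value decomposition of a linear map between spaces of the same dimension. -/
theorem exists_orthonormalBasis_apply_eq_smul {E E' : Type*} [NormedAddCommGroup E]
    [InnerProductSpace ℂ E] [NormedAddCommGroup E'] [InnerProductSpace ℂ E']
    [FiniteDimensional ℂ E] [FiniteDimensional ℂ E'] {n : ℕ} (hE : finrank ℂ E = n)
    (hE' : finrank ℂ E' = n) (Y : E →ₗ[ℂ] E') :
    ∃ (b : OrthonormalBasis (Fin n) ℂ E) (a : OrthonormalBasis (Fin n) ℂ E') (c : Fin n → ℂ),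
      ∀ i, Y (b i) = c i • a i := by
  have hY : (Y.adjoint ∘ₗ Y).IsSymmetric := fun x y => by
    simp [LinearMap.adjoint_inner_left, LinearMap.adjoint_inner_right]
  let b := hY.eigenvectorBasis hE
  have horth : ∀ i j, i ≠ j → inner ℂ (Y (b i)) (Y (b j)) = 0 := by
    intro i j hij
    rw [← LinearMap.adjoint_inner_right, ← LinearMap.comp_apply, hY.apply_eigenvectorBasis,
      inner_smul_right, b.inner_eq_ite, if_neg hij, mul_zero]
  obtain ⟨a, ha⟩ := Orthonormal.exists_orthonormalBasis_extension_of_card_eq (𝕜 := ℂ)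
    (ι := Fin n) (by simp [hE']) (v := fun i => ((‖Y (b i)‖ : ℂ)⁻¹) • Y (b i))
    (s := {i | Y (b i) ≠ 0}) (by
      constructor
      · rintro ⟨i, hi⟩
        have : ‖Y (b i)‖ ≠ 0 := norm_ne_zero_iff.2 hi
        simp [norm_smul, this]
      · rintro ⟨i, hi⟩ ⟨j, hj⟩ hij
        simp [inner_smul_left, inner_smul_right, horth i j (fun h => hij (Subtype.ext h))])
  refine ⟨b, a, fun i => ‖Y (b i)‖, fun i => ?_⟩
  by_cases hi : Y (b i) = 0
  · simp [hi]
  · have : (‖Y (b i)‖ : ℂ) ≠ 0 := by simpa using hi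
    rw [ha i hi, smul_smul, mul_inv_cancel₀ this, one_smul]

/-- Three operators between two-dimensional spaces have, in suitable orthonormal bases, linearly
dependent diagonal entries. -/
theorem exists_diagonal_relation {E E' : Type*} [NormedAddCommGroup E]
    [InnerProductSpace ℂ E] [NormedAddCommGroup E'] [InnerProductSpace ℂ E']
    [FiniteDimensional ℂ E] [FiniteDimensional ℂ E'] (hE : finrank ℂ E = 2)
    (hE' : finrank ℂ E' = 2) (S : Fin 3 → E →ₗ[ℂ] E') :
    ∃ (b : OrthonormalBasis (Fin 2) ℂ E') (a : OrthonormalBasis (Fin 2) ℂ E) (c : Fin 2 → ℂ),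
      c ≠ 0 ∧ ∀ l, ∑ i, c i * inner ℂ (b i) (S l (a i)) = 0 := by
  -- Three trace conditions on a four-dimensional space have a nonzero solution `Y`. Its singular
  -- value decomposition supplies the two bases, and its singular values are the coefficients of the
  -- relation.
  let Φ : (E' →ₗ[ℂ] E) →ₗ[ℂ] (Fin 3 → ℂ) :=
    LinearMap.pi fun l => LinearMap.trace ℂ E' ∘ₗ LinearMap.llcomp ℂ E' E E' (S l)
  have hker : LinearMap.ker Φ ≠ ⊥ := LinearMap.ker_ne_bot_of_finrank_lt (by
    rw [Module.finrank_linearMap, hE, hE', Module.finrank_fin_fun]; norm_num)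
  obtain ⟨Y, hY, hY0⟩ := (Submodule.ne_bot_iff _).1 hker
  obtain ⟨b, a, c, hc⟩ := exists_orthonormalBasis_apply_eq_smul hE' hE Y
  refine ⟨b, a, c, ?_, fun l => ?_⟩
  · rintro rfl
    refine hY0 (b.toBasis.ext fun i => ?_)
    simpa using hc i
  · have h1 : LinearMap.trace ℂ E' (S l ∘ₗ Y) = 0 := congrFun (LinearMap.mem_ker.1 hY) l
    rw [LinearMap.trace_eq_sum_inner _ b] at h1
    simpa [hc, inner_smul_right] using h1

theorem eq_zero_of_trace_star_mul_self {F : Type*} [NormedAddCommGroup F] [InnerProductSpace ℂ F]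
    [FiniteDimensional ℂ F] {p : F →ₗ[ℂ] F} (h : LinearMap.trace ℂ F (star p * p) = 0) : p = 0 := by
  let b := stdOrthonormalBasis ℂ F
  rw [LinearMap.trace_eq_sum_inner _ b] at h
  simp only [Module.End.mul_apply, LinearMap.star_eq_adjoint, LinearMap.adjoint_inner_right,
    inner_self_eq_norm_sq_to_K] at h
  norm_cast at h
  rw [RCLike.ofReal_eq_zero, Finset.sum_eq_zero_iff_of_nonneg fun _ _ => by positivity] at h
  refine b.toBasis.ext fun i => ?_
  simpa using h i (Finset.mem_univ i)

/-- Five of the nine products `x† y` commute and share an eigenvector; the unitarity relations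
express the other four through these. -/
theorem exists_eigenvector_of_unitary_blocks {F : Type*} [NormedAddCommGroup F]
    [InnerProductSpace ℂ F] [FiniteDimensional ℂ F] [Nontrivial F] {p q r : F →ₗ[ℂ] F}
    (h1 : star p * p + star r * r = 1) (h2 : star p * p + star q * q = 1)
    (h3 : star p * q + star r * p = 0) (h4 : p * star p + q * star q = 1)
    (h5 : p * star p + r * star r = 1) (h6 : p * star r + q * star p = 0) :
    ∃ v ≠ 0, ∀ x ∈ ({p, q, r} : Set (F →ₗ[ℂ] F)), ∀ y ∈ ({p, q, r} : Set (F →ₗ[ℂ] F)),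
      ∃ c : ℂ, (star x * y) v = c • v := by
  obtain ⟨v, hv, hvc⟩ := exists_common_eigenvector _ (commute_of_unitary_blocks h1 h2 h3 h4 h5 h6)
  refine ⟨v, hv, ?_⟩
  have hpp := hvc (star p * p) (by simp)
  have hpq := hvc (star p * q) (by simp)
  have hqp := hvc (star q * p) (by simp)
  have hqr := hvc (star q * r) (by simp)
  have hrq := hvc (star r * q) (by simp)
  have hqq : ∃ d : ℂ, (star q * q) v = d • v := by
    obtain ⟨d, hd⟩ := hpp
    exact ⟨1 - d, by rw [eq_sub_of_add_eq' h2, LinearMap.sub_apply, hd]; simp [sub_smul]⟩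
  have hrr : ∃ d : ℂ, (star r * r) v = d • v := by
    obtain ⟨d, hd⟩ := hpp
    exact ⟨1 - d, by rw [eq_sub_of_add_eq' h1, LinearMap.sub_apply, hd]; simp [sub_smul]⟩
  have hrp : ∃ d : ℂ, (star r * p) v = d • v := by
    obtain ⟨d, hd⟩ := hpq
    exact ⟨-d, by rw [eq_neg_of_add_eq_zero_right h3, LinearMap.neg_apply, hd, neg_smul]⟩
  have hpr : ∃ d : ℂ, (star p * r) v = d • v := by
    obtain ⟨d, hd⟩ := hqp
    have h3s : star q * p + star p * r = 0 := by
      simpa [star_add, star_mul] using congrArg star h3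
    exact ⟨-d, by rw [eq_neg_of_add_eq_zero_right h3s, LinearMap.neg_apply, hd, neg_smul]⟩
  rintro x (rfl | rfl | rfl) y (rfl | rfl | rfl) <;> assumption

theorem inner_eq_zero_of_mem_span {F : Type*} [NormedAddCommGroup F]
    [InnerProductSpace ℂ F] [FiniteDimensional ℂ F] {X : Set (F →ₗ[ℂ] F)} {v v' : F}
    (hX : ∀ x ∈ X, ∀ y ∈ X, ∃ c : ℂ, (star x * y) v = c • v) (hv : inner ℂ v' v = 0)
    {x y : F →ₗ[ℂ] F} (hx : x ∈ Submodule.span ℂ X) (hy : y ∈ Submodule.span ℂ X) :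
    inner ℂ (x v') (y v) = 0 := by
  induction hx, hy using Submodule.span_induction₂ with
  | mem_mem x y hx hy =>
    obtain ⟨d, hd⟩ := hX x hx y hy
    rw [← LinearMap.adjoint_inner_right, ← LinearMap.star_eq_adjoint, ← Module.End.mul_apply, hd,
      inner_smul_right, hv, mul_zero]
  | zero_left => simp
  | zero_right => simp
  | add_left x y z _ _ _ h1 h2 => rw [LinearMap.add_apply, inner_add_left, h1, h2, add_zero]
  | add_right x y z _ _ _ h1 h2 => rw [LinearMap.add_apply, inner_add_right, h1, h2, add_zero]
  | smul_left c x y _ _ h1 => rw [LinearMap.smul_apply, inner_smul_left, h1, mul_zero]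
  | smul_right c x y _ _ h1 => rw [LinearMap.smul_apply, inner_smul_right, h1, mul_zero]

variable {E E' F F' : Type*}
  [NormedAddCommGroup E] [InnerProductSpace ℂ E] [NormedAddCommGroup E'] [InnerProductSpace ℂ E']
  [NormedAddCommGroup F] [InnerProductSpace ℂ F] [NormedAddCommGroup F'] [InnerProductSpace ℂ F']
  [FiniteDimensional ℂ E] [FiniteDimensional ℂ E'] [FiniteDimensional ℂ F]
  [FiniteDimensional ℂ F']

/-- Source and target are both `F` here so that blocks can be multiplied. A linear relation makes
the diagonal blocks `p` and `s` proportional, and removing a phase makes them equal. A common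
eigenvector `v` of the products `x† y` of blocks is then sent into a line, because the images of
`vᗮ` are orthogonal to those of `v`. -/
theorem IsometricSum.hasLine_of_finrank_eq_two_aux {S : Fin 3 → E →ₗ[ℂ] E'}
    {T : Fin 3 → F →ₗ[ℂ] F} (h : IsometricSum S T) (hS : LinearIndependent ℂ S)
    (hE : finrank ℂ E = 2) (hE' : finrank ℂ E' = 2) (hF0 : 0 < finrank ℂ F) : HasLine T := by
  have : Nontrivial F := finrank_pos_iff.1 hF0
  obtain ⟨b, a, c, hc0, hc⟩ := exists_diagonal_relation hE hE' S
  set p := blockEntry S T (b 0) (a 0) with hp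
  set q := blockEntry S T (b 0) (a 1) with hq
  set r := blockEntry S T (b 1) (a 0) with hr
  set s := blockEntry S T (b 1) (a 1) with hs
  have col : ∀ i i', star (blockEntry S T (b 0) (a i)) * blockEntry S T (b 0) (a i') +
      star (blockEntry S T (b 1) (a i)) * blockEntry S T (b 1) (a i') =
      if i = i' then 1 else 0 := by
    intro i i'
    refine LinearMap.ext fun v' => ext_inner_left ℂ fun v => ?_
    have := h.sum_inner_blockEntry b (a i) (a i') v v'
    rw [Fin.sum_univ_two, a.inner_eq_ite] at this
    simp only [LinearMap.add_apply, Module.End.mul_apply, LinearMap.star_eq_adjoint,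
      LinearMap.adjoint_inner_right, inner_add_right]
    rw [this]
    split_ifs <;> simp
  have row : ∀ j j', blockEntry S T (b j) (a 0) * star (blockEntry S T (b j') (a 0)) +
      blockEntry S T (b j) (a 1) * star (blockEntry S T (b j') (a 1)) =
      if j = j' then 1 else 0 := by
    intro j j'
    refine LinearMap.ext fun v' => ext_inner_left ℂ fun v => ?_
    have := (h.adjoint (hE.trans hE'.symm) rfl).sum_inner_blockEntry a (b j) (b j') v v'
    rw [Fin.sum_univ_two, b.inner_eq_ite] at this
    simp only [adjoint_blockEntry, LinearMap.adjoint_inner_left] at this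
    simp only [LinearMap.add_apply, Module.End.mul_apply, LinearMap.star_eq_adjoint,
      inner_add_right]
    rw [this]
    split_ifs <;> simp
  have hrel : c 0 • p + c 1 • s = 0 := by
    simp only [hp, hs, blockEntry, Finset.smul_sum, smul_smul, ← Finset.sum_add_distrib, ← add_smul]
    refine Finset.sum_eq_zero fun l _ => ?_
    have := hc l
    rw [Fin.sum_univ_two] at this
    rw [this, zero_smul]
  -- Row 0 and column 1 share the block `q`, so `p` and `s` have the same Hilbert–Schmidt norm; this
  -- forces the proportionality factor to have modulus one.
  have htr : LinearMap.trace ℂ F (star p * p) = LinearMap.trace ℂ F (star s * s) := by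
    have e1 := congrArg (LinearMap.trace ℂ F) (row 0 0)
    have e2 := congrArg (LinearMap.trace ℂ F) (col 1 1)
    simp only [if_true, map_add] at e1 e2
    rw [LinearMap.trace_mul_comm, LinearMap.trace_mul_comm ℂ (blockEntry S T (b 0) (a 1))] at e1
    linear_combination e1 - e2
  obtain ⟨ω, hω, hsp⟩ : ∃ ω : ℂ, star ω * ω = 1 ∧ s = ω • p := by
    by_cases hp0 : p = 0
    · refine ⟨1, by simp, ?_⟩
      rw [hp0, smul_zero]
      exact eq_zero_of_trace_star_mul_self (by rw [← htr, hp0]; simp)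
    · have hc1 : c 1 ≠ 0 := by
        intro h1
        have h0 : c 0 = 0 := by simpa [h1, hp0] using hrel
        exact hc0 (by ext i; fin_cases i <;> simp [h0, h1])
      have hsω : s = (-(c 1)⁻¹ * c 0) • p := by
        have : (c 1)⁻¹ • (c 0 • p + c 1 • s) = 0 := by rw [hrel, smul_zero]
        rw [smul_add, smul_smul, smul_smul, inv_mul_cancel₀ hc1, one_smul] at this
        rw [neg_mul, neg_smul]
        exact eq_neg_of_add_eq_zero_right this
      refine ⟨_, ?_, hsω⟩
      rw [hsω] at htr
      simp only [star_smul, smul_mul_assoc, mul_smul_comm, map_smul, smul_eq_mul] at htr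
      have htp : LinearMap.trace ℂ F (star p * p) ≠ 0 := fun h0 =>
        hp0 (eq_zero_of_trace_star_mul_self h0)
      refine mul_right_cancel₀ htp ?_
      linear_combination -htr
  replace hω : (starRingEnd ℂ) ω * ω = 1 := hω
  have hω' : ω * (starRingEnd ℂ) ω = 1 := by rw [mul_comm, hω]
  have c00 : star p * p + star r * r = 1 := by simpa using col 0 0
  have c11 : star q * q + star s * s = 1 := by simpa using col 1 1
  have c01 : star p * q + star r * s = 0 := by simpa using col 0 1
  have r00 : p * star p + q * star q = 1 := by simpa using row 0 0
  have r11 : r * star r + s * star s = 1 := by simpa using row 1 1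
  have r01 : p * star r + q * star s = 0 := by simpa using row 0 1
  -- Multiplying the second block row by the conjugate of `ω` turns `s = ω • p` into `p` and
  -- preserves unitarity.
  obtain ⟨v, hv, hvc⟩ := exists_eigenvector_of_unitary_blocks
    (p := p) (q := q) (r := (starRingEnd ℂ) ω • r)
    (by simpa [smul_smul, hω, hω'] using c00)
    (by simpa [hsp, smul_smul, hω, hω', add_comm] using c11)
    (by simpa [hsp, smul_smul, hω, hω'] using c01)
    (by simpa using r00)
    (by simpa [hsp, smul_smul, hω, hω', add_comm] using r11)
    (by
      have := congrArg (ω • ·) r01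
      simpa [hsp, smul_smul, hω, hω'] using this)
  have hW : ∀ l, T l ∈ Submodule.span ℂ {p, q, (starRingEnd ℂ) ω • r} := by
    refine mem_of_forall_blockEntry_mem hS a.toBasis b ?_
    intro i j
    rw [OrthonormalBasis.coe_toBasis]
    fin_cases i <;> fin_cases j
    · exact Submodule.subset_span (by simp [hp])
    · have : ω • ((starRingEnd ℂ) ω • r) ∈ Submodule.span ℂ {p, q, (starRingEnd ℂ) ω • r} :=
        Submodule.smul_mem _ _ (Submodule.subset_span (by simp))
      rwa [smul_smul, hω', one_smul] at this
    · exact Submodule.subset_span (by simp [hq])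
    · change s ∈ _
      rw [hsp]
      exact Submodule.smul_mem _ _ (Submodule.subset_span (by simp))
  exact h.hasLine_of_inner_eq_zero (hE.trans hE'.symm) (by lia) rfl hv fun v' hv' l m =>
    inner_eq_zero_of_mem_span hvc hv' (hW l) (hW m)

theorem IsometricSum.hasLine_of_finrank_eq_two {S : Fin 3 → E →ₗ[ℂ] E'}
    {T : Fin 3 → F →ₗ[ℂ] F'} (h : IsometricSum S T) (hS : LinearIndependent ℂ S)
    (hE : finrank ℂ E = 2) (hE' : finrank ℂ E' = 2) (hF : finrank ℂ F = finrank ℂ F')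
    (hF0 : 0 < finrank ℂ F) : HasLine T := by
  -- A unitary identification of `F'` with `F` changes neither isometry nor the existence of a
  -- common line.
  let g : F' ≃ₗᵢ[ℂ] F :=
    (stdOrthonormalBasis ℂ F').equiv (stdOrthonormalBasis ℂ F) (finCongr hF.symm)
  have h' : IsometricSum S fun l => g.toLinearEquiv.toLinearMap ∘ₗ T l := by
    intro a a' v v'
    simpa using h a a' v v'
  obtain ⟨v, hv, w, hw⟩ := h'.hasLine_of_finrank_eq_two_aux hS hE hE' hF0
  refine ⟨v, hv, g.symm w, fun l => ?_⟩
  obtain ⟨c, hc⟩ := hw l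
  refine ⟨c, ?_⟩
  rw [← map_smul, ← hc]
  simp

end Qubit

/-! ### Spans of Gram matrices -/

section Gram

variable {E E' F F' : Type*}
  [NormedAddCommGroup E] [InnerProductSpace ℂ E] [NormedAddCommGroup E'] [InnerProductSpace ℂ E']
  [NormedAddCommGroup F] [InnerProductSpace ℂ F] [NormedAddCommGroup F'] [InnerProductSpace ℂ F']
  {ι : Type*}

/-- The matrix of inner products `⟪T l v, T m w⟫`. -/
noncomputable def gramMat (T : ι → F →ₗ[ℂ] F') (v w : F) : Matrix ι ι ℂ :=
  Matrix.of fun l m => inner ℂ (T l v) (T m w)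

/-- The span of the Gram matrices of a family of linear maps. Its dimension is that of the span of
the products `(T l)† (T m)`. -/
noncomputable def gramSpan (T : ι → F →ₗ[ℂ] F') : Submodule ℂ (Matrix ι ι ℂ) :=
  Submodule.span ℂ (Set.range fun x : F × F => gramMat T x.1 x.2)

theorem gramMat_mem_gramSpan (T : ι → F →ₗ[ℂ] F') (v v' : F) : gramMat T v v' ∈ gramSpan T :=
  Submodule.subset_span ⟨(v, v'), rfl⟩

theorem gramMat_apply (T : ι → F →ₗ[ℂ] F') (v v' : F) (l m : ι) :
    gramMat T v v' l m = inner ℂ (T l v) (T m v') := rfl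

theorem conjTranspose_gramMat (T : ι → F →ₗ[ℂ] F') (v v' : F) :
    (gramMat T v v').conjTranspose = gramMat T v' v := by
  ext l m
  simp [gramMat]

/-- `gramMat` as a linear map in its second vector. -/
noncomputable def gramMap (T : ι → F →ₗ[ℂ] F') (v : F) : F →ₗ[ℂ] Matrix ι ι ℂ where
  toFun := gramMat T v
  map_add' x y := by ext; simp [gramMat]
  map_smul' c x := by ext; simp [gramMat]

theorem gramMap_apply (T : ι → F →ₗ[ℂ] F') (v v' : F) : gramMap T v v' = gramMat T v v' := rfl

/-- A change of family by `P` acts on Gram matrices as `G ↦ P̄ G Pᵀ`, a linear map. -/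
theorem finrank_gramSpan_le_of_combination [Fintype ι] [DecidableEq ι] {T T' : ι → F →ₗ[ℂ] F'}
    (P : Matrix ι ι ℂ) (hP : ∀ l, T' l = ∑ m, P l m • T m) :
    finrank ℂ (gramSpan T') ≤ finrank ℂ (gramSpan T) := by
  have : gramSpan T' ≤ (gramSpan T).map
      (LinearMap.mulLeftRight ℂ (P.map (starRingEnd ℂ), P.transpose)) := by
    refine Submodule.span_le.2 ?_
    rintro _ ⟨⟨v, v'⟩, rfl⟩
    refine ⟨gramMat T v v', gramMat_mem_gramSpan T v v', ?_⟩
    ext l m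
    simp only [LinearMap.mulLeftRight_apply, Matrix.mul_apply, Matrix.map_apply, gramMat_apply, hP,
      Matrix.transpose_apply, LinearMap.sum_apply, LinearMap.smul_apply, sum_inner, inner_sum,
      inner_smul_left, inner_smul_right, Finset.sum_mul, Finset.mul_sum]
    exact Finset.sum_congr rfl fun i _ => Finset.sum_congr rfl fun j _ => by ring
  exact (Submodule.finrank_mono this).trans (Submodule.finrank_map_le _ _)

theorem finrank_le_finrank_inf_ker_add_one {V : Type*} [AddCommGroup V] [Module ℂ V]
    [FiniteDimensional ℂ V] (W : Submodule ℂ V) (φ : V →ₗ[ℂ] ℂ) :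
    finrank ℂ W ≤ finrank ℂ (W ⊓ LinearMap.ker φ : Submodule ℂ V) + 1 := by
  have h1 := Submodule.finrank_sup_add_finrank_inf_eq W (LinearMap.ker φ)
  have h2 := LinearMap.finrank_range_add_finrank_ker φ
  have h3 : finrank ℂ (LinearMap.range φ) ≤ 1 :=
    (Submodule.finrank_le _).trans (Module.finrank_self ℂ).le
  have h4 := Submodule.finrank_le (W ⊔ LinearMap.ker φ)
  lia

/-- The bilinear form `(X, Y) ↦ ∑ l m, X l m * Y l m`, as a map to the dual. -/
noncomputable def entrywisePairing (ι : Type*) [Fintype ι] :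
    Matrix ι ι ℂ →ₗ[ℂ] Dual ℂ (Matrix ι ι ℂ) :=
  LinearMap.mk₂ ℂ (fun X Y => ∑ l, ∑ m, X l m * Y l m)
    (fun X X' Y => by simp [add_mul, Finset.sum_add_distrib])
    (fun c X Y => by simp [mul_assoc, Finset.mul_sum])
    (fun X Y Y' => by simp [mul_add, Finset.sum_add_distrib])
    (fun c X Y => by simp [mul_left_comm, Finset.mul_sum])

theorem entrywisePairing_apply [Fintype ι] (X Y : Matrix ι ι ℂ) :
    entrywisePairing ι X Y = ∑ l, ∑ m, X l m * Y l m := rfl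

theorem entrywisePairing_injective [Fintype ι] : Function.Injective (entrywisePairing ι) := by
  classical
  rw [injective_iff_map_eq_zero]
  intro X hX
  ext l m
  have h := LinearMap.congr_fun hX (Matrix.single l m 1)
  simpa [entrywisePairing_apply, Matrix.single_apply, ite_and, Finset.sum_ite_eq] using h

/-- Isometry says that the Gram matrices of `S` and `T` pair to `⟪a, a'⟫ * ⟪v, v'⟫`. Hence every `Y`
in the first span pairs with the second span through a single scalar `φ Y`. Where `φ` vanishes, a
subspace of codimension at most one, `Y` annihilates the second span. -/
theorem IsometricSum.finrank_gramSpan_add_le [Fintype ι] [FiniteDimensional ℂ F]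
    {S : ι → E →ₗ[ℂ] E'} {T : ι → F →ₗ[ℂ] F'} (h : IsometricSum S T) (hF0 : 0 < finrank ℂ F) :
    finrank ℂ (gramSpan S) + finrank ℂ (gramSpan T) ≤ Fintype.card ι * Fintype.card ι + 1 := by
  have : Nontrivial F := finrank_pos_iff.1 hF0
  obtain ⟨u, hu⟩ := exists_norm_eq F zero_le_one
  have hu : inner ℂ u u = 1 := by rw [inner_self_eq_norm_sq_to_K, hu]; simp
  let φ : Matrix ι ι ℂ →ₗ[ℂ] ℂ := (entrywisePairing ι).flip (gramMat T u u)
  have hφ : ∀ Y ∈ gramSpan S, ∀ v v',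
      entrywisePairing ι Y (gramMat T v v') = inner ℂ v v' * φ Y := by
    intro Y hY v v'
    induction hY using Submodule.span_induction with
    | mem Y hY =>
      obtain ⟨⟨a, a'⟩, rfl⟩ := hY
      simp only [φ, LinearMap.flip_apply, entrywisePairing_apply, gramMat_apply, h a a' v v',
        h a a' u u, hu]
      ring
    | zero => simp
    | add x y _ _ hx hy => simp only [map_add, LinearMap.add_apply, hx, hy]; ring
    | smul c x _ hx => simp only [map_smul, LinearMap.smul_apply, hx, smul_eq_mul]; ring
  have h1 := finrank_le_finrank_inf_ker_add_one (gramSpan S) φ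
  have h2 : (gramSpan S ⊓ LinearMap.ker φ).map (entrywisePairing ι) ≤
      (gramSpan T).dualAnnihilator := by
    rintro _ ⟨Y, ⟨hY, hY0⟩, rfl⟩
    rw [Submodule.mem_dualAnnihilator]
    intro X hX
    induction hX using Submodule.span_induction with
    | mem X hX =>
      obtain ⟨⟨v, v'⟩, rfl⟩ := hX
      rw [hφ Y hY, LinearMap.mem_ker.1 hY0, mul_zero]
    | zero => simp
    | add x y _ _ hx hy => rw [map_add, hx, hy, add_zero]
    | smul c x _ hx => rw [map_smul, hx, smul_zero]
  have h3 := Submodule.finrank_mono h2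
  rw [← (Submodule.equivMapOfInjective _ entrywisePairing_injective _).finrank_eq] at h3
  have h4 := Subspace.finrank_add_finrank_dualAnnihilator_eq (gramSpan T)
  rw [Module.finrank_matrix, Module.finrank_self, mul_one] at h4
  lia

end Gram

/-! ### Families adapted to a vector -/

section Adapted

/-- Three vectors spanning a plane can be combined to two orthonormal vectors and zero. -/
theorem exists_combination_orthonormal {H : Type*} [NormedAddCommGroup H] [InnerProductSpace ℂ H]
    (x : Fin 3 → H) (hdep : ∃ c : Fin 3 → ℂ, c ≠ 0 ∧ ∑ l, c l • x l = 0)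
    (hline : ¬ ∃ w, ∀ l, ∃ c : ℂ, x l = c • w) :
    ∃ P Q : Matrix (Fin 3) (Fin 3) ℂ, P * Q = 1 ∧ Q * P = 1 ∧ ∃ e : Fin 2 → H,
      Orthonormal ℂ e ∧ ∑ m, P 0 m • x m = e 0 ∧ ∑ m, P 1 m • x m = e 1 ∧
      ∑ m, P 2 m • x m = 0 := by
  let ev : (Fin 3 → ℂ) →ₗ[ℂ] H := Fintype.linearCombination ℂ x
  have hev : ∀ c, ev c = ∑ l, c l • x l := fun c => Fintype.linearCombination_apply ℂ x c
  obtain ⟨c, hc0, hc⟩ := hdep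
  have h1 := LinearMap.finrank_range_add_finrank_ker ev
  rw [Module.finrank_fin_fun] at h1
  have h2 : 0 < finrank ℂ (LinearMap.ker ev) := by
    rw [finrank_pos_iff, Submodule.nontrivial_iff_ne_bot, Submodule.ne_bot_iff]
    exact ⟨c, by rw [LinearMap.mem_ker, hev, hc], hc0⟩
  have h3 : 1 < finrank ℂ (LinearMap.range ev) := by
    by_contra hcon
    obtain ⟨w, hw⟩ := finrank_le_one_iff.1 (not_lt.1 hcon)
    refine hline ⟨w, fun l => ?_⟩
    obtain ⟨d, hd⟩ := hw ⟨x l, Pi.single l 1, by simp [hev, Pi.single_apply]⟩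
    exact ⟨d, (congrArg Subtype.val hd).symm⟩
  have h4 : finrank ℂ (LinearMap.range ev) = 2 := by lia
  let b := (stdOrthonormalBasis ℂ (LinearMap.range ev)).reindex (finCongr h4)
  have hb : Orthonormal ℂ fun i => (b i : H) :=
    b.orthonormal.comp_linearIsometry (LinearMap.range ev).subtypeₗᵢ
  obtain ⟨c0, hc0'⟩ := (b 0).2
  obtain ⟨c1, hc1'⟩ := (b 1).2
  have hli : LinearIndependent ℂ ![c0, c1, c] := by
    rw [Fintype.linearIndependent_iff]
    intro g hg
    simp only [Fin.sum_univ_three, Matrix.cons_val_zero, Matrix.cons_val_one,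
      Matrix.cons_val] at hg
    have h5 : g 0 • (b 0 : H) + g 1 • (b 1 : H) = 0 := by
      have := congrArg ev hg
      rw [map_add, map_add, map_smul, map_smul, map_smul, hc0', hc1', hev c, hc] at this
      simpa using this
    have h6 := Fintype.linearIndependent_iff.1 hb.linearIndependent ![g 0, g 1]
      (by simpa [Fin.sum_univ_two] using h5)
    have g0 : g 0 = 0 := h6 0
    have g1 : g 1 = 0 := h6 1
    have g2 : g 2 = 0 := by simpa [g0, g1, hc0] using hg
    intro i
    fin_cases i
    exacts [g0, g1, g2]
  have hunit : IsUnit (Matrix.of ![c0, c1, c]) :=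
    Matrix.linearIndependent_rows_iff_isUnit.1 hli
  obtain ⟨u, hu⟩ := hunit
  refine ⟨Matrix.of ![c0, c1, c], (u⁻¹ : (Matrix (Fin 3) (Fin 3) ℂ)ˣ), ?_, ?_, fun i => b i, hb,
    ?_, ?_, ?_⟩
  · rw [← hu]; simp
  · rw [← hu]; simp
  · exact (hev c0).symm.trans hc0'
  · exact (hev c1).symm.trans hc1'
  · exact hc

end Adapted

/-! ### Invertible changes of family -/

section Combination

variable {V : Type*} [AddCommGroup V] [Module ℂ V]

/-- The span of `y` contains that of `x`, so `y` spans as many dimensions as it has members. -/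
theorem LinearIndependent.of_combination {ι : Type*} [Fintype ι] {x y : ι → V}
    (hx : LinearIndependent ℂ x) (Q : Matrix ι ι ℂ) (h : ∀ l, x l = ∑ m, Q l m • y m) :
    LinearIndependent ℂ y := by
  rw [linearIndependent_iff_card_le_finrank_span, Set.finrank, ← finrank_span_eq_card hx]
  have := FiniteDimensional.span_of_finite ℂ (Set.finite_range y)
  refine Submodule.finrank_mono (Submodule.span_le.2 ?_)
  rintro _ ⟨l, rfl⟩
  rw [SetLike.mem_coe, h]
  exact Submodule.sum_mem _ fun m _ => Submodule.smul_mem _ _ (Submodule.subset_span ⟨m, rfl⟩)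

theorem eq_sum_smul_of_eq_sum_smul {ι : Type*} [Fintype ι] [DecidableEq ι] {x y : ι → V}
    {P Q : Matrix ι ι ℂ} (hQP : Q * P = 1) (h : ∀ l, y l = ∑ m, P l m • x m) (l : ι) :
    x l = ∑ m, Q l m • y m := by
  simp only [h, Finset.smul_sum, smul_smul]
  rw [Finset.sum_comm]
  simp only [← Finset.sum_smul, ← Matrix.mul_apply, hQP, Matrix.one_apply, ite_smul, one_smul,
    zero_smul, Finset.sum_ite_eq, Finset.mem_univ, if_true]

end Combination

/-! ### Without splitting, the Gram span has dimension at least five -/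

section Lower

variable {E E' F F' : Type*}
  [NormedAddCommGroup E] [InnerProductSpace ℂ E] [NormedAddCommGroup E'] [InnerProductSpace ℂ E']
  [NormedAddCommGroup F] [InnerProductSpace ℂ F] [NormedAddCommGroup F'] [InnerProductSpace ℂ F']

theorem apply_two_eq_zero_of_gramMat {T : Fin 3 → F →ₗ[ℂ] F'} {v : F}
    (hv : gramMat T v v = Matrix.diagonal ![1, 1, 0]) : T 2 v = 0 := by
  have := congrFun (congrFun hv 2) 2
  rw [gramMat_apply] at this
  simpa using this

theorem orthonormal_of_gramMat {T : Fin 3 → F →ₗ[ℂ] F'} {v : F}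
    (hv : gramMat T v v = Matrix.diagonal ![1, 1, 0]) : Orthonormal ℂ ![T 0 v, T 1 v] := by
  rw [orthonormal_iff_ite]
  intro i j
  have := fun l m => congrFun (congrFun hv l) m
  simp only [gramMat_apply] at this
  fin_cases i <;> fin_cases j <;> simp [this, -inner_self_eq_norm_sq_to_K]

/-- A diagonal entry of `gramMat T u u` is a squared norm, so the `(2, 2)` entry does not vanish on
the whole Gram span. -/
theorem finrank_gramSpan_inf_ker_lt {T : Fin 3 → F →ₗ[ℂ] F'} (hT : T 2 ≠ 0) :
    ∃ J ∈ gramSpan T, J 2 2 ≠ 0 ∧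
      finrank ℂ (gramSpan T ⊓ LinearMap.ker (Matrix.entryLinearMap ℂ ℂ (2 : Fin 3) (2 : Fin 3)) :
        Submodule ℂ (Matrix (Fin 3) (Fin 3) ℂ)) < finrank ℂ (gramSpan T) := by
  obtain ⟨u, hu⟩ : ∃ u, T 2 u ≠ 0 := by
    by_contra hcon
    push Not at hcon
    exact hT (LinearMap.ext hcon)
  have hJ : gramMat T u u 2 2 ≠ 0 := by
    rw [gramMat_apply]
    exact inner_self_ne_zero.2 hu
  refine ⟨gramMat T u u, gramMat_mem_gramSpan T u u, hJ,
    Submodule.finrank_lt_finrank_of_lt (lt_of_le_of_ne inf_le_left fun heq => hJ ?_)⟩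
  have := gramMat_mem_gramSpan T u u
  rw [← heq] at this
  exact this.2

variable [FiniteDimensional ℂ F'] [FiniteDimensional ℂ F]

/-- Change of basis making a vector `v` of a nontrivial kernel adapted to the family. -/
theorem IsometricSum.exists_adapted {S : Fin 3 → E →ₗ[ℂ] E'} {T : Fin 3 → F →ₗ[ℂ] F'}
    (h : IsometricSum S T) (hS : LinearIndependent ℂ S) (hT : LinearIndependent ℂ T)
    (hF : finrank ℂ F = finrank ℂ F') (hF0 : 0 < finrank ℂ F) (hline : ¬ HasLine T) :
    ∃ (S' : Fin 3 → E →ₗ[ℂ] E') (T' : Fin 3 → F →ₗ[ℂ] F') (P Q : Matrix (Fin 3) (Fin 3) ℂ),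
      IsometricSum S' T' ∧ LinearIndependent ℂ S' ∧ LinearIndependent ℂ T' ∧
      (∀ l, S l = ∑ m, P m l • S' m) ∧ (∀ l, T l = ∑ m, Q l m • T' m) ∧
      finrank ℂ (gramSpan T') ≤ finrank ℂ (gramSpan T) ∧
      ∃ v : F, v ≠ 0 ∧ gramMat T' v v = Matrix.diagonal ![1, 1, 0] := by
  -- A vector `v` killed by a combination of `T 0` and `T 1` makes the three `T l v` dependent. They
  -- do not lie on a line, so they span a plane.
  obtain ⟨v, hv, x, y, hxy, hxyv⟩ := exists_singular_combination hF hF0 (T 0) (T 1)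
  obtain ⟨P, Q, hPQ, hQP, e, he, h0, h1, h2⟩ := exists_combination_orthonormal (fun l => T l v)
    ⟨![x, y, 0], fun h0 => by
      have e0 := congrFun h0 0
      have e1 := congrFun h0 1
      simp at e0 e1
      simp [e0, e1] at hxy, by simpa [Fin.sum_univ_three] using hxyv⟩
    (fun ⟨w, hw⟩ => hline ⟨v, hv, w, hw⟩)
  set T' : Fin 3 → F →ₗ[ℂ] F' := fun l => ∑ m, P l m • T m with hT'
  set S' : Fin 3 → E →ₗ[ℂ] E' := fun m => ∑ l, Q l m • S l with hS'
  have hTQ : ∀ l, T l = ∑ m, Q l m • T' m := eq_sum_smul_of_eq_sum_smul hQP fun _ => rfl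
  have hSP : ∀ l, S l = ∑ m, P m l • S' m :=
    eq_sum_smul_of_eq_sum_smul (P := Q.transpose) (Q := P.transpose)
      (by rw [← Matrix.transpose_mul, hQP, Matrix.transpose_one]) fun _ => rfl
  refine ⟨S', T', P, Q, h.change Q hTQ, hS.of_combination P.transpose hSP,
    hT.of_combination Q hTQ, hSP, hTQ, finrank_gramSpan_le_of_combination P fun _ => rfl, v, hv, ?_⟩
  have e0 : T' 0 v = e 0 := by rw [← h0]; simp [hT']
  have e1 : T' 1 v = e 1 := by rw [← h1]; simp [hT']
  have e2 : T' 2 v = 0 := by rw [← h2]; simp [hT']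
  have he' := orthonormal_iff_ite.1 he
  ext l m
  rw [gramMat_apply]
  fin_cases l <;> fin_cases m <;> simp [e0, e1, e2, he', -inner_self_eq_norm_sq_to_K]

variable [FiniteDimensional ℂ E] [FiniteDimensional ℂ E']

/-- All `T l` map the kernel of `gramMap T v` into the orthogonal complement of the plane spanned by
`T 0 v` and `T 1 v`. The kernel thus has codimension at least 2, and codimension exactly 2 would be
a splitting. -/
theorem IsometricSum.three_le_finrank_range_gramMap {S T}
    (h : IsometricSum (E := E) (E' := E') (F := F) (F' := F') (ι := Fin 3) S T)
    (hE : finrank ℂ E = finrank ℂ E') (hE0 : 0 < finrank ℂ E)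
    (hF : finrank ℂ F = finrank ℂ F') (hF3 : 3 ≤ finrank ℂ F) (hsplit : ¬ Splits T) {v : F}
    (hv : gramMat T v v = Matrix.diagonal ![1, 1, 0]) :
    3 ≤ finrank ℂ (LinearMap.range (gramMap T v)) := by
  let W : Submodule ℂ F' := Submodule.span ℂ (Set.range ![T 0 v, T 1 v])
  have hW : finrank ℂ W = 2 :=
    finrank_span_eq_card (orthonormal_of_gramMat hv).linearIndependent
  have hmaps : ∀ l, ∀ x ∈ LinearMap.ker (gramMap T v), T l x ∈ Wᗮ := by
    intro l x hx
    rw [Submodule.mem_orthogonal]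
    have hx0 : gramMat T v x = 0 := hx
    have hx' : ∀ i, inner ℂ (T i v) (T l x) = 0 := fun i => by
      rw [← gramMat_apply, hx0, Matrix.zero_apply]
    intro w hw
    induction hw using Submodule.span_induction with
    | mem w hw =>
      obtain ⟨i, rfl⟩ := hw
      fin_cases i
      exacts [hx' 0, hx' 1]
    | zero => simp
    | add x y _ _ hx hy => rw [inner_add_left, hx, hy, add_zero]
    | smul c x _ hx => rw [inner_smul_left, hx, mul_zero]
  have h1 := h.finrank_le hE hE0 hmaps
  have h2 := W.finrank_add_finrank_orthogonal
  have h3 := LinearMap.finrank_range_add_finrank_ker (gramMap T v)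
  by_contra hlt
  exact hsplit ⟨_, _, by lia, by lia, by lia, hmaps⟩

/-- A family whose products `(T l)† (T m)` span at most four dimensions splits. -/
theorem IsometricSum.splits_of_finrank_gramSpan_le_four {S T}
    (h : IsometricSum (E := E) (E' := E') (F := F) (F' := F') (ι := Fin 3) S T)
    (hE : finrank ℂ E = finrank ℂ E') (hE0 : 0 < finrank ℂ E)
    (hF : finrank ℂ F = finrank ℂ F') (hF3 : 3 ≤ finrank ℂ F) (hT : LinearIndependent ℂ T) {v : F}
    (hv0 : v ≠ 0) (hv : gramMat T v v = Matrix.diagonal ![1, 1, 0])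
    (ht : finrank ℂ (gramSpan T) ≤ 4) : Splits T := by
  by_contra hsplit
  have h3 := h.three_le_finrank_range_gramMap hE hE0 hF hF3 hsplit hv
  have hT2 := apply_two_eq_zero_of_gramMat hv
  obtain ⟨J, hJ, hJ2, hlt⟩ := finrank_gramSpan_inf_ker_lt (hT.ne_zero 2)
  set ε := Matrix.entryLinearMap ℂ ℂ (2 : Fin 3) (2 : Fin 3) with hε
  -- Both sides have dimension 3: the left at least by the absence of a splitting, the right at most
  -- because the entry functional removes one dimension from at most four.
  have hrange : LinearMap.range (gramMap T v) = gramSpan T ⊓ LinearMap.ker ε := by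
    refine Submodule.eq_of_le_of_finrank_le ?_ (by lia)
    rintro _ ⟨x, rfl⟩
    refine ⟨gramMat_mem_gramSpan T v x, ?_⟩
    change gramMat T v x 2 2 = 0
    rw [gramMat_apply, hT2, inner_zero_left]
  -- The matrices `gramMat T x v` also lie in this range, whose members have zero third row because
  -- `T 2 v = 0`.
  have hrow : ∀ x m, inner ℂ (T 2 x) (T m v) = 0 := by
    intro x m
    have : gramMat T x v ∈ LinearMap.range (gramMap T v) := by
      rw [hrange]
      refine ⟨gramMat_mem_gramSpan T x v, ?_⟩
      change gramMat T x v 2 2 = 0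
      rw [gramMat_apply, hT2, inner_zero_right]
    obtain ⟨z, hz⟩ := this
    rw [← gramMat_apply, ← hz, gramMap_apply, gramMat_apply, hT2, inner_zero_left]
  -- By the previous step the members of the range have zero third column, so modulo `J` the third
  -- column of any `X` is determined by its `(2, 2)` entry.
  have hcol : ∀ X ∈ gramSpan T, ∀ l, X l 2 = X 2 2 / J 2 2 * J l 2 := by
    intro X hX l
    have : X - (X 2 2 / J 2 2) • J ∈ LinearMap.range (gramMap T v) := by
      rw [hrange]
      refine ⟨Submodule.sub_mem _ hX (Submodule.smul_mem _ _ hJ), ?_⟩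
      change X 2 2 - X 2 2 / J 2 2 * J 2 2 = 0
      field_simp
      ring
    obtain ⟨z, hz⟩ := this
    have h4 := congrFun (congrFun hz l) 2
    rw [gramMap_apply, gramMat_apply, ← inner_conj_symm, hrow, map_zero] at h4
    exact (sub_eq_zero.1 h4.symm)
  have h5 := LinearMap.finrank_range_add_finrank_ker (T 2)
  have h6 := (LinearMap.range (T 2)).finrank_add_finrank_orthogonal
  have h7 : 0 < finrank ℂ (LinearMap.ker (T 2)) := by
    rw [finrank_pos_iff, Submodule.nontrivial_iff_ne_bot, Submodule.ne_bot_iff]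
    exact ⟨v, hT2, hv0⟩
  have h8 : 0 < finrank ℂ (LinearMap.range (T 2)) := by
    rw [finrank_pos_iff, Submodule.nontrivial_iff_ne_bot, ne_eq, LinearMap.range_eq_bot]
    exact hT.ne_zero 2
  -- For `x` in the kernel of `T 2` the `(2, 2)` entry of `gramMat T x z` vanishes, hence so does
  -- its third column: `T l x` is orthogonal to the range of `T 2`.
  refine hsplit ⟨LinearMap.ker (T 2), (LinearMap.range (T 2))ᗮ, by lia, h7, by lia,
    fun l x hx => ?_⟩
  rw [Submodule.mem_orthogonal']
  rintro _ ⟨z, rfl⟩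
  have h9 := hcol _ (gramMat_mem_gramSpan T x z) l
  rwa [gramMat_apply, gramMat_apply, LinearMap.mem_ker.1 hx, inner_zero_left, zero_div,
    zero_mul] at h9

theorem IsometricSum.five_le_finrank_gramSpan {S T}
    (h : IsometricSum (E := E) (E' := E') (F := F) (F' := F') (ι := Fin 3) S T)
    (hE : finrank ℂ E = finrank ℂ E') (hE0 : 0 < finrank ℂ E)
    (hF : finrank ℂ F = finrank ℂ F') (hF3 : 3 ≤ finrank ℂ F) (hS : LinearIndependent ℂ S)
    (hT : LinearIndependent ℂ T) (hsplit : ¬ Splits T) : 5 ≤ finrank ℂ (gramSpan T) := by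
  obtain ⟨S', T', P, Q, h', hS', hT', hP, hQ, hle, v, hv0, hv⟩ :=
    h.exists_adapted hS hT hF (by lia) fun hl => hsplit (h.splits_of_hasLine hE0 hl (by lia))
  by_contra hlt
  exact hsplit ((h'.splits_of_finrank_gramSpan_le_four hE hE0 hF hF3 hT' hv0 hv
    (by lia)).of_combination Q hQ)

end Lower

/-! ### Common eigenvectors from a small operator space -/

section CommonEigenvector

variable {F : Type*} [AddCommGroup F] [Module ℂ F] [FiniteDimensional ℂ F] [Nontrivial F]

/-- The relation factors as `(P - z) (Q - y) = x + y z`. If the constant is nonzero, the factors are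
inverse up to a scalar and commute. If it is zero, `P` acts as `z` on the range of `Q - y`, which is
invariant under `Q`. -/
theorem exists_common_eigenvector_of_mul_eq {P Q : End ℂ F} {x y z : ℂ}
    (h : P * Q = x • (1 : End ℂ F) + y • P + z • Q) :
    ∃ v ≠ 0, (∃ p : ℂ, P v = p • v) ∧ ∃ q : ℂ, Q v = q • v := by
  have hAB : (P - z • (1 : End ℂ F)) * (Q - y • (1 : End ℂ F)) = (x + y * z) • (1 : End ℂ F) := by
    simp only [sub_mul, mul_sub, h, smul_mul_assoc, mul_smul_comm, one_mul, mul_one]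
    module
  by_cases hc : x + y * z = 0
  · rw [hc, zero_smul] at hAB
    by_cases hB : Q - y • (1 : End ℂ F) = 0
    · obtain ⟨p, hp⟩ := Module.End.exists_eigenvalue P
      obtain ⟨v, hv⟩ := hp.exists_hasEigenvector
      refine ⟨v, hv.2, ⟨p, hv.apply_eq_smul⟩, y, ?_⟩
      rw [sub_eq_zero.1 hB]
      simp
    · have : Nontrivial (LinearMap.range (Q - y • (1 : End ℂ F))) := by
        rw [Submodule.nontrivial_iff_ne_bot, ne_eq, LinearMap.range_eq_bot]
        exact hB
      have hinv : ∀ u ∈ LinearMap.range (Q - y • (1 : End ℂ F)),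
          Q u ∈ LinearMap.range (Q - y • (1 : End ℂ F)) := by
        rintro _ ⟨u, rfl⟩
        exact ⟨Q u, by simp⟩
      obtain ⟨q, hq⟩ := Module.End.exists_eigenvalue (Q.restrict hinv)
      obtain ⟨⟨v, u, rfl⟩, hv⟩ := hq.exists_hasEigenvector
      refine ⟨_, fun h0 => hv.2 (Subtype.ext h0), ⟨z, ?_⟩, q, congrArg Subtype.val hv.apply_eq_smul⟩
      have := LinearMap.congr_fun hAB u
      rw [Module.End.mul_apply, LinearMap.sub_apply, LinearMap.zero_apply, sub_eq_zero] at this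
      simpa using this
  · have h1 : ((x + y * z)⁻¹ • (P - z • (1 : End ℂ F))) * (Q - y • (1 : End ℂ F)) = 1 := by
      rw [smul_mul_assoc, hAB, smul_smul, inv_mul_cancel₀ hc, one_smul]
    have h2 := mul_eq_one_comm.1 h1
    have hcomm : Commute P Q := by
      have h3 : (Q - y • (1 : End ℂ F)) * (P - z • (1 : End ℂ F)) =
          (P - z • (1 : End ℂ F)) * (Q - y • (1 : End ℂ F)) := by
        rw [mul_smul_comm] at h2
        rw [hAB, ← inv_smul_eq_iff₀ hc, h2]
      refine sub_eq_zero.1 ?_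
      rw [← sub_eq_zero.2 h3.symm]
      simp only [sub_mul, mul_sub, smul_mul_assoc, mul_smul_comm, one_mul, mul_one]
      module
    obtain ⟨v, hv, hvc⟩ := exists_common_eigenvector {P, Q} (by
      rintro f (rfl | rfl) g (rfl | rfl)
      exacts [Commute.refl _, hcomm, hcomm.symm, Commute.refl _])
    exact ⟨v, hv, hvc P (by simp), hvc Q (by simp)⟩

theorem mem_span_of_linearIndependent_of_finrank_le {V : Type*} [AddCommGroup V] [Module ℂ V]
    {n : ℕ} {W : Submodule ℂ V} [FiniteDimensional ℂ W] (hW : finrank ℂ W ≤ n) {x : Fin n → V}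
    (hx : LinearIndependent ℂ x) (hxW : ∀ i, x i ∈ W) {y : V} (hy : y ∈ W) :
    y ∈ Submodule.span ℂ (Set.range x) := by
  have hle : Submodule.span ℂ (Set.range x) ≤ W := by
    rw [Submodule.span_le]
    rintro _ ⟨i, rfl⟩
    exact hxW i
  rw [Submodule.eq_of_le_of_finrank_le hle (by
    rw [finrank_span_eq_card hx, Fintype.card_fin]; exact hW)]
  exact hy

/-- Operators `V`, `W`, `Z` with `1, V, W, Z, V Z, W Z` in a three-dimensional space have a common
eigenvector, if `1` and `V` are linearly independent and `Z` is not scalar. -/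
theorem exists_common_eigenvector_of_mem {M : Submodule ℂ (End ℂ F)} (hM : finrank ℂ M ≤ 3)
    {V W Z : End ℂ F} (h1 : 1 ∈ M) (hV : V ∈ M) (hW : W ∈ M) (hZ : Z ∈ M) (hVZ : V * Z ∈ M)
    (hWZ : W * Z ∈ M) (hli : LinearIndependent ℂ ![1, V]) (hZ1 : ∀ ζ : ℂ, Z ≠ ζ • 1) :
    ∃ v ≠ 0, (∃ c : ℂ, V v = c • v) ∧ (∃ c : ℂ, W v = c • v) ∧ ∃ c : ℂ, Z v = c • v := by
  have hspan : ∀ {A B X : End ℂ F}, X ∈ Submodule.span ℂ (Set.range ![1, A, B]) →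
      ∃ x y z : ℂ, X = x • (1 : End ℂ F) + y • A + z • B := by
    intro A B X hX
    obtain ⟨c, hc⟩ := (Submodule.mem_span_range_iff_exists_fun ℂ).1 hX
    exact ⟨c 0, c 1, c 2, by rw [← hc]; simp [Fin.sum_univ_three]⟩
  have hpair : ∀ {X : End ℂ F}, ¬ LinearIndependent ℂ ![1, V, X] →
      ∃ x y : ℂ, X = x • (1 : End ℂ F) + y • V := by
    intro X hX
    have h2 : ![1, V, X] = Fin.snoc ![1, V] X := by
      ext i : 1
      fin_cases i <;> rfl
    rw [h2, linearIndependent_finSnoc, not_and, not_not] at hX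
    obtain ⟨c, hc⟩ := (Submodule.mem_span_range_iff_exists_fun ℂ).1 (hX hli)
    exact ⟨c 0, c 1, by rw [← hc]; simp [Fin.sum_univ_two]⟩
  by_cases hVZli : LinearIndependent ℂ ![1, V, Z]
  · have hmem : ∀ i, ![1, V, Z] i ∈ M := by
      intro i
      fin_cases i
      exacts [h1, hV, hZ]
    obtain ⟨x, y, z, hxyz⟩ := hspan (mem_span_of_linearIndependent_of_finrank_le hM hVZli hmem hVZ)
    obtain ⟨x', y', z', hxyz'⟩ :=
      hspan (mem_span_of_linearIndependent_of_finrank_le hM hVZli hmem hW)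
    obtain ⟨v, hv, ⟨p, hp⟩, q, hq⟩ := exists_common_eigenvector_of_mul_eq hxyz
    refine ⟨v, hv, ⟨p, hp⟩, ⟨x' + y' * p + z' * q, ?_⟩, q, hq⟩
    rw [hxyz']
    simp only [LinearMap.add_apply, LinearMap.smul_apply, hp, hq, Module.End.one_apply]
    module
  · obtain ⟨α, β, hαβ⟩ := hpair hVZli
    have hβ : β ≠ 0 := by
      rintro rfl
      exact hZ1 α (by rw [hαβ]; simp)
    have hZv : ∀ {v : F} {p : ℂ}, V v = p • v → Z v = (α + β * p) • v := by
      intro v p hp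
      rw [hαβ]
      simp only [LinearMap.add_apply, LinearMap.smul_apply, hp, Module.End.one_apply]
      module
    by_cases hVWli : LinearIndependent ℂ ![1, V, W]
    · have hmem : ∀ i, ![1, V, W] i ∈ M := by
        intro i
        fin_cases i
        exacts [h1, hV, hW]
      have hWV : W * V ∈ M := by
        have : W * V = β⁻¹ • (W * Z - α • W) := by
          rw [hαβ, mul_add, mul_smul_comm, mul_smul_comm, mul_one, add_sub_cancel_left, smul_smul,
            inv_mul_cancel₀ hβ, one_smul]
        rw [this]
        exact M.smul_mem _ (M.sub_mem hWZ (M.smul_mem _ hW))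
      obtain ⟨x, y, z, hxyz⟩ :=
        hspan (mem_span_of_linearIndependent_of_finrank_le hM hVWli hmem hWV)
      obtain ⟨v, hv, ⟨p, hp⟩, q, hq⟩ := exists_common_eigenvector_of_mul_eq
        (hxyz.trans (add_right_comm _ _ _))
      exact ⟨v, hv, ⟨q, hq⟩, ⟨p, hp⟩, _, hZv hq⟩
    · obtain ⟨γ, δ, hγδ⟩ := hpair hVWli
      obtain ⟨p, hp⟩ := Module.End.exists_eigenvalue V
      obtain ⟨v, hv⟩ := hp.exists_hasEigenvector
      have hpv := hv.apply_eq_smul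
      refine ⟨v, hv.2, ⟨p, hpv⟩, ⟨γ + δ * p, ?_⟩, _, hZv hpv⟩
      rw [hγδ]
      simp only [LinearMap.add_apply, LinearMap.smul_apply, hpv, Module.End.one_apply]
      module

end CommonEigenvector

/-! ### Three-dimensional first factor, two diagonal columns -/

section Qutrit

variable {E E' F F' : Type*}
  [NormedAddCommGroup E] [InnerProductSpace ℂ E] [NormedAddCommGroup E'] [InnerProductSpace ℂ E']
  [NormedAddCommGroup F] [InnerProductSpace ℂ F] [NormedAddCommGroup F'] [InnerProductSpace ℂ F']

/-- The plane spanned by `x` and `y` goes into the plane `eᗮ`. -/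
theorem splits_of_inner_eq_zero {ι : Type*} [FiniteDimensional ℂ E'] {S : ι → E →ₗ[ℂ] E'}
    (hE : finrank ℂ E = 3)
    (hE' : finrank ℂ E' = 3) {x y : E} (hxy : LinearIndependent ℂ ![x, y]) {e : E'} (he : e ≠ 0)
    (hx : ∀ l, inner ℂ e (S l x) = 0) (hy : ∀ l, inner ℂ e (S l y) = 0) : Splits S := by
  have h1 : finrank ℂ (Submodule.span ℂ (Set.range ![x, y])) = 2 := finrank_span_eq_card hxy
  have h2 := (ℂ ∙ e).finrank_add_finrank_orthogonal
  rw [finrank_span_singleton he] at h2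
  refine ⟨Submodule.span ℂ (Set.range ![x, y]), (ℂ ∙ e)ᗮ, by lia, by lia, by lia, fun l v hv => ?_⟩
  rw [Submodule.mem_orthogonal_singleton_iff_inner_right]
  induction hv using Submodule.span_induction with
  | mem w hw =>
    obtain ⟨i, rfl⟩ := hw
    fin_cases i
    exacts [hx l, hy l]
  | zero => simp
  | add x y _ _ hx hy => rw [map_add, inner_add_right, hx, hy, add_zero]
  | smul c x _ hx => rw [map_smul, inner_smul_right, hx, mul_zero]

theorem injective_of_inner_map_eq {A : F →ₗ[ℂ] F'} {τ : ℂ} (hτ : τ ≠ 0)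
    (hA : ∀ v v', inner ℂ (A v) (A v') = τ * inner ℂ v v') : Function.Injective A := by
  rw [injective_iff_map_eq_zero]
  intro v hv
  simpa [hv, hτ] using (hA v v).symm

theorem exists_apply_ne_zero {A : F →ₗ[ℂ] F'} (hA : A ≠ 0) : ∃ v, A v ≠ 0 := by
  by_contra hcon
  push Not at hcon
  exact hA (LinearMap.ext hcon)

theorem ne_zero_of_inner_map_eq {A : F →ₗ[ℂ] F'} {τ : ℂ} (hA0 : A ≠ 0)
    (hA : ∀ v v', inner ℂ (A v) (A v') = τ * inner ℂ v v') : τ ≠ 0 := by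
  rintro rfl
  obtain ⟨v, hv⟩ := exists_apply_ne_zero hA0
  exact hv (inner_self_eq_zero.1 ((hA v v).trans (zero_mul _)))

variable [FiniteDimensional ℂ F] [FiniteDimensional ℂ F']

theorem surjective_of_inner_map_eq (hF : finrank ℂ F = finrank ℂ F') {A : F →ₗ[ℂ] F'} {τ : ℂ}
    (hτ : τ ≠ 0) (hA : ∀ v v', inner ℂ (A v) (A v') = τ * inner ℂ v v') :
    Function.Surjective A :=
  (LinearMap.injective_iff_surjective_of_finrank_eq_finrank hF).1 (injective_of_inner_map_eq hτ hA)

/-- If `⟪A v, B v'⟫ = c * ⟪v, Z v'⟫` for a multiple `A` of a unitary, then `B` is a multiple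
of `A Z`. -/
theorem apply_eq_smul_of_inner_map_eq (hF : finrank ℂ F = finrank ℂ F') {A B : F →ₗ[ℂ] F'}
    {Z : F →ₗ[ℂ] F} {τ c : ℂ} (hτ : τ ≠ 0) (hA : ∀ v v', inner ℂ (A v) (A v') = τ * inner ℂ v v')
    (hB : ∀ v v', inner ℂ (A v) (B v') = c * inner ℂ v (Z v')) : B = (c / τ) • (A ∘ₗ Z) := by
  ext v'
  refine ext_inner_left ℂ fun w => ?_
  obtain ⟨v, rfl⟩ := surjective_of_inner_map_eq hF hτ hA w
  rw [hB, LinearMap.smul_apply, inner_smul_right, LinearMap.comp_apply, hA]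
  field_simp

variable [FiniteDimensional ℂ E'] [FiniteDimensional ℂ E]

/-- The case of a three-dimensional `E` with two columns of the block matrix in diagonal form. -/
theorem IsometricSum.splits_or_hasLine_of_gramMat {S : Fin 3 → E →ₗ[ℂ] E'} {T : Fin 3 → F →ₗ[ℂ] F'}
    (h : IsometricSum S T) (hE : finrank ℂ E = 3) (hE' : finrank ℂ E' = 3)
    (hF : finrank ℂ F = finrank ℂ F') (hF0 : 0 < finrank ℂ F)
    (hS : LinearIndependent ℂ S) (hT : LinearIndependent ℂ T) {a y : E} (ha : a ≠ 0) (hy : y ≠ 0)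
    (hay : inner ℂ a y = 0) (haa : gramMat S a a = Matrix.diagonal ![1, 1, 0]) {κ₀ κ₁ : ℂ}
    (hκ : gramMat S a y = Matrix.diagonal ![κ₀, κ₁, 0]) (hκ0 : κ₀ ≠ 0 ∨ κ₁ ≠ 0) :
    Splits S ∨ HasLine T := by
  have : Nontrivial F := finrank_pos_iff.1 hF0
  obtain ⟨e, he⟩ := Orthonormal.exists_orthonormalBasis_extension_of_card_eq (𝕜 := ℂ)
    (ι := Fin 3) (by simp [hE']) (v := ![S 0 a, S 1 a, 0]) (s := {0, 1}) (by
      have hon := orthonormal_iff_ite.1 (orthonormal_of_gramMat haa)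
      have h00 := hon 0 0
      have h01 := hon 0 1
      have h10 := hon 1 0
      have h11 := hon 1 1
      simp only [Matrix.cons_val_zero, Matrix.cons_val_one, if_true, Fin.zero_eq_one_iff,
        Nat.reduceEqDiff, if_false, Fin.one_eq_zero_iff] at h00 h01 h10 h11
      rw [orthonormal_iff_ite]
      rintro ⟨i, rfl | rfl⟩ ⟨j, rfl | rfl⟩ <;>
        simp [h00, h01, h10, h11, Subtype.ext_iff, -inner_self_eq_norm_sq_to_K])
  have he0 : e 0 = S 0 a := he 0 (by simp)
  have he1 : e 1 = S 1 a := he 1 (by simp)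
  have hS2 : S 2 a = 0 := apply_two_eq_zero_of_gramMat haa
  have he2 : e 2 ≠ 0 := e.orthonormal.ne_zero 2
  obtain ⟨c, hc0, hac, hyc⟩ : ∃ c : E, c ≠ 0 ∧ inner ℂ a c = 0 ∧ inner ℂ y c = 0 := by
    have h1 : finrank ℂ (Submodule.span ℂ (Set.range ![a, y])) ≤ 2 := by
      exact finrank_range_le_card (R := ℂ) ![a, y]
    have h2 := (Submodule.span ℂ (Set.range ![a, y])).finrank_add_finrank_orthogonal
    have h3 : 0 < finrank ℂ (Submodule.span ℂ (Set.range ![a, y]))ᗮ := by lia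
    rw [finrank_pos_iff, Submodule.nontrivial_iff_ne_bot, Submodule.ne_bot_iff] at h3
    obtain ⟨c, hc, hc0⟩ := h3
    rw [Submodule.mem_orthogonal] at hc
    exact ⟨c, hc0, hc a (Submodule.subset_span ⟨0, rfl⟩), hc y (Submodule.subset_span ⟨1, rfl⟩)⟩
  have hli : LinearIndependent ℂ ![a, y, c] := by
    refine linearIndependent_of_ne_zero_of_inner_eq_zero (𝕜 := ℂ) ?_ ?_
    · intro i
      fin_cases i
      exacts [ha, hy, hc0]
    · intro i j hij
      have hya : inner ℂ y a = 0 := inner_eq_zero_symm.1 hay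
      have hca : inner ℂ c a = 0 := inner_eq_zero_symm.1 hac
      have hcy : inner ℂ c y = 0 := inner_eq_zero_symm.1 hyc
      fin_cases i <;> fin_cases j <;> first | exact absurd rfl hij | assumption
  let f : Basis (Fin 3) ℂ E := basisOfLinearIndependentOfCardEqFinrank hli (by simp [hE])
  have hf : ⇑f = ![a, y, c] := coe_basisOfLinearIndependentOfCardEqFinrank hli _
  -- In the bases `e` and `a, y, c`, the first two columns of the block matrix are `(T 0, T 1, 0)`
  -- and `(κ₀ T 0, κ₁ T 1, X)`; the third is `(R₀, R₁, R₂)`.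
  have m0a : blockEntry S T (e 0) a = T 0 := by
    have : ∀ l, inner ℂ (e 0) (S l a) = Matrix.diagonal ![1, 1, 0] 0 l := fun l => by
      rw [he0, ← gramMat_apply, haa]
    simp [blockEntry, this, Fin.sum_univ_three]
  have m1a : blockEntry S T (e 1) a = T 1 := by
    have : ∀ l, inner ℂ (e 1) (S l a) = Matrix.diagonal ![1, 1, 0] 1 l := fun l => by
      rw [he1, ← gramMat_apply, haa]
    simp [blockEntry, this, Fin.sum_univ_three]
  have e2a : ∀ l, inner ℂ (e 2) (S l a) = 0 := by
    intro l
    fin_cases l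
    · exact (congrArg _ he0.symm).trans (e.inner_eq_zero (by decide))
    · exact (congrArg _ he1.symm).trans (e.inner_eq_zero (by decide))
    · exact (congrArg _ hS2).trans (inner_zero_right _)
  have m2a : blockEntry S T (e 2) a = 0 := by simp [blockEntry, e2a]
  have m0y : blockEntry S T (e 0) y = κ₀ • T 0 := by
    have : ∀ l, inner ℂ (e 0) (S l y) = Matrix.diagonal ![κ₀, κ₁, 0] 0 l := fun l => by
      rw [he0, ← gramMat_apply, hκ]
    simp [blockEntry, this, Fin.sum_univ_three]
  have m1y : blockEntry S T (e 1) y = κ₁ • T 1 := by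
    have : ∀ l, inner ℂ (e 1) (S l y) = Matrix.diagonal ![κ₀, κ₁, 0] 1 l := fun l => by
      rw [he1, ← gramMat_apply, hκ]
    simp [blockEntry, this, Fin.sum_univ_three]
  set X := blockEntry S T (e 2) y with hX
  set R₀ := blockEntry S T (e 0) c with hR₀
  set R₁ := blockEntry S T (e 1) c with hR₁
  set R₂ := blockEntry S T (e 2) c with hR₂
  have eqs := h.sum_inner_blockEntry e
  simp only [Fin.sum_univ_three] at eqs
  set α : ℂ := inner ℂ a a with hα
  have hα0 : α ≠ 0 := inner_self_ne_zero.2 ha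
  have eaa : ∀ v v', inner ℂ (T 0 v) (T 0 v') + inner ℂ (T 1 v) (T 1 v') = α * inner ℂ v v' := by
    intro v v'
    simpa [m0a, m1a, m2a, -inner_self_eq_norm_sq_to_K] using eqs a a v v'
  have eay : ∀ v v', κ₀ * inner ℂ (T 0 v) (T 0 v') + κ₁ * inner ℂ (T 1 v) (T 1 v') = 0 := by
    intro v v'
    simpa [m0a, m1a, m2a, m0y, m1y, hay, inner_smul_right] using eqs a y v v'
  have eyy : ∀ v v', (starRingEnd ℂ) κ₀ * κ₀ * inner ℂ (T 0 v) (T 0 v') +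
      (starRingEnd ℂ) κ₁ * κ₁ * inner ℂ (T 1 v) (T 1 v') + inner ℂ (X v) (X v') =
      inner ℂ y y * inner ℂ v v' := by
    intro v v'
    rw [← eqs y y v v', m0y, m1y, ← hX]
    simp only [LinearMap.smul_apply, inner_smul_left, inner_smul_right]
    ring
  have eac : ∀ v v', inner ℂ (T 0 v) (R₀ v') + inner ℂ (T 1 v) (R₁ v') = 0 := by
    intro v v'
    simpa [m0a, m1a, m2a, hac] using eqs a c v v'
  have eyc : ∀ v v', (starRingEnd ℂ) κ₀ * inner ℂ (T 0 v) (R₀ v') +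
      (starRingEnd ℂ) κ₁ * inner ℂ (T 1 v) (R₁ v') + inner ℂ (X v) (R₂ v') = 0 := by
    intro v v'
    simpa [m0y, m1y, hyc, inner_smul_left, mul_comm] using eqs y c v v'
  -- Equal `κ₀` and `κ₁` would make column `y` overlap column `a`. Since they differ, the relations
  -- can be solved for `T 0† T 0`, `T 1† T 1` and `X† X`, which are all scalar.
  have hκne : κ₀ - κ₁ ≠ 0 := by
    intro h0
    have h1 : κ₀ = κ₁ := sub_eq_zero.1 h0
    obtain ⟨v, hv⟩ := exists_ne (0 : F)
    have h2 : κ₁ * (α * inner ℂ v v) = 0 := by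
      rw [← eaa, ← eay v v, h1]; ring
    have h3 : κ₁ = 0 := by
      simpa [hα0, hv] using h2
    simp [h1, h3] at hκ0
  obtain ⟨τ₀, hτ₀⟩ : ∃ τ : ℂ, ∀ v v', inner ℂ (T 0 v) (T 0 v') = τ * inner ℂ v v' := by
    refine ⟨-κ₁ * α / (κ₀ - κ₁), fun v v' => ?_⟩
    field_simp
    linear_combination eay v v' - κ₁ * eaa v v'
  obtain ⟨τ₁, hτ₁⟩ : ∃ τ : ℂ, ∀ v v', inner ℂ (T 1 v) (T 1 v') = τ * inner ℂ v v' := by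
    refine ⟨κ₀ * α / (κ₀ - κ₁), fun v v' => ?_⟩
    field_simp
    linear_combination κ₀ * eaa v v' - eay v v'
  obtain ⟨χ, hχ⟩ : ∃ χ : ℂ, ∀ v v', inner ℂ (X v) (X v') = χ * inner ℂ v v' := by
    refine ⟨inner ℂ y y - (starRingEnd ℂ) κ₀ * κ₀ * τ₀ - (starRingEnd ℂ) κ₁ * κ₁ * τ₁,
      fun v v' => ?_⟩
    have := eyy v v'
    rw [hτ₀, hτ₁] at this
    linear_combination this
  have hτ₀0 := ne_zero_of_inner_map_eq (hT.ne_zero 0) hτ₀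
  have hτ₁0 := ne_zero_of_inner_map_eq (hT.ne_zero 1) hτ₁
  by_cases hX0 : X = 0
  · left
    have hay' : LinearIndependent ℂ ![a, y] := by
      have := hli.comp ![0, 1] (by decide)
      convert this using 1
      ext i : 1
      fin_cases i <;> rfl
    exact splits_of_inner_eq_zero hE hE' hay' he2 e2a (Fintype.linearIndependent_iff.1 hT _ hX0)
  have hχ0 := ne_zero_of_inner_map_eq hX0 hχ
  let t := LinearEquiv.ofInjectiveOfFinrankEq (T 0) (injective_of_inner_map_eq hτ₀0 hτ₀) hF
  have ht : ∀ v, T 0 (t.symm v) = v := fun v => t.apply_symm_apply v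
  -- Orthogonality to the first two columns forces the third column to be `T 0 Z` followed by
  -- nonzero multiples of `T 1 Z` and `X Z`.
  set Z : End ℂ F := t.symm.toLinearMap ∘ₗ R₀ with hZ
  have hR₀Z : R₀ = T 0 ∘ₗ Z := LinearMap.ext fun v => (ht _).symm
  have hR₁Z : R₁ = (-τ₀ / τ₁) • (T 1 ∘ₗ Z) := by
    refine apply_eq_smul_of_inner_map_eq hF hτ₁0 hτ₁ fun v v' => ?_
    have := eac v v'
    rw [hR₀Z, LinearMap.comp_apply, hτ₀] at this
    linear_combination this
  set ν : ℂ := ((starRingEnd ℂ) κ₁ - (starRingEnd ℂ) κ₀) * τ₀ / χ with hν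
  have hR₂Z : R₂ = ν • (X ∘ₗ Z) := by
    refine apply_eq_smul_of_inner_map_eq hF hχ0 hχ fun v v' => ?_
    have h1 := eac v v'
    have h2 := eyc v v'
    rw [hR₀Z, LinearMap.comp_apply, hτ₀] at h1 h2
    linear_combination h2 - (starRingEnd ℂ) κ₁ * h1
  have hν0 : ν ≠ 0 := by
    refine div_ne_zero (mul_ne_zero ?_ hτ₀0) hχ0
    rw [← map_sub, ne_eq, map_eq_zero, ← neg_sub, neg_eq_zero]
    exact hκne
  by_cases hZ1 : ∃ ζ : ℂ, Z = ζ • 1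
  · left
    obtain ⟨ζ, hζ⟩ := hZ1
    -- If `Z = ζ`, then `R₂ = ν ζ X`, so `c - ν ζ y` has zero block in row `e 2`, as `a` does.
    refine splits_of_inner_eq_zero hE hE' (x := a) (y := c - (ν * ζ) • y) ?_ he2 e2a ?_
    · rw [LinearIndependent.pair_iff]
      intro s r hsr
      have h1 := Fintype.linearIndependent_iff.1 hli ![s, -(r * (ν * ζ)), r] (by
        rw [← hsr]
        simp only [Fin.sum_univ_three, Matrix.cons_val_zero, Matrix.cons_val_one, Matrix.cons_val]
        module)
      exact ⟨h1 0, h1 2⟩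
    · intro l
      refine Fintype.linearIndependent_iff.1 hT
        (fun l => inner ℂ (e 2) (S l (c - (ν * ζ) • y))) ?_ l
      have h1 : ∑ l, inner ℂ (e 2) (S l (c - (ν * ζ) • y)) • T l = R₂ - (ν * ζ) • X := by
        simp only [hR₂, hX, blockEntry, map_sub, map_smul, inner_sub_right, inner_smul_right,
          sub_smul, Finset.sum_sub_distrib, Finset.smul_sum, smul_smul]
      rw [h1, hR₂Z, hζ, LinearMap.comp_smul, Module.End.one_eq_id, LinearMap.comp_id, smul_smul,
        sub_self]
  · right
    push Not at hZ1
    let L : (F →ₗ[ℂ] F') →ₗ[ℂ] End ℂ F := LinearMap.llcomp ℂ F F' F t.symm.toLinearMap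
    have hL : ∀ A : F →ₗ[ℂ] F', L A = t.symm.toLinearMap ∘ₗ A := fun A => rfl
    -- Pulling the span of the `T l` back along `T 0` gives at most three dimensions that contain
    -- `1`, `V = T 0⁻¹ T 1`, `W = T 0⁻¹ X`, `Z`, `V Z` and `W Z`. A common eigenvector of `V`, `W`,
    -- `Z` is sent by all nine blocks into the line of `T 0 v`.
    let M : Submodule ℂ (End ℂ F) := (Submodule.span ℂ (Set.range T)).map L
    have hM : finrank ℂ M ≤ 3 := by
      refine (Submodule.finrank_map_le _ _).trans ?_
      exact finrank_range_le_card (R := ℂ) T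
    have hentry : ∀ b x, blockEntry S T b x ∈ Submodule.span ℂ (Set.range T) := fun b x =>
      Submodule.sum_mem _ fun l _ => Submodule.smul_mem _ _ (Submodule.subset_span ⟨l, rfl⟩)
    have hTM : ∀ l, L (T l) ∈ M := fun l =>
      Submodule.mem_map_of_mem (Submodule.subset_span ⟨l, rfl⟩)
    have hL0 : L (T 0) = 1 := LinearMap.ext fun v => t.symm_apply_apply v
    have h1 : (1 : End ℂ F) ∈ M := hL0 ▸ hTM 0
    have hVZ : L (T 1) * Z ∈ M := by
      have h2 : L (T 1) * Z = (-τ₀ / τ₁)⁻¹ • L R₁ := by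
        rw [hR₁Z, map_smul, smul_smul, inv_mul_cancel₀ (div_ne_zero (neg_ne_zero.2 hτ₀0) hτ₁0),
          one_smul]
        rfl
      rw [h2]
      exact M.smul_mem _ (Submodule.mem_map_of_mem (hentry _ _))
    have hWZ : L X * Z ∈ M := by
      have h2 : L X * Z = ν⁻¹ • L R₂ := by
        rw [hR₂Z, map_smul, smul_smul, inv_mul_cancel₀ hν0, one_smul]
        rfl
      rw [h2]
      exact M.smul_mem _ (Submodule.mem_map_of_mem (hentry _ _))
    have hli2 : LinearIndependent ℂ ![1, L (T 1)] := by
      rw [LinearIndependent.pair_iff]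
      intro s r hsr
      have h2 : s • T 0 + r • T 1 = 0 := by
        ext v
        have := congrArg (T 0) (LinearMap.congr_fun hsr v)
        simpa [hL, ht] using this
      have h3 := Fintype.linearIndependent_iff.1 hT ![s, r, 0] (by
        rw [← h2]; simp [Fin.sum_univ_three])
      exact ⟨h3 0, h3 1⟩
    obtain ⟨v, hv, ⟨p, hp⟩, ⟨q, hq⟩, r, hr⟩ := exists_common_eigenvector_of_mem hM h1 (hTM 1)
      (Submodule.mem_map_of_mem (hentry (e 2) y)) (Submodule.mem_map_of_mem (hentry (e 0) c))
      hVZ hWZ hli2 hZ1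
    have hZv : Z v = r • v := hr
    have hTv : T 1 v = p • T 0 v := by
      rw [← map_smul, ← hp, hL, LinearMap.comp_apply]; exact (ht _).symm
    have hXv : X v = q • T 0 v := by
      rw [← map_smul, ← hq, hL, LinearMap.comp_apply]; exact (ht _).symm
    let N : Submodule ℂ (F →ₗ[ℂ] F') := (ℂ ∙ T 0 v).comap (LinearMap.applyₗ v)
    have hN : ∀ {A : F →ₗ[ℂ] F'} (d : ℂ), A v = d • T 0 v → A ∈ N := fun d hd =>
      Submodule.mem_span_singleton.2 ⟨d, hd.symm⟩
    have hmem : ∀ l, T l ∈ N := by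
      refine mem_of_forall_blockEntry_mem hS f e fun i j => ?_
      rw [hf]
      fin_cases i <;> fin_cases j
      · exact hN 1 (by simpa using congrArg (· v) m0a)
      · exact hN p (by simpa [hTv] using congrArg (· v) m1a)
      · exact hN 0 (by simpa using congrArg (· v) m2a)
      · exact hN κ₀ (by simpa using congrArg (· v) m0y)
      · exact hN (κ₁ * p) (by simpa [hTv, mul_smul] using congrArg (· v) m1y)
      · exact hN q hXv
      · refine hN r ?_
        change R₀ v = _
        rw [hR₀Z, LinearMap.comp_apply, hZv, map_smul]
      · refine hN ((-τ₀ / τ₁) * r * p) ?_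
        change R₁ v = _
        rw [hR₁Z, LinearMap.smul_apply, LinearMap.comp_apply, hZv, map_smul, hTv, smul_smul,
          smul_smul, mul_assoc]
      · refine hN (ν * r * q) ?_
        change R₂ v = _
        rw [hR₂Z, LinearMap.smul_apply, LinearMap.comp_apply, hZv, map_smul, hXv, smul_smul,
          smul_smul, mul_assoc]
    refine ⟨v, hv, T 0 v, fun l => ?_⟩
    obtain ⟨d, hd⟩ := Submodule.mem_span_singleton.1 (hmem l)
    exact ⟨d, hd.symm⟩

end Qutrit

/-! ### A Hermitian Gram matrix by dimension count -/

section HermitianGram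

variable {E E' F F' : Type*}
  [NormedAddCommGroup E] [InnerProductSpace ℂ E] [NormedAddCommGroup E'] [InnerProductSpace ℂ E']
  [NormedAddCommGroup F] [InnerProductSpace ℂ F] [NormedAddCommGroup F'] [InnerProductSpace ℂ F']

/-- By isometry, pairing with a fixed Gram matrix `gramMat T v v` recovers the inner product from
the Gram matrix. -/
theorem IsometricSum.inner_eq_zero_of_gramMat_eq {ι : Type*} [Fintype ι] {S : ι → E →ₗ[ℂ] E'}
    {T : ι → F →ₗ[ℂ] F'} [FiniteDimensional ℂ F]
    (h : IsometricSum S T) (hF0 : 0 < finrank ℂ F) {x y x' y' : E}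
    (hg : gramMat S x y = gramMat S x' y') (hxy : inner ℂ x' y' = 0) : inner ℂ x y = 0 := by
  have : Nontrivial F := finrank_pos_iff.1 hF0
  obtain ⟨v, hv⟩ := exists_ne (0 : F)
  have h1 := h x y v v
  simp only [← gramMat_apply S, hg] at h1
  simp only [gramMat_apply S, h x' y' v v, hxy, zero_mul] at h1
  simpa [hv] using h1.symm

/-- Taking adjoints exchanges `z` and `z'`, so their sum gives a Hermitian matrix. When the sum is
zero, `gramMat S a z` is anti-Hermitian and the factor `i` repairs it. -/
theorem isHermitian_gramMat_of_eq {ι : Type*} {S : ι → E →ₗ[ℂ] E'} {a z z' : E}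
    (hz : gramMat S a z = gramMat S z' a) :
    (gramMat S a (z + z')).IsHermitian ∧ (z' = -z → (gramMat S a (Complex.I • z)).IsHermitian) := by
  have hz' : gramMat S z a = gramMat S a z' := by
    rw [← conjTranspose_gramMat, hz, conjTranspose_gramMat]
  refine ⟨?_, fun h => ?_⟩
  · rw [Matrix.IsHermitian, conjTranspose_gramMat]
    have h1 : gramMat S (z + z') a = gramMat S z a + gramMat S z' a := by
      ext; simp [gramMat]
    rw [h1, hz', ← hz, ← gramMap_apply, ← gramMap_apply, ← gramMap_apply, map_add, add_comm]
  · rw [Matrix.IsHermitian, conjTranspose_gramMat]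
    have h1 : gramMat S (Complex.I • z) a = -Complex.I • gramMat S z a := by
      ext; simp [gramMat, mul_comm]
    rw [h1, hz', h, ← gramMap_apply, ← gramMap_apply, map_neg, map_smul, smul_neg, neg_smul,
      neg_neg]

/-- A dimension count: in a small span of Gram matrices, some Gram matrix in the row of `a` is
Hermitian. -/
theorem IsometricSum.exists_isHermitian_gramMat [FiniteDimensional ℂ E]
    [FiniteDimensional ℂ F] {S : Fin 3 → E →ₗ[ℂ] E'}
    {T : Fin 3 → F →ₗ[ℂ] F'} (h : IsometricSum S T) (hF0 : 0 < finrank ℂ F)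
    (hE : finrank ℂ E = 3) (hS : S 2 ≠ 0) {a : E} (ha : a ≠ 0) (hS2 : S 2 a = 0)
    (hinj : Function.Injective (gramMap S a)) (hs : finrank ℂ (gramSpan S) ≤ 5) :
    ∃ y ≠ 0, inner ℂ a y = 0 ∧ (gramMat S a y).IsHermitian := by
  have hfin : finrank ℂ (ℂ ∙ a)ᗮ = 2 := by
    have := (ℂ ∙ a).finrank_add_finrank_orthogonal
    rw [finrank_span_singleton ha] at this
    lia
  let b := (stdOrthonormalBasis ℂ (ℂ ∙ a)ᗮ).reindex (finCongr hfin)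
  have hab : ∀ i, inner ℂ a (b i : E) = 0 := fun i =>
    Submodule.mem_orthogonal_singleton_iff_inner_right.1 (b i).2
  have hb : ∀ x y : ℂ, x • (b 0 : E) + y • (b 1 : E) = 0 → x = 0 ∧ y = 0 := by
    intro x y hxy
    have h1 : x • b 0 + y • b 1 = 0 := Subtype.ext hxy
    have h2 := Fintype.linearIndependent_iff.1 b.orthonormal.linearIndependent ![x, y]
      (by simpa [Fin.sum_univ_two] using h1)
    exact ⟨h2 0, h2 1⟩
  let w : Fin 5 → Matrix (Fin 3) (Fin 3) ℂ :=
    ![gramMat S a a, gramMat S a (b 0), gramMat S a (b 1), gramMat S (b 0) a, gramMat S (b 1) a]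
  obtain ⟨J, -, -, hlt⟩ := finrank_gramSpan_inf_ker_lt hS
  -- All five matrices have vanishing `(2, 2)` entry, which leaves them at most four dimensions.
  have hw : ¬ LinearIndependent ℂ w := by
    intro hw
    have hle : Submodule.span ℂ (Set.range w) ≤ gramSpan S ⊓
        LinearMap.ker (Matrix.entryLinearMap ℂ ℂ (2 : Fin 3) (2 : Fin 3)) := by
      rw [Submodule.span_le]
      rintro _ ⟨i, rfl⟩
      fin_cases i <;>
        exact ⟨gramMat_mem_gramSpan _ _ _, by simp [w, gramMat_apply, hS2]⟩
    have h1 := Submodule.finrank_mono hle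
    rw [finrank_span_eq_card hw, Fintype.card_fin] at h1
    lia
  obtain ⟨g, hg, i, hi⟩ := Fintype.not_linearIndependent_iff.1 hw
  -- The two sides of the dependency: terms with `a` on the left, and terms with `a` on the right,
  -- whose coefficients are conjugated because the first slot is conjugate-linear.
  let z : E := g 0 • a + (g 1 • (b 0 : E) + g 2 • (b 1 : E))
  let z' : E := -((starRingEnd ℂ) (g 3) • (b 0 : E) + (starRingEnd ℂ) (g 4) • (b 1 : E))
  have hzz' : gramMat S a z = gramMat S z' a := by
    rw [← sub_eq_zero, ← hg]
    ext l m
    simp only [z, z', w, Fin.sum_univ_five, gramMat, map_add, map_neg, map_smul, inner_add_right,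
      inner_add_left, inner_smul_right, inner_smul_left, inner_neg_left, Matrix.sub_apply,
      Matrix.add_apply, Matrix.smul_apply, Matrix.of_apply, smul_eq_mul,
      RingHomCompTriple.comp_apply, RingHom.id_apply, Matrix.cons_val]
    ring
  have haz' : inner ℂ z' a = 0 := by
    rw [inner_eq_zero_symm]
    simp [z', hab, inner_add_right, inner_smul_right]
  have haz : inner ℂ a z = 0 := h.inner_eq_zero_of_gramMat_eq hF0 hzz' haz'
  have hz0 : z ≠ 0 := by
    intro hz
    have hz'0 : z' = 0 := by
      refine hinj ?_
      rw [gramMap_apply, ← conjTranspose_gramMat, ← hzz', hz, ← gramMap_apply, map_zero,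
        Matrix.conjTranspose_zero]
    have hg34 := hb _ _ (neg_eq_zero.1 hz'0)
    have hg0 : g 0 = 0 := by
      have : inner ℂ a z = g 0 * inner ℂ a a := by
        simp only [z, inner_add_right, inner_smul_right, hab, mul_zero, add_zero]
      rw [haz] at this
      simpa [ha] using this.symm
    have hg12 : g 1 = 0 ∧ g 2 = 0 := hb _ _ (by simpa [z, hg0] using hz)
    have hg3 : g 3 = 0 := by simpa using hg34.1
    have hg4 : g 4 = 0 := by simpa using hg34.2
    refine hi ?_
    fin_cases i
    exacts [hg0, hg12.1, hg12.2, hg3, hg4]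
  obtain ⟨h1, h2⟩ := isHermitian_gramMat_of_eq hzz'
  by_cases hadd : z + z' = 0
  · exact ⟨Complex.I • z, by simp [hz0], by rw [inner_smul_right, haz, mul_zero],
      h2 (eq_neg_of_add_eq_zero_right hadd)⟩
  · exact ⟨z + z', hadd, by rw [inner_add_right, haz, inner_eq_zero_symm.1 haz', add_zero], h1⟩

end HermitianGram

/-! ### Three-dimensional first factor: the Gram span has dimension at least six -/

section SixLe

variable {E E' F F' : Type*}
  [NormedAddCommGroup E] [InnerProductSpace ℂ E] [NormedAddCommGroup E'] [InnerProductSpace ℂ E']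
  [NormedAddCommGroup F] [InnerProductSpace ℂ F] [NormedAddCommGroup F'] [InnerProductSpace ℂ F']

theorem gramMat_combination {ι κ : Type*} [Fintype κ] (P : Matrix ι κ ℂ) (S : κ → E →ₗ[ℂ] E')
    (x y : E) : gramMat (fun l => ∑ m, P l m • S m) x y =
      P.map (starRingEnd ℂ) * gramMat S x y * P.transpose := by
  ext l m
  simp only [gramMat, Matrix.of_apply, LinearMap.sum_apply, LinearMap.smul_apply, sum_inner,
    inner_sum, inner_smul_left, inner_smul_right, Matrix.mul_apply, Matrix.map_apply,
    Matrix.transpose_apply, Finset.sum_mul]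
  simp only [Finset.mul_sum]
  exact Finset.sum_congr rfl fun i _ => Finset.sum_congr rfl fun j _ => by ring

theorem exists_unitary_diagonal {K : Matrix (Fin 3) (Fin 3) ℂ} (hK : K.IsHermitian)
    (hK2 : ∀ j, K 2 j = 0) : ∃ (P : Matrix (Fin 3) (Fin 3) ℂ) (κ₀ κ₁ : ℂ), P.conjTranspose * P = 1 ∧
      P.map (starRingEnd ℂ) * Matrix.diagonal ![1, 1, 0] * P.transpose =
        Matrix.diagonal ![1, 1, 0] ∧
      P.map (starRingEnd ℂ) * K * P.transpose = Matrix.diagonal ![κ₀, κ₁, 0] := by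
  let M : Matrix (Fin 2) (Fin 2) ℂ := K.submatrix Fin.castSucc Fin.castSucc
  have hM : M.IsHermitian := hK.submatrix _
  have hK2' : ∀ j, K j 2 = 0 := fun j => by rw [← hK.apply, hK2, star_zero]
  let U : Matrix (Fin 2) (Fin 2) ℂ := hM.eigenvectorUnitary
  have hU1 : star U * U = 1 := Unitary.coe_star_mul_self hM.eigenvectorUnitary
  have hU2 : U * star U = 1 := Unitary.coe_mul_star_self hM.eigenvectorUnitary
  have hUM : star U * M * U = Matrix.diagonal (RCLike.ofReal ∘ hM.eigenvalues) := by
    have := hM.conjStarAlgAut_star_eigenvectorUnitary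
    rw [Unitary.conjStarAlgAut_star_apply] at this
    exact this
  have e1 := fun i j => congrFun (congrFun hU1 i) j
  have e2 := fun i j => congrFun (congrFun hU2 i) j
  have e3 := fun i j => congrFun (congrFun hUM i) j
  simp only [Matrix.mul_apply, Fin.sum_univ_two, Matrix.star_apply, Matrix.submatrix_apply, M,
    Fin.castSucc_zero, Fin.castSucc_one, Complex.star_def] at e1 e2 e3
  have e00 := e1 0 0
  have e01 := e1 0 1
  have e10 := e1 1 0
  have e11 := e1 1 1
  have f00 := e2 0 0
  have f01 := e2 0 1
  have f10 := e2 1 0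
  have f11 := e2 1 1
  have g00 := e3 0 0
  have g01 := e3 0 1
  have g10 := e3 1 0
  have g11 := e3 1 1
  simp only [Matrix.one_apply_eq, Matrix.one_apply_ne (show (0 : Fin 2) ≠ 1 by decide),
    Matrix.one_apply_ne (show (1 : Fin 2) ≠ 0 by decide), Matrix.diagonal_apply_eq,
    Matrix.diagonal_apply_ne _ (show (0 : Fin 2) ≠ 1 by decide),
    Matrix.diagonal_apply_ne _ (show (1 : Fin 2) ≠ 0 by decide), Function.comp_apply]
    at e00 e01 e10 e11 f00 f01 f10 f11 g00 g01 g10 g11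
  generalize U = V at *
  clear e1 e2 e3 hUM hU1 hU2
  -- The transpose of the eigenvector matrix of the upper block, extended by 1; it acts within the
  -- first two indices, so it fixes `diag(1, 1, 0)`.
  refine ⟨!![V 0 0, V 1 0, 0; V 0 1, V 1 1, 0; 0, 0, 1], hM.eigenvalues 0, hM.eigenvalues 1,
    ?_, ?_, ?_⟩
  · ext i j
    fin_cases i <;> fin_cases j <;> simp [Matrix.mul_apply, Fin.sum_univ_three]
    · linear_combination f00
    · linear_combination f10
    · linear_combination f01
    · linear_combination f11
  · ext i j
    fin_cases i <;> fin_cases j <;> simp [Matrix.mul_apply, Fin.sum_univ_three]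
    · linear_combination e00
    · linear_combination e01
    · linear_combination e10
    · linear_combination e11
  · ext i j
    fin_cases i <;> fin_cases j <;> simp [Matrix.mul_apply, Fin.sum_univ_three, hK2, hK2']
    · linear_combination g00
    · linear_combination g01
    · linear_combination g10
    · linear_combination g11

variable [FiniteDimensional ℂ E] [FiniteDimensional ℂ E'] [FiniteDimensional ℂ F]
  [FiniteDimensional ℂ F']

/-- Without a splitting, `gramMap S a` is injective and the dimension count provides `y` orthogonal
to `a` with `gramMat S a y` Hermitian. A unitary change of family diagonalizes it without disturbing
`gramMat S a a`, giving two diagonal columns. -/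
theorem IsometricSum.splits_or_hasLine_of_finrank_gramSpan_le_five {S : Fin 3 → E →ₗ[ℂ] E'}
    {T : Fin 3 → F →ₗ[ℂ] F'} (h : IsometricSum S T) (hE : finrank ℂ E = 3)
    (hE' : finrank ℂ E' = 3) (hF : finrank ℂ F = finrank ℂ F') (hF0 : 0 < finrank ℂ F)
    (hS : LinearIndependent ℂ S) (hT : LinearIndependent ℂ T) {a : E} (ha : a ≠ 0)
    (haa : gramMat S a a = Matrix.diagonal ![1, 1, 0]) (hs : finrank ℂ (gramSpan S) ≤ 5) :
    Splits S ∨ HasLine T := by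
  by_cases hsplit : Splits S
  · exact Or.inl hsplit
  have hinj : Function.Injective (gramMap S a) := by
    have h1 := h.symm.three_le_finrank_range_gramMap hF hF0 (hE.trans hE'.symm) hE.ge hsplit haa
    have h2 := LinearMap.finrank_range_add_finrank_ker (gramMap S a)
    rw [← LinearMap.ker_eq_bot, ← Submodule.finrank_eq_zero (R := ℂ)]
    lia
  have hS2 : S 2 a = 0 := apply_two_eq_zero_of_gramMat haa
  obtain ⟨y, hy0, hay, hy⟩ :=
    h.exists_isHermitian_gramMat hF0 hE (hS.ne_zero 2) ha hS2 hinj hs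
  obtain ⟨P, κ₀, κ₁, hP, hP1, hPK⟩ := exists_unitary_diagonal hy (fun j => by simp [gramMat, hS2])
  let S' : Fin 3 → E →ₗ[ℂ] E' := fun l => ∑ m, P l m • S m
  have hSS' : ∀ l, S l = ∑ m, P.conjTranspose l m • S' m :=
    eq_sum_smul_of_eq_sum_smul hP fun l => rfl
  have h' := (h.symm.change _ hSS').symm
  have hT' : ∀ l, T l = ∑ m, P.transpose l m • ∑ i, P.conjTranspose i m • T i := by
    refine eq_sum_smul_of_eq_sum_smul (P := P.conjTranspose.transpose) ?_ fun l => rfl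
    rw [← Matrix.transpose_mul, hP, Matrix.transpose_one]
  have hay' : gramMat S' a y = Matrix.diagonal ![κ₀, κ₁, 0] := by
    rw [← hPK]; exact gramMat_combination P S a y
  have haa' : gramMat S' a a = Matrix.diagonal ![1, 1, 0] := by
    rw [← hP1, ← haa]; exact gramMat_combination P S a a
  have hκ : κ₀ ≠ 0 ∨ κ₁ ≠ 0 := by
    by_contra hcon
    push Not at hcon
    refine hy0 (hinj ?_)
    have : gramMat S' a y = 0 := by
      rw [hay', hcon.1, hcon.2]
      ext i j
      fin_cases i <;> fin_cases j <;> simp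
    rw [map_zero, gramMap_apply, show S = fun l => ∑ m, P.conjTranspose l m • S' m from funext hSS',
      gramMat_combination, this]
    simp
  rcases h'.splits_or_hasLine_of_gramMat hE hE' hF hF0 (hS.of_combination _ hSS')
    (hT.of_combination _ hT') ha hy0 hay haa' hay' hκ with h1 | h1
  · exact Or.inl (h1.of_combination _ hSS')
  · exact Or.inr (h1.of_combination _ hT')

theorem IsometricSum.six_le_finrank_gramSpan {S : Fin 3 → E →ₗ[ℂ] E'}
    {T : Fin 3 → F →ₗ[ℂ] F'} (h : IsometricSum S T) (hE : finrank ℂ E = 3)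
    (hE' : finrank ℂ E' = 3) (hF : finrank ℂ F = finrank ℂ F') (hF0 : 0 < finrank ℂ F)
    (hS : LinearIndependent ℂ S) (hT : LinearIndependent ℂ T) (hsplit : ¬ Splits S)
    (hline : ¬ HasLine T) : 6 ≤ finrank ℂ (gramSpan S) := by
  by_contra hlt
  obtain ⟨T', S', P, Q, h', hT', hS', hP, hQ, hle, a, ha, haa⟩ :=
    h.symm.exists_adapted hT hS (hE.trans hE'.symm) (by lia)
      fun hl => hsplit (h.symm.splits_of_hasLine hF0 hl (by lia))
  rcases h'.symm.splits_or_hasLine_of_finrank_gramSpan_le_five hE hE' hF hF0 hS' hT' ha haa (by lia)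
    with h1 | h1
  · exact hsplit (h1.of_combination _ hQ)
  · exact hline (h1.of_combination P.transpose hP)

end SixLe

/-! ### Such unitaries are controlled from one side -/

section Classification

universe u v

variable {E E' : Type*}
  [NormedAddCommGroup E] [InnerProductSpace ℂ E] [NormedAddCommGroup E'] [InnerProductSpace ℂ E']
  [FiniteDimensional ℂ E] [FiniteDimensional ℂ E']

/-- Solve the dependency for one member. The last clause says that `C` has trivial kernel, which
keeps the other tensor factors independent when they absorb `C`. -/
theorem exists_combination_fin_two {V : Type*} [AddCommGroup V] [Module ℂ V] {x : Fin 3 → V}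
    (hx : ¬ LinearIndependent ℂ x) :
    ∃ (y : Fin 2 → V) (C : Matrix (Fin 3) (Fin 2) ℂ), (∀ l, x l = ∑ m, C l m • y m) ∧
      ∀ z : Fin 2 → ℂ, (∀ l, ∑ m, C l m * z m = 0) → ∀ m, z m = 0 := by
  obtain ⟨c, hc, i, hi⟩ := Fintype.not_linearIndependent_iff.1 hx
  refine ⟨fun m => x (i.succAbove m), Matrix.of fun l m =>
    if l = i then -(c i)⁻¹ * c (i.succAbove m) else if l = i.succAbove m then 1 else 0,
    fun l => ?_, fun z hz m => ?_⟩
  · rcases Fin.eq_self_or_eq_succAbove i l with rfl | ⟨m, rfl⟩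
    · rw [Fin.sum_univ_succAbove _ l] at hc
      have h1 : (c l)⁻¹ • (c l • x l + ∑ m, c (l.succAbove m) • x (l.succAbove m)) = 0 := by
        rw [hc, smul_zero]
      rw [smul_add, smul_smul, inv_mul_cancel₀ hi, one_smul] at h1
      rw [eq_neg_of_add_eq_zero_left h1]
      simp [mul_smul]
    · simp
  · simpa using hz (i.succAbove m)

theorem IsometricSum.simDiag_of_not_linearIndependent {F : Type u} {F' : Type v}
    [NormedAddCommGroup F] [InnerProductSpace ℂ F] [NormedAddCommGroup F'] [InnerProductSpace ℂ F']
    [FiniteDimensional ℂ F] [FiniteDimensional ℂ F'] {S : Fin 3 → E →ₗ[ℂ] E'}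
    {T : Fin 3 → F →ₗ[ℂ] F'} (h : IsometricSum S T) (hE : finrank ℂ E = finrank ℂ E')
    (hE0 : 0 < finrank ℂ E) (hF : finrank ℂ F = finrank ℂ F') (hS : LinearIndependent ℂ S)
    (hT : ¬ LinearIndependent ℂ T) : SimDiag T := by
  obtain ⟨T', C, hC, hinj⟩ := exists_combination_fin_two hT
  have hS' : LinearIndependent ℂ fun m => ∑ l, C l m • S l := by
    rw [Fintype.linearIndependent_iff]
    intro z hz
    refine hinj z (Fintype.linearIndependent_iff.1 hS _ ?_)
    rw [← hz]
    simp only [Finset.smul_sum, Finset.sum_smul, smul_smul]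
    rw [Finset.sum_comm]
    simp only [mul_comm]
  exact (IsometricSum.simDiag_of_forall_hasLine hE hE0 hS'
    (fun F F' _ _ _ _ _ _ T h' hF hF0 => h'.hasLine_of_two hE hE0 hF hF0) _ F F' T'
    (h.change C hC) rfl hF.symm).of_combination C hC

theorem IsometricSum.simDiag_of_finrank_eq_two {F : Type u} {F' : Type v}
    [NormedAddCommGroup F] [InnerProductSpace ℂ F] [NormedAddCommGroup F'] [InnerProductSpace ℂ F']
    [FiniteDimensional ℂ F] [FiniteDimensional ℂ F'] {S : Fin 3 → E →ₗ[ℂ] E'}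
    {T : Fin 3 → F →ₗ[ℂ] F'} (h : IsometricSum S T) (hE : finrank ℂ E = 2)
    (hE' : finrank ℂ E' = 2) (hF : finrank ℂ F = finrank ℂ F') (hS : LinearIndependent ℂ S) :
    SimDiag T :=
  IsometricSum.simDiag_of_forall_hasLine (hE.trans hE'.symm) (by lia) hS
    (fun F F' _ _ _ _ _ _ T h' hF hF0 => h'.hasLine_of_finrank_eq_two hS hE hE' hF hF0) _ F F' T
    h rfl hF.symm

variable {F : Type u} {F' : Type v}
  [NormedAddCommGroup F] [InnerProductSpace ℂ F] [NormedAddCommGroup F'] [InnerProductSpace ℂ F']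
  [FiniteDimensional ℂ F] [FiniteDimensional ℂ F']

/-- On the plane the first factor is two-dimensional. If the restricted `S l` are independent, `T`
is diagonal by that case. If not, the restricted sum has two terms, so `S` is diagonal on the plane,
and the complement is a line. -/
theorem IsometricSum.simDiag_or_simDiag_of_map_plane {S : Fin 3 → E →ₗ[ℂ] E'}
    {T : Fin 3 → F →ₗ[ℂ] F'} (h : IsometricSum S T) (hE : finrank ℂ E = 3)
    (hE' : finrank ℂ E' = 3) (hF : finrank ℂ F = finrank ℂ F') (hF0 : 0 < finrank ℂ F)
    (hT : LinearIndependent ℂ T) {V : Submodule ℂ E} {W : Submodule ℂ E'} (hV : finrank ℂ V = 2)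
    (hW : finrank ℂ W = 2) (hVW : ∀ l, ∀ v ∈ V, S l v ∈ W) : SimDiag S ∨ SimDiag T := by
  have h' := h.symm.restrict hVW
  by_cases hli : LinearIndependent ℂ fun l => (S l).restrict (hVW l)
  · exact Or.inr (h'.symm.simDiag_of_finrank_eq_two hV hW hF hli)
  · have hVW' := h.symm.map_orthogonal hF hT (hV.trans hW.symm) hVW
    have h1 := V.finrank_add_finrank_orthogonal
    have h2 := W.finrank_add_finrank_orthogonal
    exact Or.inl (simDiag_of_restrict hVW hVW'
      (h'.simDiag_of_not_linearIndependent hF hF0 (hV.trans hW.symm) hT hli)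
      (simDiag_of_finrank_eq_one _ (by lia) (by lia)))

theorem IsometricSum.simDiag_or_simDiag_of_splits {S : Fin 3 → E →ₗ[ℂ] E'}
    {T : Fin 3 → F →ₗ[ℂ] F'} (h : IsometricSum S T) (hE : finrank ℂ E = 3)
    (hE' : finrank ℂ E' = 3) (hF : finrank ℂ F = finrank ℂ F') (hF0 : 0 < finrank ℂ F)
    (hT : LinearIndependent ℂ T) (hsplit : Splits S) : SimDiag S ∨ SimDiag T := by
  obtain ⟨V, W, hd, h1, h2, hVW⟩ := hsplit
  rcases (by lia : finrank ℂ V = 1 ∨ finrank ℂ V = 2) with hV | hV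
  · have h3 := V.finrank_add_finrank_orthogonal
    have h4 := W.finrank_add_finrank_orthogonal
    exact h.simDiag_or_simDiag_of_map_plane hE hE' hF hF0 hT (V := Vᗮ) (W := Wᗮ) (by lia) (by lia)
      (h.symm.map_orthogonal hF hT hd hVW)
  · exact h.simDiag_or_simDiag_of_map_plane hE hE' hF hF0 hT hV (hd.symm.trans hV) hVW

/-- A unitary of the form `∑ l, S l ⊗ T l` with three terms, acting on a three-dimensional space
and another space, is controlled from one of the two sides. -/
theorem IsometricSum.simDiag_or_simDiag {S : Fin 3 → E →ₗ[ℂ] E'} (hE : finrank ℂ E = 3)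
    (hE' : finrank ℂ E' = 3) (hS : LinearIndependent ℂ S) (n : ℕ) :
    ∀ (F : Type u) (F' : Type v) [NormedAddCommGroup F] [InnerProductSpace ℂ F]
      [NormedAddCommGroup F'] [InnerProductSpace ℂ F'] [FiniteDimensional ℂ F]
      [FiniteDimensional ℂ F'] (T : Fin 3 → F →ₗ[ℂ] F'), IsometricSum S T →
      finrank ℂ F = n → finrank ℂ F' = n → SimDiag S ∨ SimDiag T := by
  induction n using Nat.strong_induction_on with
  | _ n ih =>
    intro F F' _ _ _ _ _ _ T h hF hF'
    have hEE' := hE.trans hE'.symm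
    have hFF' := hF.trans hF'.symm
    by_cases hT : LinearIndependent ℂ T
    swap
    · exact Or.inr (h.simDiag_of_not_linearIndependent hEE' (by lia) hFF' hS hT)
    rcases Nat.lt_or_ge n 3 with hn | hn
    · interval_cases n
      · exact Or.inr (simDiag_of_finrank_eq_zero T hF hF')
      · exact Or.inr (simDiag_of_finrank_eq_one T hF hF')
      -- A two-dimensional second factor is the two-dimensional case with the parties exchanged.
      · exact Or.inl (h.symm.simDiag_of_finrank_eq_two hF hF' hEE' hT)
    by_cases hsplitT : Splits T
    · obtain ⟨V, W, h1, h2, h3, hVW⟩ := hsplitT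
      have hVW' := h.map_orthogonal hEE' hS h1 hVW
      have h4 := V.finrank_add_finrank_orthogonal
      have h5 := finrank_orthogonal_eq hFF' h1
      rcases ih _ (by lia) _ _ _ (h.restrict hVW) rfl h1.symm with h6 | h6
      · exact Or.inl h6
      rcases ih _ (by lia) _ _ _ (h.restrict hVW') rfl h5.symm with h7 | h7
      · exact Or.inl h7
      exact Or.inr (simDiag_of_restrict hVW hVW' h6 h7)
    by_cases hsplitS : Splits S
    · exact h.simDiag_or_simDiag_of_splits hE hE' hFF' (by lia) hT hsplitS
    -- Neither side splits, and 6 + 5 exceeds the bound 3 · 3 + 1.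
    have hs := h.six_le_finrank_gramSpan hE hE' hFF' (by lia) hS hT hsplitS
      fun hl => hsplitT (h.splits_of_hasLine (by lia) hl (by lia))
    have ht := h.five_le_finrank_gramSpan hEE' (by lia) hFF' (by lia) hS hT hsplitT
    have hst := h.finrank_gramSpan_add_le (by lia)
    rw [Fintype.card_fin] at hst
    lia

end Classification

/-! ### A three-round protocol scheme -/

section LOCC

/-- The isometry that appends the state `|Ψ_k⟩` to a bipartite input. -/
noncomputable def appendMaxEntangled (A B : Type) [DecidableEq A] [DecidableEq B] (k : ℕ) :
    Matrix ((A × Fin k) × (B × Fin k)) (A × B) ℂ :=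
  Matrix.of fun p q => if p.1.1 = q.1 then
    if p.2.1 = q.2 then maxEntangledKet k (p.1.2, p.2.2) else 0 else 0

theorem bipartiteTensor_maxEntangledState {A B : Type} [Fintype A] [Fintype B] [DecidableEq A]
    [DecidableEq B] (k : ℕ) (ρ : Matrix (A × B) (A × B) ℂ) :
    bipartiteTensor ρ (maxEntangledState k) =
      appendMaxEntangled A B k * ρ * (appendMaxEntangled A B k).conjTranspose := by
  ext ⟨⟨a, x⟩, ⟨b, y⟩⟩ ⟨⟨a', x'⟩, ⟨b', y'⟩⟩
  simp [bipartiteTensor, maxEntangledState, appendMaxEntangled, Matrix.mul_apply,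
    Fintype.sum_prod_type, Matrix.vecMulVec_apply, apply_ite star, ite_mul, mul_ite, mul_zero,
    zero_mul, Finset.sum_ite_eq, Finset.mem_univ]
  ring

variable {A B : Type} [Fintype A] [Fintype B] [DecidableEq A] [DecidableEq B]

/-- A protocol of three rounds: a measurement by Alice, one by Bob and a correction by Alice. -/
theorem implementableByLOCC_of_three_rounds {ι κ C X : Type} [Fintype ι] [Fintype κ] [Fintype C]
    [DecidableEq C] [Fintype X] [DecidableEq X] {k : ℕ} (hk : 0 < k) (e : Fin k ≃ X)
    {U : Matrix (A × B) (A × B) ℂ} (K : ι → Matrix C (A × X) ℂ)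
    (hK : ∑ i, (K i).conjTranspose * K i = 1) (L : ι → κ → Matrix B (B × X) ℂ)
    (hL : ∀ i, ∑ f, (L i f).conjTranspose * L i f = 1) (D : ι → κ → Matrix A C ℂ)
    (hD : ∀ i f, (D i f).conjTranspose * D i f = 1) (γ : ι → κ → ℂ)
    (hγ : ∑ i, ∑ f, γ i f * star (γ i f) = k)
    (h : ∀ i f a' b' a b, ∑ x, (D i f * K i) a' (a, x) * L i f b' (b, x) =
      γ i f * U (a', b') (a, b)) : ImplementableByLOCC U k := by
  let K' : ι → Matrix C (A × Fin k) ℂ := fun i => (K i).submatrix id (Prod.map id e)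
  let L' : ι → κ → Matrix B (B × Fin k) ℂ := fun i f => (L i f).submatrix id (Prod.map id e)
  have hinjA : Function.Injective (Prod.map (id : A → A) e) :=
    Function.injective_id.prodMap e.injective
  have hinjB : Function.Injective (Prod.map (id : B → B) e) :=
    Function.injective_id.prodMap e.injective
  have hK' : ∑ i, (K' i).conjTranspose * K' i = 1 := by
    rw [← Matrix.submatrix_one _ hinjA, ← hK]
    ext p q
    simp [K', Matrix.sum_apply, Matrix.mul_apply]
  have hL' : ∀ i, ∑ f, (L' i f).conjTranspose * L' i f = 1 := by
    intro i
    rw [← Matrix.submatrix_one _ hinjB, ← hL i]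
    ext p q
    simp [L', Matrix.sum_apply, Matrix.mul_apply]
  set ψ : ℂ := ((1 / Real.sqrt k : ℝ) : ℂ) with hψdef
  have hψ : (k : ℂ) * (ψ * star ψ) = 1 := by
    have h1 : (k : ℝ) * (1 / Real.sqrt k * (1 / Real.sqrt k)) = 1 := by
      have h2 : Real.sqrt k * Real.sqrt k = k := Real.mul_self_sqrt (Nat.cast_nonneg k)
      have h3 : (k : ℝ) ≠ 0 := by exact_mod_cast hk.ne'
      rw [div_mul_div_comm, h2]
      field_simp
    have h2 : star ψ = ψ := Complex.conj_ofReal _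
    rw [h2, hψdef]
    exact_mod_cast h1
  -- For every pair of outcomes the total Kraus operator on the input is a multiple of `U`; the
  -- weights sum to one because `ψ` is `1/√k` and `∑ |γ|² = k`.
  have hM : ∀ i f, (D i f ⊗ₖ (1 : Matrix B B ℂ)) * ((1 : Matrix C C ℂ) ⊗ₖ L' i f) *
      (K' i ⊗ₖ (1 : Matrix (B × Fin k) (B × Fin k) ℂ)) * appendMaxEntangled A B k =
      (γ i f * ψ) • U := by
    intro i f
    rw [← Matrix.mul_kronecker_mul, ← Matrix.mul_kronecker_mul, Matrix.one_mul, Matrix.mul_one,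
      Matrix.mul_one]
    ext ⟨a', b'⟩ ⟨a, b⟩
    rw [Matrix.smul_apply, smul_eq_mul, mul_right_comm, ← h, Finset.sum_mul, ← e.sum_comp]
    simp only [Matrix.mul_apply (M := (D i f * K' i) ⊗ₖ L' i f), Fintype.sum_prod_type,
      appendMaxEntangled, Matrix.of_apply, mul_ite, mul_zero, maxEntangledKet,
      Matrix.kroneckerMap_apply]
    simp only [Finset.sum_ite_irrel, Finset.sum_const_zero, Finset.sum_ite_eq', Finset.sum_ite_eq,
      Finset.mem_univ, if_true]
    rfl
  refine ⟨_, IsLOCC.alice K' hK' _ fun i => IsLOCC.bob (L' i) (hL' i) _ fun f =>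
    IsLOCC.alice (ι := Unit) (C := fun _ => A) (fun _ => D i f) (by simpa using hD i f) _
      fun _ => IsLOCC.done, fun ρ => ?_⟩
  have hterm : ∀ i f, (D i f ⊗ₖ (1 : Matrix B B ℂ)) * (((1 : Matrix C C ℂ) ⊗ₖ L' i f) *
      ((K' i ⊗ₖ (1 : Matrix (B × Fin k) (B × Fin k) ℂ)) *
        bipartiteTensor ρ (maxEntangledState k) *
        (K' i ⊗ₖ (1 : Matrix (B × Fin k) (B × Fin k) ℂ)).conjTranspose) *
      ((1 : Matrix C C ℂ) ⊗ₖ L' i f).conjTranspose) *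
      (D i f ⊗ₖ (1 : Matrix B B ℂ)).conjTranspose =
      (γ i f * star (γ i f) * (ψ * star ψ)) • (U * ρ * U.conjTranspose) := by
    intro i f
    have h1 := hM i f
    have h2 := congrArg Matrix.conjTranspose h1
    simp only [Matrix.conjTranspose_mul, Matrix.conjTranspose_smul, Matrix.mul_assoc] at h1 h2
    rw [bipartiteTensor_maxEntangledState]
    simp only [Matrix.mul_assoc]
    rw [h2]
    simp only [← Matrix.mul_assoc] at h1 ⊢
    rw [h1]
    simp only [Matrix.smul_mul, Matrix.mul_smul, smul_smul, star_mul]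
    congr 1
    ring
  simp only [Finset.univ_unique, Finset.sum_singleton, hterm]
  simp only [← Finset.sum_smul, ← Finset.sum_mul, hγ, hψ, one_smul]

end LOCC

/-! ### Characters of the cyclic group -/

section Fourier

theorem exists_fourier (k : ℕ) [NeZero k] : ∃ χ : Fin k → Fin k → ℂ,
    (∀ f y, star (χ f y) * χ f y = 1) ∧
      ∀ y y', ∑ f, star (χ f y) * χ f y' = if y = y' then (k : ℂ) else 0 := by
  let e : Fin k ≃ ZMod k := (ZMod.finEquiv k).toEquiv
  let χ := ZMod.stdAddChar (N := k)
  have hstar : ∀ x, star (χ x) = χ (-x) := fun x => (AddChar.map_neg_eq_conj χ x).symm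
  refine ⟨fun f y => χ (e f * e y), fun f y => ?_, fun y y' => ?_⟩
  · rw [hstar, ← AddChar.map_add_eq_mul, neg_add_cancel, AddChar.map_zero_eq_one]
  · have h1 : ∀ f, star (χ (e f * e y)) * χ (e f * e y') = χ (e f * (e y' - e y)) := by
      intro f
      rw [hstar, ← AddChar.map_add_eq_mul]
      congr 1
      ring
    simp only [h1]
    rw [e.sum_comp (fun f => χ (f * (e y' - e y))),
      AddChar.sum_mulShift _ (ZMod.isPrimitive_stdAddChar k), ZMod.card]
    simp only [sub_eq_zero, e.injective.eq_iff, eq_comm (a := y), apply_ite (Nat.cast (R := ℂ)),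
      Nat.cast_zero]

end Fourier

/-! ### The two protocols: controlled unitaries and teleportation -/

section Protocols

theorem exists_star_mul_self_eq_inv (k : ℕ) : ∃ c : ℂ, star c * c = (k : ℂ)⁻¹ := by
  refine ⟨((Real.sqrt k : ℝ) : ℂ)⁻¹, ?_⟩
  have h1 : Real.sqrt k * Real.sqrt k = k := Real.mul_self_sqrt (Nat.cast_nonneg k)
  rw [star_inv₀, Complex.star_def, Complex.conj_ofReal, ← mul_inv, ← Complex.ofReal_mul, h1,
    Complex.ofReal_natCast]

variable {A B : Type} [Fintype A] [Fintype B] [DecidableEq A] [DecidableEq B]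

/-- A unitary controlled by Alice needs a maximally entangled state of the dimension of the
control. -/
theorem implementableByLOCC_of_controlled {k : ℕ} [NeZero k] (j : A ↪ Fin k)
    {U : Matrix (A × B) (A × B) ℂ} {G H : Matrix A A ℂ} {V : A → Matrix B B ℂ}
    (hG : G.conjTranspose * G = 1) (hH : H * H.conjTranspose = 1)
    (hV : ∀ i, (V i).conjTranspose * V i = 1)
    (hU : ∀ a' b' a b, U (a', b') (a, b) = ∑ i, G a' i * star (H a i) * V i b' b) :
    ImplementableByLOCC U k := by
  have hk : (k : ℂ) ≠ 0 := by exact_mod_cast NeZero.ne k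
  obtain ⟨χ, hχ, hχ'⟩ := exists_fourier k
  -- Values of the register outside the image of the control get the identity, so that Bob's
  -- measurement is complete.
  let W : Fin k → Matrix B B ℂ := Function.extend j V 1
  have hWj : ∀ i, W (j i) = V i := fun i => j.injective.extend_apply V 1 i
  have hW : ∀ x, (W x).conjTranspose * W x = 1 := by
    intro x
    by_cases hx : ∃ i, j i = x
    · obtain ⟨i, rfl⟩ := hx
      rw [hWj, hV]
    · simp [W, Function.extend_apply' _ _ _ hx]
  obtain ⟨c, hc⟩ := exists_star_mul_self_eq_inv k
  -- Alice measures the cyclic difference `m` between her half and the control index `i`, so Bob's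
  -- half holds `j i + m`. Bob applies the corresponding unitary and measures his half in the
  -- Fourier basis. Alice removes the resulting phase and rotates to the output basis.
  refine implementableByLOCC_of_three_rounds (ι := Fin k) (κ := Fin k) (C := A)
    (NeZero.pos k) (Equiv.refl (Fin k))
    (fun m => Matrix.of fun i p => if p.2 = j i + m then star (H p.1 i) else 0) ?_
    (fun m f => Matrix.of fun b' p => c * χ f p.2 * W (p.2 - m) b' p.1) ?_
    (fun m f => Matrix.of fun a i => G a i * star (χ f (j i + m))) ?_ (fun _ _ => c) ?_ ?_
  · ext ⟨a, x⟩ ⟨a', x'⟩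
    have h1 := congrFun (congrFun hH a) a'
    simp only [Matrix.mul_apply, Matrix.conjTranspose_apply] at h1
    simp only [Matrix.sum_apply, Matrix.mul_apply, Matrix.conjTranspose_apply, Matrix.of_apply]
    rw [Finset.sum_comm]
    have h2 : ∀ i, ∑ m, star (if x = j i + m then star (H a i) else 0) *
        (if x' = j i + m then star (H a' i) else 0) =
        if x = x' then H a i * star (H a' i) else 0 := by
      intro i
      rw [Finset.sum_eq_single (x - j i)]
      · simp [eq_comm]
      · intro m _ hm
        rw [if_neg, star_zero, zero_mul]
        rintro rfl
        exact hm (by abel)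
      · simp
    simp only [h2]
    by_cases hx : x = x'
    · simp only [hx, if_true, h1, Matrix.one_apply, Prod.mk.injEq, and_true]
    · simp [hx]
  · intro m
    ext ⟨b, y⟩ ⟨b', y'⟩
    simp only [Matrix.sum_apply, Matrix.mul_apply, Matrix.conjTranspose_apply, Matrix.of_apply]
    rw [Finset.sum_comm]
    have h1 : ∀ z f, star (c * χ f y * W (y - m) z b) * (c * χ f y' * W (y' - m) z b') =
        (star (χ f y) * χ f y') * ((star c * c) * (star (W (y - m) z b) * W (y' - m) z b')) := by
      intro z f
      simp only [star_mul]
      ring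
    simp only [h1, ← Finset.sum_mul, hχ', ← Finset.mul_sum, hc]
    by_cases hy : y = y'
    · subst hy
      have h2 := congrFun (congrFun (hW (y - m)) b) b'
      simp only [Matrix.mul_apply, Matrix.conjTranspose_apply] at h2
      rw [if_pos rfl, h2, ← mul_assoc, mul_inv_cancel₀ hk, one_mul]
      simp [Matrix.one_apply]
    · simp [hy]
  · intro m f
    ext i i'
    have h1 := congrFun (congrFun hG i) i'
    simp only [Matrix.mul_apply, Matrix.conjTranspose_apply] at h1
    simp only [Matrix.mul_apply, Matrix.conjTranspose_apply, Matrix.of_apply]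
    have h2 : ∀ a, star (G a i * star (χ f (j i + m))) * (G a i' * star (χ f (j i' + m))) =
        (star (G a i) * G a i') * (star (χ f (j i' + m)) * χ f (j i + m)) := by
      intro a
      simp only [star_mul, star_star]
      ring
    simp only [h2, ← Finset.sum_mul, h1]
    by_cases hi : i = i'
    · rw [hi, hχ, mul_one]
    · rw [Matrix.one_apply_ne hi, zero_mul]
  · simp only [mul_comm c, hc, Finset.sum_const, Finset.card_univ, Fintype.card_fin, nsmul_eq_mul]
    rw [mul_inv_cancel₀ hk, mul_one]
  · intro m f a' b' a b
    simp only [Matrix.mul_apply, Matrix.of_apply, Finset.sum_mul]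
    rw [Finset.sum_comm, hU, Finset.mul_sum]
    refine Finset.sum_congr rfl fun i _ => ?_
    simp only [mul_ite, mul_zero, ite_mul, zero_mul, Finset.sum_ite_eq', Finset.mem_univ, if_true]
    rw [add_sub_cancel_right, hWj]
    linear_combination (c * G a' i * star (H a i) * V i b' b) * hχ f (j i + m)

/-- The Weyl operators. -/
theorem exists_weyl (d : ℕ) [NeZero d] : ∃ σ : Fin d × Fin d → Matrix (Fin d) (Fin d) ℂ,
    (∀ x y x' y', ∑ p, star (σ p x y) * σ p x' y' =
      if x = x' then if y = y' then (d : ℂ) else 0 else 0) ∧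
    (∀ p x x', ∑ y, star (σ p x y) * σ p x' y = if x = x' then 1 else 0) ∧
    ∀ p y y', ∑ x, star (σ p x y) * σ p x y' = if y = y' then 1 else 0 := by
  obtain ⟨χ, hχ, hχ'⟩ := exists_fourier d
  refine ⟨fun p => Matrix.of fun x y => if y = x + p.2 then χ p.1 x else 0,
    fun x y x' y' => ?_, fun p x x' => ?_, fun p y y' => ?_⟩
  · simp only [Fintype.sum_prod_type, Matrix.of_apply]
    have h1 : ∀ f, ∑ m, star (if y = x + m then χ f x else 0) *
        (if y' = x' + m then χ f x' else 0) =
        if y' = x' + (y - x) then star (χ f x) * χ f x' else 0 := by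
      intro f
      rw [Finset.sum_eq_single (y - x)]
      · simp
      · intro m _ hm
        rw [if_neg, star_zero, zero_mul]
        rintro rfl
        exact hm (by abel)
      · simp
    simp only [h1, Finset.sum_ite_irrel, Finset.sum_const_zero, hχ']
    by_cases hx : x = x'
    · subst hx
      simp [eq_comm]
    · simp [hx]
  · simp only [Matrix.of_apply, apply_ite star, star_zero, ite_mul, zero_mul, mul_ite, mul_zero,
      Finset.sum_ite_eq', Finset.mem_univ, if_true, add_left_inj]
    by_cases hx : x = x'
    · subst hx
      simpa using hχ p.1 x
    · simp [hx, Ne.symm hx]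
  · simp only [Matrix.of_apply]
    rw [Finset.sum_eq_single (y - p.2)]
    · by_cases hy : y = y'
      · subst hy
        simpa using hχ p.1 (y - p.2)
      · simp [hy, Ne.symm hy]
    · intro x _ hx
      rw [if_neg, star_zero, zero_mul]
      rintro rfl
      exact hx (by abel)
    · simp

/-- Teleportation of Alice's system to Bob and back. -/
theorem implementableByLOCC_of_unitary {d k : ℕ} [NeZero d] (hk : k = d ^ 2)
    {U : Matrix (Fin d × B) (Fin d × B) ℂ} (hU : U.conjTranspose * U = 1) :
    ImplementableByLOCC U k := by
  have hd : (d : ℂ) ≠ 0 := by exact_mod_cast NeZero.ne d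
  obtain ⟨σ, hσ, hσ1, hσ2⟩ := exists_weyl d
  obtain ⟨c, hc⟩ := exists_star_mul_self_eq_inv d
  let N : Fin d × Fin d → Matrix (Fin d × B) (Fin d × B) ℂ := fun p =>
    U * ((σ p).map star ⊗ₖ (1 : Matrix B B ℂ))
  have hσ3 : ∀ p, ((σ p).map star).conjTranspose * (σ p).map star = 1 := by
    intro p
    ext y y'
    simp only [Matrix.mul_apply, Matrix.conjTranspose_apply, Matrix.map_apply, star_star,
      Matrix.one_apply]
    simp only [mul_comm (σ p _ y), hσ2, eq_comm]
  have hN : ∀ p, (N p).conjTranspose * N p = 1 := by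
    intro p
    simp only [N, Matrix.conjTranspose_mul, Matrix.mul_assoc]
    rw [← Matrix.mul_assoc U.conjTranspose, hU, Matrix.one_mul, Matrix.conjTranspose_kronecker,
      ← Matrix.mul_kronecker_mul, hσ3, Matrix.conjTranspose_one, Matrix.one_mul,
      Matrix.one_kronecker_one]
  have hNU : ∀ p a' b' a b, ∑ x, N p (a', b') (x, b) * σ p a x = U (a', b') (a, b) := by
    intro p a' b' a b
    simp only [N, Matrix.mul_apply, Fintype.sum_prod_type, Matrix.kroneckerMap_apply,
      Matrix.map_apply, Matrix.one_apply, mul_ite, mul_one, mul_zero, Finset.sum_ite_eq',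
      Finset.mem_univ, if_true, Finset.sum_mul]
    rw [Finset.sum_comm]
    simp only [mul_assoc, ← Finset.mul_sum, hσ1, mul_ite, mul_one, mul_zero, Finset.sum_ite_eq',
      Finset.mem_univ, if_true]
  -- Alice's outcome `p` is a Bell measurement of her input and her first half. Bob applies `N p`,
  -- which is `U` after the teleportation correction, and teleports the output back through the
  -- second pair with outcome `q`, which Alice corrects. The factor `c * c` collects `1/√d` from
  -- each Bell measurement.
  refine implementableByLOCC_of_three_rounds (ι := Fin d × Fin d) (κ := Fin d × Fin d)
    (C := Fin d) (X := Fin d × Fin d) (by rw [hk]; exact pow_pos (NeZero.pos d) 2)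
    ((finCongr (hk.trans (sq d))).trans finProdFinEquiv.symm)
    (fun p => Matrix.of fun x q => if x = q.2.2 then c * σ p q.1 q.2.1 else 0) ?_
    (fun p q => Matrix.of fun b' r => c * ∑ a', σ q a' r.2.2 * N p (a', b') (r.2.1, r.1)) ?_
    (fun _ q => Matrix.of fun a x => star (σ q a x)) ?_ (fun _ _ => c * c) ?_ ?_
  · ext ⟨a, x₁, x₂⟩ ⟨a', y₁, y₂⟩
    simp only [Matrix.sum_apply, Matrix.mul_apply, Matrix.conjTranspose_apply, Matrix.of_apply,
      apply_ite star, star_zero, ite_mul, zero_mul, Finset.sum_ite_eq', Finset.mem_univ, if_true,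
      mul_ite, mul_zero, Finset.sum_ite_irrel, Finset.sum_const_zero, star_mul]
    have h1 : ∀ p, star (σ p a x₁) * star c * (c * σ p a' y₁) =
        (star c * c) * (star (σ p a x₁) * σ p a' y₁) := fun p => by ring
    simp only [h1, ← Finset.mul_sum, hσ, hc, Matrix.one_apply, Prod.mk.injEq, mul_ite, mul_zero,
      inv_mul_cancel₀ hd]
    by_cases h2 : x₂ = y₂ <;> by_cases h3 : x₁ = y₁ <;> by_cases h4 : a = a' <;>
      simp [h2, h3, h4, eq_comm (a := y₂)]
  · intro p
    ext ⟨b, x₁, x₂⟩ ⟨b', y₁, y₂⟩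
    have h2 := congrFun (congrFun (hN p) (x₁, b)) (y₁, b')
    simp only [Matrix.mul_apply, Matrix.conjTranspose_apply, Fintype.sum_prod_type,
      Matrix.one_apply, Prod.mk.injEq] at h2
    rw [Finset.sum_comm] at h2
    simp only [Matrix.sum_apply, Matrix.mul_apply, Matrix.conjTranspose_apply, Matrix.of_apply,
      star_mul, star_sum]
    rw [Finset.sum_comm]
    have h1 : ∀ z, ∑ q, (∑ i, star (N p (i, z) (x₁, b)) * star (σ q i x₂)) * star c *
        (c * ∑ i, σ q i y₂ * N p (i, z) (y₁, b')) =
        if x₂ = y₂ then ∑ i, star (N p (i, z) (x₁, b)) * N p (i, z) (y₁, b') else 0 := by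
      intro z
      have h3 : ∀ q, (∑ i, star (N p (i, z) (x₁, b)) * star (σ q i x₂)) * star c *
          (c * ∑ i, σ q i y₂ * N p (i, z) (y₁, b')) = ∑ i, ∑ i', (star c * c) *
          (star (N p (i, z) (x₁, b)) * N p (i', z) (y₁, b')) * (star (σ q i x₂) * σ q i' y₂) := by
        intro q
        rw [mul_assoc, ← mul_assoc (star c), Finset.sum_mul]
        refine Finset.sum_congr rfl fun i _ => ?_
        rw [Finset.mul_sum, Finset.mul_sum]
        exact Finset.sum_congr rfl fun i' _ => by ring
      simp only [h3]
      rw [Finset.sum_comm]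
      have h4 : ∀ i, ∑ q, ∑ i', (star c * c) *
          (star (N p (i, z) (x₁, b)) * N p (i', z) (y₁, b')) * (star (σ q i x₂) * σ q i' y₂) =
          if x₂ = y₂ then star (N p (i, z) (x₁, b)) * N p (i, z) (y₁, b') else 0 := by
        intro i
        rw [Finset.sum_comm]
        simp only [← Finset.mul_sum, hσ, mul_ite, mul_zero, Finset.sum_ite_eq, Finset.mem_univ,
          if_true, hc]
        rw [mul_comm, ← mul_assoc, mul_inv_cancel₀ hd, one_mul]
      simp only [h4, Finset.sum_ite_irrel, Finset.sum_const_zero]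
    simp only [h1, Finset.sum_ite_irrel, Finset.sum_const_zero, h2, Matrix.one_apply,
      Prod.mk.injEq]
    by_cases h3 : x₁ = y₁ <;> by_cases h4 : x₂ = y₂ <;> simp [h3, h4]
  · intro p q
    exact hσ3 q
  · simp only [star_mul, Finset.sum_const, Finset.card_univ, Fintype.card_prod, Fintype.card_fin,
      nsmul_eq_mul, hk, Nat.cast_mul, Nat.cast_pow]
    have h1 : c * c * (star c * star c) = (d : ℂ)⁻¹ * (d : ℂ)⁻¹ := by rw [← hc]; ring
    rw [h1]
    field_simp
  · intro p q a' b' a b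
    rw [← hNU p]
    have h1 : ∀ x₁ x₂, (Matrix.of (fun a x => star (σ q a x)) *
        Matrix.of fun x (q : Fin d × Fin d × Fin d) => if x = q.2.2 then c * σ p q.1 q.2.1 else 0)
        a' (a, x₁, x₂) = star (σ q a' x₂) * (c * σ p a x₁) := by
      intro x₁ x₂
      simp [Matrix.mul_apply]
    simp only [Fintype.sum_prod_type, h1, Matrix.of_apply]
    rw [Finset.mul_sum]
    refine Finset.sum_congr rfl fun x₁ _ => ?_
    have h2 : ∀ x₂, star (σ q a' x₂) * (c * σ p a x₁) *
        (c * ∑ i, σ q i x₂ * N p (i, b') (x₁, b)) =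
        ∑ i, c * c * (N p (i, b') (x₁, b) * σ p a x₁) * (star (σ q a' x₂) * σ q i x₂) := by
      intro x₂
      rw [Finset.mul_sum, Finset.mul_sum]
      exact Finset.sum_congr rfl fun i _ => by ring
    simp only [h2]
    rw [Finset.sum_comm]
    simp only [← Finset.mul_sum, hσ1, mul_ite, mul_one, mul_zero, Finset.sum_ite_eq,
      Finset.mem_univ, if_true]

end Protocols

/-! ### Exchanging the parties -/

section Swap

theorem mul_submatrix_swap_mul {A B C D : Type} [Fintype A] [Fintype B]
    (M : Matrix (C × D) (A × B) ℂ) (ρ : Matrix (B × A) (B × A) ℂ) :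
    M * ρ.submatrix Prod.swap Prod.swap * M.conjTranspose =
      (M.submatrix Prod.swap Prod.swap * ρ *
        (M.submatrix Prod.swap Prod.swap).conjTranspose).submatrix Prod.swap Prod.swap := by
  change _ = (M.submatrix Prod.swap (Equiv.prodComm B A) *
    (ρ.submatrix Prod.swap Prod.swap).submatrix (Equiv.prodComm B A) (Equiv.prodComm B A) *
    M.conjTranspose.submatrix (Equiv.prodComm B A) Prod.swap).submatrix _ _
  rw [Matrix.submatrix_mul_equiv, Matrix.submatrix_mul_equiv]
  exact (Matrix.submatrix_id_id _).symm

theorem kronecker_submatrix_swap {A B C D : Type} (M : Matrix A B ℂ) (N : Matrix C D ℂ) :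
    (M ⊗ₖ N).submatrix Prod.swap Prod.swap = N ⊗ₖ M := by
  ext ⟨_, _⟩ ⟨_, _⟩
  simp [mul_comm]

/-- Exchanging the roles of the two parties. -/
theorem IsLOCC.swap {A' B' A B : Type}
    {Λ : Matrix (A × B) (A × B) ℂ → Matrix (A' × B') (A' × B') ℂ} (h : IsLOCC Λ) :
    IsLOCC fun ρ : Matrix (B × A) (B × A) ℂ =>
      (Λ (ρ.submatrix Prod.swap Prod.swap)).submatrix Prod.swap Prod.swap := by
  induction h with
  | done => exact IsLOCC.done
  | alice K hK Λ hΛ ih =>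
    convert IsLOCC.bob K hK _ ih using 2 with ρ
    ext p q
    simp only [mul_submatrix_swap_mul, kronecker_submatrix_swap, Matrix.submatrix_apply,
      Matrix.sum_apply]
  | bob K hK Λ hΛ ih =>
    convert IsLOCC.alice K hK _ ih using 2 with ρ
    ext p q
    simp only [mul_submatrix_swap_mul, kronecker_submatrix_swap, Matrix.submatrix_apply,
      Matrix.sum_apply]

/-- Exchange the parties in the protocol; the resource `|Ψ_k⟩` is symmetric. -/
theorem ImplementableByLOCC.of_swap {A B : Type} [Fintype A] [Fintype B]
    {U : Matrix (A × B) (A × B) ℂ} {k : ℕ}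
    (h : ImplementableByLOCC (U.submatrix Prod.swap Prod.swap) k) : ImplementableByLOCC U k := by
  obtain ⟨Λ, hΛ, h⟩ := h
  refine ⟨_, hΛ.swap, fun ρ => ?_⟩
  have h1 : (bipartiteTensor ρ (maxEntangledState k)).submatrix Prod.swap Prod.swap =
      bipartiteTensor (ρ.submatrix Prod.swap Prod.swap) (maxEntangledState k) := by
    ext ⟨⟨b, y⟩, a, x⟩ ⟨⟨b', y'⟩, a', x'⟩
    simp [bipartiteTensor, maxEntangledState, Matrix.vecMulVec_apply, maxEntangledKet, eq_comm]
  rw [h1, h, mul_submatrix_swap_mul]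
  simp only [Matrix.submatrix_submatrix, Prod.swap_swap_eq, Matrix.submatrix_id_id]

end Swap

/-! ### From matrices to linear maps and back -/

section Matrix

theorem inner_eq_sum_star_mul {ι : Type*} [Fintype ι] (x y : EuclideanSpace ℂ ι) :
    inner ℂ x y = ∑ i, star (x i) * y i := by
  simp [PiLp.inner_apply, mul_comm]

theorem sum_kronecker_apply {A B : Type} {ι : Type*} [Fintype ι] (S : ι → Matrix A A ℂ)
    (T : ι → Matrix B B ℂ) (a' : A) (b' : B) (a : A) (b : B) :
    (∑ l, S l ⊗ₖ T l) (a', b') (a, b) = ∑ l, S l a' a * T l b' b := by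
  simp [Matrix.sum_apply]

variable {A B : Type} [Fintype A] [Fintype B] [DecidableEq A] [DecidableEq B]

/-- The product vector `a ⊗ v` is modelled by the function `w a v` on `A × B`, on which unitarity of
the matrix can be used directly. -/
theorem isometricSum_toEuclideanLin {ι : Type*} [Fintype ι] {S : ι → Matrix A A ℂ}
    {T : ι → Matrix B B ℂ}
    (hU : (∑ l, S l ⊗ₖ T l).conjTranspose * (∑ l, S l ⊗ₖ T l) = 1) :
    IsometricSum (fun l => Matrix.toEuclideanLin (S l)) fun l => Matrix.toEuclideanLin (T l) := by
  intro a a' v v'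
  set U := ∑ l, S l ⊗ₖ T l with hUdef
  let w : EuclideanSpace ℂ A → EuclideanSpace ℂ B → A × B → ℂ := fun a v p => a p.1 * v p.2
  have hw : ∀ a v p, U.mulVec (w a v) p =
      ∑ l, Matrix.toEuclideanLin (S l) a p.1 * Matrix.toEuclideanLin (T l) v p.2 := by
    rintro a v ⟨x, y⟩
    simp only [Matrix.mulVec, dotProduct, Fintype.sum_prod_type, w, hUdef, sum_kronecker_apply,
      Matrix.toLpLin_apply, Finset.sum_mul, Finset.mul_sum]
    rw [Finset.sum_comm_cycle]
    refine Finset.sum_congr rfl fun l _ => ?_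
    rw [Finset.sum_comm]
    exact Finset.sum_congr rfl fun i _ => Finset.sum_congr rfl fun j _ => by ring
  have h1 : ∑ p, star (U.mulVec (w a v) p) * U.mulVec (w a' v') p =
      ∑ p, star (w a v p) * w a' v' p := by
    change star (U.mulVec (w a v)) ⬝ᵥ U.mulVec (w a' v') = star (w a v) ⬝ᵥ w a' v'
    rw [Matrix.star_mulVec, Matrix.dotProduct_mulVec, Matrix.vecMul_vecMul, hU, Matrix.vecMul_one]
  have h3 : ∀ (a a' : EuclideanSpace ℂ A) (v v' : EuclideanSpace ℂ B),
      inner ℂ a a' * inner ℂ v v' = ∑ p : A × B, star (a p.1 * v p.2) * (a' p.1 * v' p.2) := by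
    intro a a' v v'
    rw [inner_eq_sum_star_mul, inner_eq_sum_star_mul, Finset.sum_mul_sum, Fintype.sum_prod_type]
    exact Finset.sum_congr rfl fun i _ => Finset.sum_congr rfl fun j _ => by
      simp only [star_mul]; ring
  rw [h3 a a', ← h1]
  simp only [hw, h3, star_sum, Finset.sum_mul_sum]
  rw [Finset.sum_comm (s := (Finset.univ : Finset (A × B)))]
  exact Finset.sum_congr rfl fun l _ => Finset.sum_comm

/-- A unitary with simultaneously diagonal factors on Alice's side is controlled by Alice. -/
theorem implementableByLOCC_of_simDiag {ι : Type*} [Fintype ι] {S : ι → Matrix A A ℂ}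
    {T : ι → Matrix B B ℂ}
    (hU : (∑ l, S l ⊗ₖ T l).conjTranspose * (∑ l, S l ⊗ₖ T l) = 1)
    (hS : SimDiag fun l => Matrix.toEuclideanLin (S l)) {k : ℕ} [NeZero k] (j : A ↪ Fin k) :
    ImplementableByLOCC (∑ l, S l ⊗ₖ T l) k := by
  obtain ⟨n, f₀, g₀, hfg⟩ := hS
  choose c₀ hc₀ using hfg
  have hn : Fintype.card (Fin n) = Fintype.card A := by
    rw [← finrank_eq_card_basis f₀.toBasis, finrank_euclideanSpace]
  let e := Fintype.equivOfCardEq hn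
  let f := f₀.reindex e
  let g := g₀.reindex e
  let c : ι → A → ℂ := fun l i => c₀ l (e.symm i)
  have hc : ∀ l i, Matrix.toEuclideanLin (S l) (f i) = c l i • g i := by
    intro l i
    simpa [f, g] using hc₀ l (e.symm i)
  clear_value f g c
  let G : Matrix A A ℂ := Matrix.of fun a i => g i a
  let H : Matrix A A ℂ := Matrix.of fun a i => f i a
  have hunit : ∀ f : OrthonormalBasis A ℂ (EuclideanSpace ℂ A),
      (Matrix.of fun a i => f i a).conjTranspose * (Matrix.of fun a i => f i a) = 1 := by
    intro f
    ext i i'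
    have := orthonormal_iff_ite.1 f.orthonormal i i'
    rw [inner_eq_sum_star_mul] at this
    simpa [Matrix.mul_apply, Matrix.one_apply] using this
  have hG : G.conjTranspose * G = 1 := hunit g
  have hH : H.conjTranspose * H = 1 := hunit f
  have hG' : G * G.conjTranspose = 1 := mul_eq_one_comm.1 hG
  have hH' : H * H.conjTranspose = 1 := mul_eq_one_comm.1 hH
  have hSH : ∀ l, S l * H = G * Matrix.diagonal (c l) := by
    intro l
    ext a i
    have := congrArg (fun x : EuclideanSpace ℂ A => x a) (hc l i)
    rw [Matrix.mul_diagonal]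
    simpa [Matrix.mul_apply, Matrix.toLpLin_apply, Matrix.mulVec, dotProduct, H, G, mul_comm]
      using this
  let V : A → Matrix B B ℂ := fun i => ∑ l, c l i • T l
  refine implementableByLOCC_of_controlled j (V := V) hG hH' (fun i => ?_) fun a' b' a b => ?_
  -- In the two bases `U` becomes block diagonal with blocks `V i`, so unitarity passes to each
  -- block.
  · let M := (G.conjTranspose ⊗ₖ (1 : Matrix B B ℂ)) * (∑ l, S l ⊗ₖ T l) *
      (H ⊗ₖ (1 : Matrix B B ℂ))
    have hM : M.conjTranspose * M = 1 := by
      simp only [M, Matrix.conjTranspose_mul, Matrix.conjTranspose_kronecker,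
        Matrix.conjTranspose_conjTranspose, Matrix.conjTranspose_one, Matrix.mul_assoc]
      rw [← Matrix.mul_assoc (G ⊗ₖ _), ← Matrix.mul_kronecker_mul, hG', Matrix.one_mul,
        Matrix.one_kronecker_one, Matrix.one_mul, ← Matrix.mul_assoc _ _ (H ⊗ₖ _), hU,
        Matrix.one_mul, ← Matrix.mul_kronecker_mul, hH, Matrix.one_mul, Matrix.one_kronecker_one]
    have hMV : ∀ i b i' b', M (i, b) (i', b') = if i = i' then V i b b' else 0 := by
      intro i b i' b'
      have h1 : M = ∑ l, Matrix.diagonal (c l) ⊗ₖ T l := by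
        simp only [M, Matrix.mul_sum, Matrix.sum_mul]
        refine Finset.sum_congr rfl fun l _ => ?_
        rw [← Matrix.mul_kronecker_mul, ← Matrix.mul_kronecker_mul, Matrix.one_mul, Matrix.mul_one,
          Matrix.mul_assoc, hSH, ← Matrix.mul_assoc, hG, Matrix.one_mul]
      rw [h1, sum_kronecker_apply]
      by_cases hi : i = i'
      · subst hi
        simp [V, Matrix.sum_apply]
      · simp [hi]
    ext b b'
    have h1 := congrFun (congrFun hM (i, b)) (i, b')
    simp only [Matrix.mul_apply, Matrix.conjTranspose_apply, Fintype.sum_prod_type, hMV] at h1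
    simpa [Matrix.mul_apply, Matrix.one_apply, apply_ite star, Finset.sum_ite_irrel] using h1
  · have h1 : ∀ l, S l = G * Matrix.diagonal (c l) * H.conjTranspose := by
      intro l
      rw [← hSH, Matrix.mul_assoc, hH', Matrix.mul_one]
    have h2 : ∀ l, S l a' a = ∑ i, G a' i * c l i * star (H a i) := by
      intro l
      rw [h1, Matrix.mul_apply]
      simp [Matrix.mul_diagonal]
    rw [sum_kronecker_apply]
    simp only [h2, V, Matrix.sum_apply, Matrix.smul_apply, smul_eq_mul, Finset.sum_mul,
      Finset.mul_sum]
    rw [Finset.sum_comm]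
    exact Finset.sum_congr rfl fun i _ => Finset.sum_congr rfl fun j _ => by ring

end Matrix

/-! ### The theorem -/

theorem lemma4p3 (dA dB : ℕ) (hdA : dA = 2 ∨ dA = 3) (hAB : dA ≤ dB)
    (U : Matrix (Fin dA × Fin dB) (Fin dA × Fin dB) ℂ)
    (hU : U ∈ Matrix.unitaryGroup (Fin dA × Fin dB) ℂ)
    (hrank : HasSchmidtRank U 3) :
    ImplementableByLOCC U (min (dA ^ 2) dB) := by
  have : NeZero dA := ⟨by lia⟩
  have : NeZero dB := ⟨by lia⟩
  have hU' : U.conjTranspose * U = 1 := Matrix.mem_unitaryGroup_iff'.1 hU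
  rcases Nat.le_or_ge (dA ^ 2) dB with hd | hd
  · exact implementableByLOCC_of_unitary (min_eq_left hd) hU'
  rw [min_eq_right hd]
  obtain ⟨S, T, hS, hT, rfl⟩ := hrank
  have hiso := isometricSum_toEuclideanLin hU'
  have hS' : LinearIndependent ℂ fun l => Matrix.toEuclideanLin (S l) :=
    hS.map' Matrix.toEuclideanLin.toLinearMap (LinearEquiv.ker _)
  have key : (SimDiag fun l => Matrix.toEuclideanLin (S l)) ∨
      SimDiag fun l => Matrix.toEuclideanLin (T l) := by
    rcases hdA with rfl | rfl
    · exact Or.inr (hiso.simDiag_of_finrank_eq_two (by simp) (by simp) rfl hS')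
    · exact IsometricSum.simDiag_or_simDiag (by simp) (by simp) hS' dB _ _ _ hiso (by simp)
        (by simp)
  rcases key with h | h
  -- Control by Alice: her `dA` control values embed in the `dB` levels of the resource. Control by
  -- Bob, below, uses all of them.
  · exact implementableByLOCC_of_simDiag hU' h (Fin.castLEEmb hAB)
  · have hswap : (∑ l, S l ⊗ₖ T l).submatrix Prod.swap Prod.swap = ∑ l, T l ⊗ₖ S l := by
      ext ⟨b, a⟩ ⟨b', a'⟩
      simp [Matrix.sum_apply, mul_comm]
    refine ImplementableByLOCC.of_swap ?_
    rw [hswap]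
    refine implementableByLOCC_of_simDiag ?_ h (Function.Embedding.refl _)
    rw [← hswap, Matrix.conjTranspose_submatrix]
    have := Matrix.submatrix_mul_equiv (∑ l, S l ⊗ₖ T l).conjTranspose (∑ l, S l ⊗ₖ T l)
      Prod.swap (Equiv.prodComm (Fin dB) (Fin dA)) Prod.swap
    rw [hU', Matrix.submatrix_one _ Prod.swap_injective] at this
    exact this
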